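/- **Definitions.** Let $\mathcal S'(\mathbb R)$ be the space of tempered distributions on $\mathbb R$, with Fourier transform $\int\widehat\sigma f\,dx=\int\sigma\widehat f\,dx$, $\widehat f(y)=\int_{\mathbb R} f(x)e^{-2\pi ixy}dx$. For $\delta\in\mathbb Z/2\mathbb Z$ (represented by $0$ or $1$), $\mathcal S'_\delta(\mathbb R)$ is the subspace of those $\sigma$ with $\sigma(-x)=(-1)^\delta\sigma(x)$. A distribution $\sigma$ defined near $0\in\mathbb R$ *vanishes to order $k\ge 0$ at $0$* if on some open neighborhood of $0$ it is a finite sum $\sigma=\sum_j f_jD_jh_j$, where $f_j$ is $C^\infty$ and vanishes to order $k$ at $0$, $h_j\in L^\infty_{\rm loc}$, and $D_j$ is a linear differential operator with $C^\infty$ coefficients which is tangential to $\{0\}$, i.e. preserves every power of the ideal of smooth functions vanishing at $0$. It vanishes to order $-k$ ($k>0$) if $x^k\sigma$ vanishes to order $0$, and to infinite order if it vanishes to order $k$ for all $k\ge0$. Vanishing at $\infty\in\mathbb R\cup\{\infty\}$ is defined in the same way in the coordinate $y=1/x$, where distributions transform like functions. A distribution $\sigma$ on $\mathbb R$ *extends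 canonically across $\infty$* if it extends to a distribution on $\mathbb R\cup\{\infty\}$ which vanishes to infinite order at $\infty$. Let $\sigma$ be a distribution on $\mathbb R$ which vanishes to order $k_0\in\mathbb Z$ at $0$ and has an extension across $\infty$ vanishing to order $k_\infty\in\mathbb Z$ there, with $k_0+k_\infty\ge1$. For $-k_0<\operatorname{Re}s<k_\infty$ the signed Mellin transform is $$M_\delta\sigma(s)=\int_{\mathbb R\cup\{\infty\}}(\operatorname{sgn}x)^\delta|x|^{s-1}\sigma(x)\,dx ,$$ where the integrand is extended across $0$ as follows, and across $\infty$ in the same way in the coordinate $y=1/x$, in which it equals $(\operatorname{sgn}y)^\delta|y|^{-s-1}\sigma(1/y)\,dy$. If $\tau$ vanishes to order $k$ at $0$, then $(\operatorname{sgn}x)^\delta|x|^{\alpha}\tau$, for $\operatorname{Re}\alpha>-k-1$, is extended across $0$ by the unique family of distributions which is holomorphic in $\alpha$ and vanishes at $0$ to every integral order $\ell$ with $0\le\ell\le\operatorname{Re}\alpha+k$. The value $M_\delta\sigma(s)$ does not depend on the choices of $k_0$, $k_\infty$ and of the extension of $\sigma$. Finally let $$G_\delta(s)=2\,i^\delta(2\pi)^{-s}\,\Gamma(s)\cos\bigl(\pi(s-\delta)/2\bigr).$$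 **Theorem.** (a) Let $\delta\in\mathbb Z/2\mathbb Z$ and let $\sigma\in\mathcal S'(\mathbb R)$ vanish to infinite order at $0$. Then there is a real number $A$ such that for $\operatorname{Re}s>A$ both $M_\delta\widehat\sigma(s)$ and $M_\delta\sigma(1-s)$ are defined and $$M_\delta\widehat\sigma(s)=(-1)^\delta\,G_\delta(s)\,M_\delta\sigma(1-s).$$ (b) Let $\sigma\in\mathcal S'_\delta(\mathbb R)$ extend canonically across $\infty$ and vanish to order $k_0\ge1$ at $0$. Then $M_\delta\sigma(1-s)$ is defined for $\operatorname{Re}s<1$, and $\widehat\sigma$ vanishes to infinite order at $0$ if and only if the meromorphic function $G_\delta(s)\,M_\delta\sigma(1-s)$ has no poles in $\{\operatorname{Re}s<1\}$. When that is the case, $M_\delta\widehat\sigma(s)$ is defined for $\operatorname{Re}s<1$, and $M_\delta\widehat\sigma(s)=(-1)^\delta G_\delta(s)\,M_\delta\sigma(1-s)$ there; at the non-positive integers $s$, where $\Gamma$ has poles, the right hand side is understood as the limit, i.e. with its removable singularity removed. -/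

import Mathlib

open Filter Topology MeasureTheory
open scoped Distributions SchwartzMap FourierTransform ContDiff

noncomputable section

namespace SignedMellin

/-- Complex valued test functions on `ℝ`: smooth, with compact support. -/
abbrev TestFun : Type := 𝓓((⊤ : TopologicalSpace.Opens ℝ), ℂ)

/-- Complex valued distributions on `ℝ`; the value `T f` is the integral `∫ T(x) f(x) dx`. -/
abbrev Distr : Type := TestFun →L[ℂ] ℂ

/-- Multiplication by a smooth function, as an operator on test functions. -/
def mulTest (a : ℝ → ℂ) (ha : ContDiff ℝ ∞ a) : TestFun →L[ℂ] TestFun :=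
  TestFunction.limitCLM ℂ
    (fun f : TestFun => (⟨fun x => f x * a x, f.contDiff.mul ha,
      f.hasCompactSupport.mul_right, fun _ _ => trivial⟩ : TestFun))
    (fun _ hK => (TestFunction.ofSupportedInCLM ℂ hK).comp
      (ContDiffMapSupportedIn.bilinLeftCLM (ContinuousLinearMap.mul ℂ ℂ) ha))
    (fun _ _ f => by ext x; simp [ContDiffMapSupportedIn.bilinLeftCLM_apply])

theorem mulTest_apply (a : ℝ → ℂ) (ha : ContDiff ℝ ∞ a) (f : TestFun) (x : ℝ) :
    mulTest a ha f x = f x * a x := rfl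

theorem contDiff_ofReal_pow (n : ℕ) : ContDiff ℝ ∞ (fun x : ℝ => (x : ℂ) ^ n) :=
  Complex.ofRealCLM.contDiff.pow n

/-- The product `x ^ n * T(x)`. -/
def mulPow (n : ℕ) (T : Distr) : Distr :=
  T.comp (mulTest (fun x : ℝ => (x : ℂ) ^ n) (contDiff_ofReal_pow n))

/-- Smooth functions supported in a fixed compact set, as Schwartz functions. -/
def supportedToSchwartz (K : TopologicalSpace.Compacts ℝ) :
    𝓓^{(⊤ : ℕ∞)}_{K}(ℝ, ℂ) →ₗ[ℂ] 𝓢(ℝ, ℂ) where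
  toFun f := f.hasCompactSupport.toSchwartzMap f.contDiff
  map_add' _ _ := rfl
  map_smul' _ _ := rfl

theorem continuous_supportedToSchwartz (K : TopologicalSpace.Compacts ℝ) :
    Continuous (supportedToSchwartz K) := by
  refine WithSeminorms.continuous_of_isBounded
    (ContDiffMapSupportedIn.withSeminorms ℂ ℝ ℂ ⊤ K) (schwartz_withSeminorms ℂ ℝ ℂ) _ ?_
  rintro ⟨k, n⟩
  obtain ⟨R, hR⟩ := K.isCompact.isBounded.exists_norm_le
  have hC : 0 ≤ (max R 0) ^ k := pow_nonneg (le_max_right R 0) k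
  refine ⟨{n}, ⟨(max R 0) ^ k, hC⟩, fun f => ?_⟩
  have key : SchwartzMap.seminorm ℂ k n (supportedToSchwartz K f) ≤
      (max R 0) ^ k * ContDiffMapSupportedIn.seminorm ℂ ℝ ℂ ⊤ K n f := by
    refine SchwartzMap.seminorm_le_bound ℂ k n _ (mul_nonneg hC (apply_nonneg _ _)) fun x => ?_
    have hd := ContDiffMapSupportedIn.norm_iteratedFDeriv_apply_le_seminorm_top
      (𝕜 := ℂ) (i := n) (f := f) (x := x)
    change ‖x‖ ^ k * ‖iteratedFDeriv ℝ n f x‖ ≤ _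
    by_cases hx : x ∈ K
    · exact mul_le_mul (pow_le_pow_left₀ (norm_nonneg _) ((hR x hx).trans (le_max_left _ _)) k)
        hd (norm_nonneg _) hC
    · have h0 : iteratedFDeriv ℝ n f x = 0 := f.iteratedFDeriv_zero_on_compl hx
      rw [h0, norm_zero, mul_zero]
      exact mul_nonneg hC (apply_nonneg _ _)
  simp only [Finset.sup_singleton]
  exact key

/-- The inclusion of the space of test functions into the Schwartz space. -/
def testToSchwartz : TestFun →L[ℂ] 𝓢(ℝ, ℂ) :=
  TestFunction.mkCLM ℂ (fun f : TestFun => f.hasCompactSupport.toSchwartzMap f.contDiff)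
    (fun _ _ => rfl) (fun _ _ => rfl) (fun K _ => continuous_supportedToSchwartz K)

theorem testToSchwartz_apply (f : TestFun) (x : ℝ) : testToSchwartz f x = f x := rfl

/-- The distribution on `ℝ` underlying a tempered distribution. -/
def toDistr (σ : 𝓢'(ℝ, ℂ)) : Distr where
  toFun f := σ (testToSchwartz f)
  map_add' f g := by simp
  map_smul' c f := by simp
  cont := by
    have h : Continuous (fun g : 𝓢(ℝ, ℂ) => σ g) := map_continuous σ
    exact h.comp testToSchwartz.continuous

/-! ### Order of vanishing of a distribution at the origin -/

/-- `u` is, on the neighborhood `U` of `0`, a section of the `k`-th power of the ideal of smooth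
functions vanishing at `0`; that is, `u` is smooth and vanishes to order `k` at `0`. -/
def MemIdealPow (U : Set ℝ) (k : ℕ) (u : ℝ → ℂ) : Prop :=
  ∃ v : ℝ → ℂ, ContDiffOn ℝ ∞ v U ∧ ∀ x ∈ U, u x = (x : ℂ) ^ k * v x

/-- A linear differential expression `∑ i ≤ order, coeff i * (d/dx) ^ i`. -/
structure DiffOp where
  /-- a bound for the order -/
  order : ℕ
  /-- the coefficients -/
  coeff : ℕ → ℝ → ℂ

/-- `D u = ∑ i, coeff i * u^(i)`. -/
def DiffOp.apply (D : DiffOp) (u : ℝ → ℂ) (x : ℝ) : ℂ :=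
  ∑ i ∈ Finset.range (D.order + 1), D.coeff i x * iteratedDeriv i u x

/-- The formal transpose `∑ i, (-1)^i (d/dx)^i (coeff i * u)`. -/
def DiffOp.transpose (D : DiffOp) (u : ℝ → ℂ) (x : ℝ) : ℂ :=
  ∑ i ∈ Finset.range (D.order + 1),
    (-1 : ℂ) ^ i * iteratedDeriv i (fun y => D.coeff i y * u y) x

/-- `D` has smooth coefficients on `U`. -/
def DiffOp.SmoothOn (D : DiffOp) (U : Set ℝ) : Prop :=
  ∀ i ≤ D.order, ContDiffOn ℝ ∞ (D.coeff i) U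

/-- `D` is tangential to `{0}` on `U`: it preserves every power of the ideal of `{0}`. -/
def DiffOp.TangentialOn (D : DiffOp) (U : Set ℝ) : Prop :=
  ∀ (k : ℕ) (u : ℝ → ℂ), MemIdealPow U k u → MemIdealPow U k (D.apply u)

/-- `h` is measurable and locally bounded on `U`, i.e. of class `L^∞_loc`. -/
def LocallyBoundedOn (U : Set ℝ) (h : ℝ → ℂ) : Prop :=
  ∀ K ⊆ U, IsCompact K → MemLp h ⊤ (volume.restrict K)

/-- The distribution `T` vanishes to order `k ≥ 0` at `0`: near `0` it is a finite sum
`∑ j, f j * D j (h j)`, in the sense of distributions, with `f j` smooth and vanishing to order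
`k` at `0`, `D j` a differential operator tangential to `{0}`, and `h j` locally bounded. -/
def VanishesToNatOrder (T : Distr) (k : ℕ) : Prop :=
  ∃ U : Set ℝ, IsOpen U ∧ (0 : ℝ) ∈ U ∧
    ∃ (N : ℕ) (f : Fin N → ℝ → ℂ) (D : Fin N → DiffOp) (h : Fin N → ℝ → ℂ),
      (∀ j, MemIdealPow U k (f j)) ∧
      (∀ j, (D j).SmoothOn U) ∧ (∀ j, (D j).TangentialOn U) ∧
      (∀ j, LocallyBoundedOn U (h j)) ∧
      ∀ g : TestFun, tsupport g ⊆ U →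
        T g = ∑ j, ∫ x, h j x * (D j).transpose (fun y => f j y * g y) x

/-- The distribution `T` vanishes to order `k ∈ ℤ` at `0`. For negative `k = -n` this means that
`x ^ n * T` vanishes to order `0`. -/
def VanishesToOrder (T : Distr) : ℤ → Prop
  | Int.ofNat k => VanishesToNatOrder T k
  | Int.negSucc n => VanishesToNatOrder (mulPow (n + 1) T) 0

/-- The distribution `T` vanishes to infinite order at `0`. -/
def VanishesToInfiniteOrder (T : Distr) : Prop :=
  ∀ k : ℕ, VanishesToNatOrder T k

/-! ### Extension across infinity -/

/-- `T` is a distribution in the coordinate `y = 1 / x` on `(ℝ ∪ {∞}) \ {0}`, defined also at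
`y = 0`, i.e. at `x = ∞`, which agrees with `S` on the complement of `{0, ∞}`, that is
`T(y) = S(1 / y)` for `y ≠ 0`. (Distributions transform like functions, hence the Jacobian.)
Such `T` are the extensions of `S` to a distribution on `ℝ ∪ {∞}`. -/
def IsExtensionAcrossInfinity (S T : Distr) : Prop :=
  ∀ f g : TestFun, (0 : ℝ) ∉ tsupport f → (∀ x : ℝ, g x = ((x : ℂ) ^ 2)⁻¹ * f x⁻¹) →
    T f = S g

/-- `S` has a canonical extension across `∞`: an extension to `ℝ ∪ {∞}` which vanishes to infinite
order at `∞`. -/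
def ExtendsCanonically (S : Distr) : Prop :=
  ∃ T : Distr, IsExtensionAcrossInfinity S T ∧ VanishesToInfiniteOrder T

/-! ### The signed Mellin transform -/

/-- The function `(sgn x) ^ δ * |x| ^ α`, for `x ≠ 0`. -/
def signedPower (δ : ZMod 2) (α : ℂ) (x : ℝ) : ℂ :=
  (Real.sign x : ℂ) ^ δ.val * ((|x| : ℝ) : ℂ) ^ α

/-- For a distribution `T` vanishing to order `k` at `0`, the family `E α`, `Re α > - k - 1`, is
the extension of `(sgn x) ^ δ * |x| ^ α * T(x)` from `ℝ \ {0}` to `ℝ` which depends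
holomorphically on `α` and vanishes at `0` to every order `0 ≤ ℓ ≤ Re α + k`. These conditions
determine `E α` uniquely. -/
structure IsPowerExtension (δ : ZMod 2) (T : Distr) (k : ℤ) (E : ℂ → Distr) : Prop where
  extends_off_zero : ∀ α : ℂ, -(k : ℝ) - 1 < α.re → ∀ f g : TestFun,
    (0 : ℝ) ∉ tsupport f → (∀ x : ℝ, g x = signedPower δ α x * f x) → E α f = T g
  holomorphic : ∀ f : TestFun,
    DifferentiableOn ℂ (fun α => E α f) {α : ℂ | -(k : ℝ) - 1 < α.re}
  vanishes : ∀ α : ℂ, -(k : ℝ) - 1 < α.re → ∀ l : ℕ, (l : ℝ) ≤ α.re + k →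
    VanishesToNatOrder (E α) l

/-- The signed Mellin transform `M_δ S(s) = ∫ (sgn x) ^ δ * |x| ^ (s - 1) * S(x) dx` is defined at
`s` and has the value `v` there. It is defined if `S` vanishes to order `k₀ ∈ ℤ` at `0` and has an
extension across `∞` vanishing to order `k₁ ∈ ℤ` at `∞`, with `-k₀ < Re s < k₁`. The integrand is
extended across `0` and across `∞`, where in the coordinate `y = 1 / x` it becomes
`(sgn y) ^ δ * |y| ^ (-s - 1) * S(1 / y) dy`; the integral over `ℝ ∪ {∞}` is then computed by means
of a partition of unity `φ(x) + ψ(1 / x) = 1`. -/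
def HasSignedMellin (δ : ZMod 2) (S : Distr) (s v : ℂ) : Prop :=
  ∃ (k₀ k₁ : ℤ) (T : Distr) (E₀ E₁ : ℂ → Distr) (φ ψ : TestFun),
    -(k₀ : ℝ) < s.re ∧ s.re < (k₁ : ℝ) ∧
    VanishesToOrder S k₀ ∧ IsExtensionAcrossInfinity S T ∧ VanishesToOrder T k₁ ∧
    IsPowerExtension δ S k₀ E₀ ∧ IsPowerExtension δ T k₁ E₁ ∧
    (∀ x : ℝ, x ≠ 0 → φ x + ψ x⁻¹ = 1) ∧
    v = E₀ (s - 1) φ + E₁ (-s - 1) ψ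

/-- The signed Mellin transform `M_δ S(s)` (an unspecified number where it is not defined). -/
def signedMellin (δ : ZMod 2) (S : Distr) (s : ℂ) : ℂ :=
  Classical.epsilon fun v => HasSignedMellin δ S s v

/-- The signed Mellin transform `M_δ S` is defined at the point `s`. -/
def MellinDefinedAt (δ : ZMod 2) (S : Distr) (s : ℂ) : Prop :=
  ∃! v : ℂ, HasSignedMellin δ S s v

/-! ### Parity, the factor `G_δ`, and regularity -/

/-- The tempered distribution `σ` has parity `δ`, i.e. `σ(-x) = (-1) ^ δ * σ(x)`. -/
def HasParity (δ : ZMod 2) (σ : 𝓢'(ℝ, ℂ)) : Prop :=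
  ∀ f g : 𝓢(ℝ, ℂ), (∀ x : ℝ, g x = f (-x)) → σ g = (-1 : ℂ) ^ δ.val * σ f

/-- `G_δ(s) = 2 i^δ (2π)^(-s) Γ(s) cos(π (s - δ) / 2)`. -/
def gammaFactor (δ : ZMod 2) (s : ℂ) : ℂ :=
  2 * Complex.I ^ δ.val * (2 * Real.pi : ℂ) ^ (-s) * Complex.Gamma s *
    Complex.cos (Real.pi * (s - (δ.val : ℂ)) / 2)

/-- The meromorphic function `F` has no poles in `U`. -/
def IsRegularOn (F : ℂ → ℂ) (U : Set ℂ) : Prop :=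
  ∀ s ∈ U, MeromorphicAt F s ∧ 0 ≤ meromorphicOrderAt F s

end SignedMellin

end

open SignedMellin

noncomputable section

namespace SignedMellin

/-! ### Calculus of polynomials in the Euler operator. -/

open scoped Polynomial

/-! Write E = x d/dx. Near 0, vanishing to order k means exactly that the distribution has the form
f ↦ Σ ∫ v_j p_j(E) f with polynomials p_j and measurable v_j = O(|x|^k) (`vanishesToNatOrder_iff`):
the i-th coefficient of a tangential operator is divisible by x^i, and (d/dx)^i x^i is a polynomial
in E. For tempered σ the structure theorem provides such a formula away from 0, and a partition of
unity glues it to the local formulas at 0 and at ∞. Orders k₀ and k₁ at the two points thus yield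
one formula, with v_j = O(|x|^k₀) at 0 and v_j = O(|x|^(-k₁)) at ∞
(`isEulerSum_of_vanishesToOrder`). It holds on test functions supported off 0. A distribution
supported at 0 and vanishing to order 0 there is zero (`eq_zero_of_vanishesToNatOrder`), so for k₀ ≥
0 the formula extends to all Schwartz functions (`apply_schwartz_of_offZero`).

Multiplication by a power |x|^α turns p(E) into p(E + α), and E kills constants. Hence M_δσ(s) is
the absolutely convergent expression Σ p_j(s-1) ∫ v_j (sgn x)^δ |x|^(s-1) dx
(`mellin_eq_mellinSum`). It is also a limit of values of σ on functions cut off to growing annuli,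
so none of the choices in the definition matters (`HasSignedMellin.unique`).

The functional equation `mellinSum_fourier` comes from dilations. Take a test function f supported
off 0, pair σ̂ with f(tx), and integrate against (sgn t)^δ |t|^(-s) dt. By Fubini this is M_δσ̂(s)
times the Mellin integral of f. Moving the Fourier transform onto f gives M_δσ(1-s) times the Mellin
integral of f̂ at s, and the local functional equation for f (`integral_fourier_mul_signedPower`)
contributes (-1)^δ G_δ(s).

For (a), divide the coefficients v_j by a high power x^k. Their Fourier transforms become bounded,
and σ̂ is obtained from them by k derivatives and Euler operators; this gives order -k at 0 and
order k at ∞ (`vanishesToOrder_fourier`). Some finite order of σ at ∞ is provided by division of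
tempered distributions by powers of the coordinate (`exists_extension`). Both transforms then exist
for large Re s.

For (b), k₀ ≥ 1 makes the argument work on 0 < Re s < 1 once σ̂ vanishes to order 0 at the origin.
If σ̂ vanishes to infinite order, the identity, multiplied by the entire function 1/Γ, continues to
Re s < 1, so the right hand side has no poles. Conversely, at s = -i with i ≡ δ mod 2 the cofactor
of Γ in G_δ is nonzero, so the absence of a pole forces M_δσ(1+i) = 0. This number is the i-th
moment of σ, and the moments of the other parity vanish by symmetry. Once all moments vanish, the
Fourier transforms of the v_j may be replaced by their Taylor remainders at 0, which are O(|y|^m)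
for every m (`vanishesToNatOrder_fourier_of_moments`). -/

/-- The Euler operator `x d/dx`. -/
def eulerOp (f : ℝ → ℂ) (x : ℝ) : ℂ := x * deriv f x

/-- The operator `p(x d/dx)` for a polynomial `p`. -/
def eulerPoly (p : ℂ[X]) (f : ℝ → ℂ) (x : ℝ) : ℂ :=
  p.sum fun i c => c * (eulerOp^[i] f) x

theorem eulerPoly_eq_sum_range (p : ℂ[X]) {n : ℕ} (hn : p.natDegree < n) (f : ℝ → ℂ) (x : ℝ) :
    eulerPoly p f x = ∑ i ∈ Finset.range n, p.coeff i * (eulerOp^[i] f) x :=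
  Polynomial.sum_over_range' p (by simp) n hn

theorem eulerPoly_add (p q : ℂ[X]) (f : ℝ → ℂ) (x : ℝ) :
    eulerPoly (p + q) f x = eulerPoly p f x + eulerPoly q f x :=
  Polynomial.sum_add_index p q _ (by simp) (by intros; ring)

theorem eulerPoly_C_mul (c : ℂ) (p : ℂ[X]) (f : ℝ → ℂ) (x : ℝ) :
    eulerPoly (Polynomial.C c * p) f x = c * eulerPoly p f x := by
  have h := Polynomial.natDegree_C_mul_le c p
  rw [eulerPoly_eq_sum_range _ (Nat.lt_succ_iff.2 h),
    eulerPoly_eq_sum_range p (Nat.lt_succ_self _), Finset.mul_sum]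
  simp only [Polynomial.coeff_C_mul, mul_assoc]

theorem eulerPoly_C (c : ℂ) (f : ℝ → ℂ) (x : ℝ) : eulerPoly (Polynomial.C c) f x = c * f x := by
  simp [eulerPoly]

theorem eulerPoly_one (f : ℝ → ℂ) (x : ℝ) : eulerPoly 1 f x = f x := by
  simpa using eulerPoly_C 1 f x

theorem eulerPoly_monomial (n : ℕ) (c : ℂ) (f : ℝ → ℂ) (x : ℝ) :
    eulerPoly (Polynomial.monomial n c) f x = c * (eulerOp^[n] f) x := by
  simp [eulerPoly]

theorem eulerPoly_mul_X (p : ℂ[X]) (f : ℝ → ℂ) (x : ℝ) :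
    eulerPoly (p * Polynomial.X) f x = eulerPoly p (eulerOp f) x := by
  induction p using Polynomial.induction_on' with
  | add p q hp hq => rw [add_mul, eulerPoly_add, eulerPoly_add, hp, hq]
  | monomial n a =>
    rw [Polynomial.monomial_mul_X, eulerPoly_monomial, eulerPoly_monomial, Function.iterate_succ,
      Function.comp_apply]

theorem eulerPoly_X (f : ℝ → ℂ) (x : ℝ) : eulerPoly Polynomial.X f x = eulerOp f x := by
  simpa [eulerPoly_one] using eulerPoly_mul_X 1 f x

theorem contDiff_eulerOp {f : ℝ → ℂ} (hf : ContDiff ℝ ∞ f) : ContDiff ℝ ∞ (eulerOp f) :=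
  Complex.ofRealCLM.contDiff.mul (hf.iterate_deriv 1)

theorem contDiff_iterate_eulerOp {f : ℝ → ℂ} (hf : ContDiff ℝ ∞ f) (n : ℕ) :
    ContDiff ℝ ∞ (eulerOp^[n] f) := by
  induction n generalizing f with
  | zero => exact hf
  | succ n ih => exact ih (contDiff_eulerOp hf)

theorem contDiff_eulerPoly (p : ℂ[X]) {f : ℝ → ℂ} (hf : ContDiff ℝ ∞ f) :
    ContDiff ℝ ∞ (eulerPoly p f) := by
  have : eulerPoly p f = fun x => ∑ i ∈ Finset.range (p.natDegree + 1),
      p.coeff i * (eulerOp^[i] f) x :=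
    funext fun x => eulerPoly_eq_sum_range p (Nat.lt_succ_self _) f x
  rw [this]
  exact ContDiff.sum fun i _ => contDiff_const.mul (contDiff_iterate_eulerOp hf i)

theorem eulerOp_add {f g : ℝ → ℂ} (hf : Differentiable ℝ f) (hg : Differentiable ℝ g) :
    eulerOp (fun x => f x + g x) = fun x => eulerOp f x + eulerOp g x := by
  funext x
  simp only [eulerOp]
  rw [show (fun x => f x + g x) = f + g from rfl, deriv_add (hf x) (hg x)]
  ring

theorem eulerOp_const_mul (c : ℂ) {f : ℝ → ℂ} (hf : Differentiable ℝ f) :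
    eulerOp (fun x => c * f x) = fun x => c * eulerOp f x := by
  funext x
  simp only [eulerOp]
  rw [deriv_const_mul _ (hf x)]
  ring

theorem differentiable_of_contDiff {f : ℝ → ℂ} (hf : ContDiff ℝ ∞ f) : Differentiable ℝ f :=
  hf.differentiable (by simp)

theorem eulerPoly_fun_add (p : ℂ[X]) {f g : ℝ → ℂ} (hf : ContDiff ℝ ∞ f) (hg : ContDiff ℝ ∞ g)
    (x : ℝ) : eulerPoly p (fun y => f y + g y) x = eulerPoly p f x + eulerPoly p g x := by
  have key : ∀ n : ℕ, ∀ f g : ℝ → ℂ, ContDiff ℝ ∞ f → ContDiff ℝ ∞ g →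
      eulerOp^[n] (fun y => f y + g y) = fun y => (eulerOp^[n] f) y + (eulerOp^[n] g) y := by
    intro n
    induction n with
    | zero => intros; rfl
    | succ n ih =>
      intro f g hf hg
      simp only [Function.iterate_succ, Function.comp_apply]
      rw [eulerOp_add (differentiable_of_contDiff hf) (differentiable_of_contDiff hg),
        ih _ _ (contDiff_eulerOp hf) (contDiff_eulerOp hg)]
  simp only [eulerPoly, key _ f g hf hg, Polynomial.sum, mul_add, Finset.sum_add_distrib]

theorem eulerPoly_fun_const_mul (p : ℂ[X]) (c : ℂ) {f : ℝ → ℂ} (hf : ContDiff ℝ ∞ f) (x : ℝ) :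
    eulerPoly p (fun y => c * f y) x = c * eulerPoly p f x := by
  have key : ∀ n : ℕ, ∀ f : ℝ → ℂ, ContDiff ℝ ∞ f →
      eulerOp^[n] (fun y => c * f y) = fun y => c * (eulerOp^[n] f) y := by
    intro n
    induction n with
    | zero => intros; rfl
    | succ n ih =>
      intro f hf
      simp only [Function.iterate_succ, Function.comp_apply]
      rw [eulerOp_const_mul c (differentiable_of_contDiff hf), ih _ (contDiff_eulerOp hf)]
  simp only [eulerPoly, key _ f hf, Polynomial.sum, Finset.mul_sum]
  exact Finset.sum_congr rfl fun i _ => by ring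

theorem eulerPoly_fun_sub (p : ℂ[X]) {f g : ℝ → ℂ} (hf : ContDiff ℝ ∞ f) (hg : ContDiff ℝ ∞ g)
    (x : ℝ) : eulerPoly p (fun y => f y - g y) x = eulerPoly p f x - eulerPoly p g x := by
  have h1 := eulerPoly_fun_add p hf (contDiff_const.mul hg : ContDiff ℝ ∞ fun y => (-1 : ℂ) * g y) x
  rw [eulerPoly_fun_const_mul p _ hg] at h1
  have h2 : (fun y => f y - g y) = fun y => f y + -1 * g y := by funext y; ring
  rw [h2, h1]; ring

/-- Smooth functions thereby form a module over ℂ[X] with X acting as E. Smoothness is what makes E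
additive on all the intermediate functions. -/
theorem eulerPoly_mul (p q : ℂ[X]) {f : ℝ → ℂ} (hf : ContDiff ℝ ∞ f) (x : ℝ) :
    eulerPoly (p * q) f x = eulerPoly p (eulerPoly q f) x := by
  induction q using Polynomial.induction_on' generalizing f x with
  | add q r hq hr =>
    rw [mul_add, eulerPoly_add, hq hf, hr hf,
      ← eulerPoly_fun_add p (contDiff_eulerPoly q hf) (contDiff_eulerPoly r hf)]
    congr 1
    funext y
    rw [eulerPoly_add]
  | monomial n a =>
    induction n generalizing f with
    | zero =>
      have : eulerPoly (Polynomial.monomial 0 a) f = fun y => a * f y := by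
        funext y; rw [eulerPoly_monomial]; rfl
      rw [this, eulerPoly_fun_const_mul p a hf, Polynomial.monomial_zero_left, mul_comm p,
        eulerPoly_C_mul]
    | succ n ih =>
      have : eulerPoly (Polynomial.monomial (n + 1) a) f
          = eulerPoly (Polynomial.monomial n a) (eulerOp f) := by
        funext y; rw [← Polynomial.monomial_mul_X, eulerPoly_mul_X]
      rw [this, ← ih (contDiff_eulerOp hf), ← Polynomial.monomial_mul_X, ← mul_assoc,
        eulerPoly_mul_X]

theorem eulerOp_congr_of_isOpen {U : Set ℝ} (hU : IsOpen U) {f g : ℝ → ℂ}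
    (h : ∀ x ∈ U, f x = g x) : ∀ x ∈ U, eulerOp f x = eulerOp g x := fun x hx => by
  have : f =ᶠ[𝓝 x] g := by
    filter_upwards [hU.mem_nhds hx] with y hy using h y hy
  simp only [eulerOp, this.deriv_eq]

theorem eulerPoly_congr_of_isOpen {U : Set ℝ} (hU : IsOpen U) (p : ℂ[X]) {f g : ℝ → ℂ}
    (h : ∀ x ∈ U, f x = g x) : ∀ x ∈ U, eulerPoly p f x = eulerPoly p g x := by
  have key : ∀ n : ℕ, ∀ f g : ℝ → ℂ, (∀ x ∈ U, f x = g x) →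
      ∀ x ∈ U, (eulerOp^[n] f) x = (eulerOp^[n] g) x := by
    intro n
    induction n with
    | zero => intro f g h; exact h
    | succ n ih => intro f g h; exact ih _ _ (eulerOp_congr_of_isOpen hU h)
  intro x hx
  simp only [eulerPoly, key _ f g h x hx]

theorem tsupport_eulerOp_subset (f : ℝ → ℂ) : tsupport (eulerOp f) ⊆ tsupport f := by
  refine closure_minimal (fun x hx => ?_) (isClosed_tsupport f)
  have : deriv f x ≠ 0 := fun h => hx (by simp [eulerOp, h])
  exact support_deriv_subset this

theorem eulerPoly_eq_zero_of_notMem_tsupport (p : ℂ[X]) {f : ℝ → ℂ} {x : ℝ}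
    (hx : x ∉ tsupport f) : eulerPoly p f x = 0 := by
  have key : ∀ n : ℕ, tsupport (eulerOp^[n] f) ⊆ tsupport f := by
    intro n
    induction n with
    | zero => exact subset_rfl
    | succ n ih =>
      rw [Function.iterate_succ_apply']
      exact (tsupport_eulerOp_subset _).trans ih
  have : ∀ n : ℕ, (eulerOp^[n] f) x = 0 := fun n =>
    image_eq_zero_of_notMem_tsupport fun h => hx (key n h)
  simp [eulerPoly, this, Polynomial.sum]

theorem tsupport_eulerPoly_subset (p : ℂ[X]) (f : ℝ → ℂ) :
    tsupport (eulerPoly p f) ⊆ tsupport f :=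
  closure_minimal (fun x hx => by
    by_contra h
    exact hx (eulerPoly_eq_zero_of_notMem_tsupport p h)) (isClosed_tsupport f)

/-- The polynomial `p(a X + b)`. -/
def affComp (p : ℂ[X]) (a b : ℂ) : ℂ[X] :=
  p.comp (Polynomial.C a * Polynomial.X + Polynomial.C b)

theorem eval_affComp (p : ℂ[X]) (a b z : ℂ) : (affComp p a b).eval z = p.eval (a * z + b) := by
  simp [affComp]

theorem affComp_affComp (p : ℂ[X]) (a b c d : ℂ) :
    affComp (affComp p a b) c d = affComp p (a * c) (a * d + b) := by
  simp only [affComp, Polynomial.comp_assoc]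
  congr 1
  simp
  ring

theorem affComp_one_zero (p : ℂ[X]) : affComp p 1 0 = p := by
  simp [affComp]

/-- If `x w' = b w` and `x m' = a m`, then `p(x d/dx)` turns `w * (G ∘ m)` into
`w * (p(a x d/dx + b) G) ∘ m`. -/
theorem eulerPoly_mul_comp {U : Set ℝ} (hU : IsOpen U) {w : ℝ → ℂ} {m : ℝ → ℝ} {a : ℝ} {b : ℂ}
    (hw : ∀ x ∈ U, ∃ w', HasDerivAt w w' x ∧ x * w' = b * w x)
    (hm : ∀ x ∈ U, ∃ m', HasDerivAt m m' x ∧ x * m' = a * m x)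
    (p : ℂ[X]) {F G : ℝ → ℂ} (hG : ContDiff ℝ ∞ G) (hFG : ∀ x ∈ U, F x = w x * G (m x)) :
    ∀ x ∈ U, eulerPoly p F x = w x * eulerPoly (affComp p a b) G (m x) := by
  have step : ∀ F G : ℝ → ℂ, ContDiff ℝ ∞ G → (∀ x ∈ U, F x = w x * G (m x)) →
      ∀ x ∈ U, eulerOp F x = w x * (a * eulerOp G (m x) + b * G (m x)) := by
    intro F G hG h x hx
    obtain ⟨w', hw1, hw2⟩ := hw x hx
    obtain ⟨m', hm1, hm2⟩ := hm x hx
    have hd : HasDerivAt (fun y => w y * G (m y)) (w' * G (m x) + w x * (m' • deriv G (m x))) x :=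
      hw1.mul ((differentiable_of_contDiff hG (m x)).hasDerivAt.scomp x hm1)
    rw [eulerOp_congr_of_isOpen hU h x hx, eulerOp, hd.deriv, eulerOp, Complex.real_smul]
    have hm3 : (x : ℂ) * m' = a * m x := by exact_mod_cast hm2
    linear_combination (G (m x)) * hw2 + w x * deriv G (m x) * hm3
  induction p using Polynomial.induction_on' with
  | add p q hp hq =>
    intro x hx
    have h1 : affComp (p + q) a b = affComp p a b + affComp q a b := by simp [affComp]
    rw [h1, eulerPoly_add, eulerPoly_add, hp x hx, hq x hx]
    ring
  | monomial n c =>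
    induction n generalizing F G with
    | zero =>
      intro x hx
      simp only [Polynomial.monomial_zero_left, affComp, Polynomial.C_comp, eulerPoly_C,
        hFG x hx]
      ring
    | succ n ih =>
      intro x hx
      have hG' : ContDiff ℝ ∞ (fun y => a * eulerOp G y + b * G y) :=
        (contDiff_const.mul (contDiff_eulerOp hG)).add (contDiff_const.mul hG)
      have h1 := ih hG' (step F G hG hFG) x hx
      rw [← Polynomial.monomial_mul_X, eulerPoly_mul_X, h1,
        eulerPoly_fun_add _ (contDiff_const.mul (contDiff_eulerOp hG)) (contDiff_const.mul hG),
        eulerPoly_fun_const_mul _ _ (contDiff_eulerOp hG), eulerPoly_fun_const_mul _ _ hG]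
      have h2 : affComp (Polynomial.monomial n c * Polynomial.X) a b
          = Polynomial.C (a : ℂ) * (affComp (Polynomial.monomial n c) a b * Polynomial.X)
            + Polynomial.C b * affComp (Polynomial.monomial n c) a b := by
        simp [affComp]; ring
      rw [h2, eulerPoly_add, eulerPoly_C_mul, eulerPoly_C_mul, eulerPoly_mul_X]

/-- E is a derivation, so its powers obey the binomial formula. Collecting the binomial coefficients
against the coefficients of p produces p^(i)/i!, the Hasse derivatives. This is how a smooth factor
is moved from the test function into the coefficient. -/
theorem eulerPoly_leibniz (p : ℂ[X]) {n : ℕ} (hn : p.natDegree < n) {f g : ℝ → ℂ}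
    (hf : ContDiff ℝ ∞ f) (hg : ContDiff ℝ ∞ g) (x : ℝ) :
    eulerPoly p (fun y => f y * g y) x =
      ∑ i ∈ Finset.range n, (eulerOp^[i] f) x * eulerPoly (Polynomial.hasseDeriv i p) g x := by
  have key : ∀ m : ℕ, ∀ x, (eulerOp^[m] fun y => f y * g y) x =
      ∑ i ∈ Finset.range (m + 1), (m.choose i : ℂ) * ((eulerOp^[i] f) x * (eulerOp^[m - i] g) x) := by
    intro m
    induction m with
    | zero => simp
    | succ m ih =>
      intro x
      rw [Function.iterate_succ_apply', funext ih]
      have hd : ∀ i, HasDerivAt (fun y => (m.choose i : ℂ) * ((eulerOp^[i] f) y * (eulerOp^[m - i] g) y))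
          ((m.choose i : ℂ) * (deriv (eulerOp^[i] f) x * (eulerOp^[m - i] g) x
            + (eulerOp^[i] f) x * deriv (eulerOp^[m - i] g) x)) x := fun i =>
        ((differentiable_of_contDiff (contDiff_iterate_eulerOp hf i) x).hasDerivAt.mul
          (differentiable_of_contDiff (contDiff_iterate_eulerOp hg _) x).hasDerivAt).const_mul _
      rw [eulerOp, (HasDerivAt.fun_sum fun i _ => hd i).deriv, Finset.mul_sum,
        Finset.sum_range_succ' _ (m + 1)]
      simp only [Nat.choose_succ_succ, Nat.cast_add, add_mul, Finset.sum_add_distrib]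
      have e1 : ∀ i, i ∈ Finset.range (m + 1) → (x : ℂ) * ((m.choose i : ℂ) *
          (deriv (eulerOp^[i] f) x * (eulerOp^[m - i] g) x
            + (eulerOp^[i] f) x * deriv (eulerOp^[m - i] g) x)) =
          (m.choose i : ℂ) * ((eulerOp^[i + 1] f) x * (eulerOp^[m + 1 - (i + 1)] g) x) +
          (m.choose i : ℂ) * ((eulerOp^[i] f) x * (eulerOp^[m + 1 - i] g) x) := by
        intro i hi
        have : i ≤ m := Nat.lt_succ_iff.1 (Finset.mem_range.1 hi)
        rw [show m + 1 - i = (m - i) + 1 by omega, show m + 1 - (i + 1) = m - i by omega,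
          Function.iterate_succ_apply', Function.iterate_succ_apply' _ (m - i)]
        simp only [eulerOp]
        ring
      rw [Finset.sum_congr rfl e1, Finset.sum_add_distrib, add_assoc]
      congr 1
      rw [Finset.sum_range_succ' _ m, Finset.sum_range_succ _ m]
      simp
  have e2 : ∀ i, eulerPoly (Polynomial.hasseDeriv i p) g x =
      ∑ m ∈ Finset.range n, p.coeff m * ((m.choose i : ℂ) * (eulerOp^[m - i] g) x) := by
    intro i
    have add : ∀ (s : Finset ℕ) (q : ℕ → ℂ[X]),
        eulerPoly (∑ m ∈ s, q m) g x = ∑ m ∈ s, eulerPoly (q m) g x := fun s q =>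
      map_sum (AddMonoidHom.mk' (fun q => eulerPoly q g x) fun p q => eulerPoly_add p q g x) q s
    rw [Polynomial.hasseDeriv_apply, Polynomial.sum_over_range' p (by simp) n hn, add]
    refine Finset.sum_congr rfl fun m _ => ?_
    rw [eulerPoly_monomial]
    ring
  rw [eulerPoly_eq_sum_range p hn]
  simp only [key, e2, Finset.mul_sum]
  conv_rhs => rw [Finset.sum_comm]
  refine Finset.sum_congr rfl fun m hm => ?_
  have hm' : m + 1 ≤ n := Finset.mem_range.1 hm
  rw [← Finset.sum_subset (Finset.range_mono hm')]
  · exact Finset.sum_congr rfl fun i _ => by ring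
  · intro i _ hi
    rw [Nat.choose_eq_zero_of_lt (by simpa using hi)]
    simp

theorem hasDerivAt_ofReal_pow (k : ℕ) (x : ℝ) :
    HasDerivAt (fun y : ℝ => (y : ℂ) ^ k) (k * (x : ℂ) ^ (k - 1)) x := by
  simpa using (hasDerivAt_id x).ofReal_comp.fun_pow k

theorem eulerOp_pow_mul (k : ℕ) {g : ℝ → ℂ} (hg : ContDiff ℝ ∞ g) (x : ℝ) :
    eulerOp (fun y => (y : ℂ) ^ k * g y) x = (x : ℂ) ^ k * (k * g x + eulerOp g x) := by
  have h : HasDerivAt (fun y : ℝ => (y : ℂ) ^ k * g y) _ x :=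
    (hasDerivAt_ofReal_pow k x).mul (differentiable_of_contDiff hg x).hasDerivAt
  rw [eulerOp, h.deriv, eulerOp]
  rcases k with _ | k
  · simp
  · simp only [Nat.add_sub_cancel, pow_succ]
    ring

theorem eulerPoly_pow_mul (k : ℕ) (p : ℂ[X]) {g : ℝ → ℂ} (hg : ContDiff ℝ ∞ g) (x : ℝ) :
    eulerPoly p (fun y => (y : ℂ) ^ k * g y) x = (x : ℂ) ^ k * eulerPoly (affComp p 1 k) g x := by
  have := eulerPoly_mul_comp (U := Set.univ) isOpen_univ (w := fun y : ℝ => (y : ℂ) ^ k)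
    (m := fun y => y) (a := 1) (b := k) (fun x _ => ⟨_, hasDerivAt_ofReal_pow k x, ?_⟩)
    (fun x _ => ⟨1, hasDerivAt_id x, by simp⟩) p (F := fun y => (y : ℂ) ^ k * g y) hg
    (fun _ _ => rfl) x trivial
  · simpa using this
  · rcases k with _ | k
    · simp
    · simp only [Nat.add_sub_cancel, pow_succ]
      ring

/-- The polynomial `(X + 1) ⋯ (X + i)`. -/
def risingPoly (i : ℕ) : ℂ[X] := ∏ m ∈ Finset.range i, (Polynomial.X + Polynomial.C ((m : ℂ) + 1))

theorem risingPoly_succ (i : ℕ) :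
    risingPoly (i + 1) = risingPoly i * (Polynomial.X + Polynomial.C ((i : ℂ) + 1)) :=
  Finset.prod_range_succ _ _

theorem contDiff_iteratedDeriv {f : ℝ → ℂ} (hf : ContDiff ℝ ∞ f) (n : ℕ) :
    ContDiff ℝ ∞ (iteratedDeriv n f) := by
  rw [iteratedDeriv_eq_iterate]
  exact hf.iterate_deriv n

/-- `(d/dx)^i x^i = (x d/dx + 1) ⋯ (x d/dx + i)`. -/
theorem iteratedDeriv_pow_mul (i : ℕ) {f : ℝ → ℂ} (hf : ContDiff ℝ ∞ f) (x : ℝ) :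
    iteratedDeriv i (fun y : ℝ => (y : ℂ) ^ i * f y) x = eulerPoly (risingPoly i) f x := by
  induction i generalizing f x with
  | zero => simp [risingPoly, eulerPoly_one]
  | succ i ih =>
    have h1 : deriv (fun y : ℝ => (y : ℂ) ^ (i + 1) * f y) =
        fun y : ℝ => (y : ℂ) ^ i * (eulerOp f y + ((i : ℂ) + 1) * f y) := by
      funext y
      have h : HasDerivAt (fun y : ℝ => (y : ℂ) ^ (i + 1) * f y) _ y :=
        (hasDerivAt_ofReal_pow (i + 1) y).mul (differentiable_of_contDiff hf y).hasDerivAt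
      rw [h.deriv, eulerOp]
      simp only [Nat.add_sub_cancel, pow_succ, Nat.cast_add, Nat.cast_one]
      ring
    rw [iteratedDeriv_succ', h1, ih ((contDiff_eulerOp hf).add (contDiff_const.mul hf)),
      risingPoly_succ, eulerPoly_mul _ _ hf]
    congr 1
    funext y
    rw [eulerPoly_add, eulerPoly_X, eulerPoly_C]

/-- The polynomial `X (X - 1) ⋯ (X - i + 1)`. -/
def fallingPoly (i : ℕ) : ℂ[X] := ∏ m ∈ Finset.range i, (Polynomial.X - Polynomial.C (m : ℂ))

/-- `x^i (d/dx)^i = x d/dx (x d/dx - 1) ⋯ (x d/dx - i + 1)`. -/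
theorem pow_mul_iteratedDeriv (i : ℕ) {f : ℝ → ℂ} (hf : ContDiff ℝ ∞ f) (x : ℝ) :
    (x : ℂ) ^ i * iteratedDeriv i f x = eulerPoly (fallingPoly i) f x := by
  induction i generalizing x with
  | zero => simp [fallingPoly, eulerPoly_one]
  | succ i ih =>
    have h1 : fallingPoly (i + 1) = (Polynomial.X + Polynomial.C (-(i : ℂ))) * fallingPoly i := by
      rw [fallingPoly, Finset.prod_range_succ, mul_comm, Polynomial.C_neg, sub_eq_add_neg]
      rfl
    have h2 : eulerPoly (fallingPoly i) f = fun y : ℝ => (y : ℂ) ^ i * iteratedDeriv i f y :=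
      funext fun y => (ih y).symm
    rw [h1, eulerPoly_mul _ _ hf, eulerPoly_add, eulerPoly_X, eulerPoly_C, h2,
      eulerOp_pow_mul i (contDiff_iteratedDeriv hf i), iteratedDeriv_succ]
    simp only [eulerOp]
    ring

/-! ### Euler operators as continuous operators, and their Fourier transforms. -/

/-- The Euler operator on test functions. -/
def eulerTest : TestFun →L[ℂ] TestFun :=
  (mulTest (fun x : ℝ => (x : ℂ)) Complex.ofRealCLM.contDiff).comp
    (TestFunction.lineDerivCLM ℂ (1 : ℝ))

theorem coe_eulerTest (f : TestFun) : ⇑(eulerTest f) = eulerOp f := by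
  funext x
  change (TestFunction.lineDerivCLM ℂ (1 : ℝ) f : TestFun) x * (x : ℂ) = _
  rw [TestFunction.lineDerivCLM_apply]
  have h : HasDerivAt (fun t : ℝ => f (x + t • (1 : ℝ))) (deriv f x) 0 := by
    have h1 : HasDerivAt (fun t : ℝ => x + t • (1 : ℝ)) 1 0 := by
      simpa using (hasDerivAt_id (0 : ℝ)).const_add x
    have h2 : HasDerivAt f (deriv f x) (x + (0 : ℝ) • (1 : ℝ)) := by
      simpa using (differentiable_of_contDiff f.contDiff x).hasDerivAt
    simpa [Function.comp_def] using h2.scomp (0 : ℝ) h1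
  rw [lineDeriv, h.deriv, eulerOp, mul_comm, if_pos le_top]

/-- The Euler operator on Schwartz functions. -/
def eulerSchwartz : 𝓢(ℝ, ℂ) →L[ℂ] 𝓢(ℝ, ℂ) :=
  (SchwartzMap.smulLeftCLM ℂ (fun x : ℝ => (x : ℂ))).comp (SchwartzMap.derivCLM ℂ ℂ)

theorem coe_eulerSchwartz (f : 𝓢(ℝ, ℂ)) : ⇑(eulerSchwartz f) = eulerOp f := by
  funext x
  rw [eulerSchwartz, ContinuousLinearMap.comp_apply, SchwartzMap.smulLeftCLM_apply_apply
    (by fun_prop)]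
  simp [eulerOp]

/-- The operator `p(x d/dx)` on Schwartz functions. -/
def eulerPolySchwartz (p : ℂ[X]) : 𝓢(ℝ, ℂ) →L[ℂ] 𝓢(ℝ, ℂ) :=
  ∑ i ∈ Finset.range (p.natDegree + 1), p.coeff i • eulerSchwartz ^ i

theorem coe_eulerPolySchwartz (p : ℂ[X]) (f : 𝓢(ℝ, ℂ)) :
    ⇑(eulerPolySchwartz p f) = eulerPoly p f := by
  have key : ∀ n : ℕ, ⇑((eulerSchwartz ^ n) f) = eulerOp^[n] f := by
    intro n
    induction n with
    | zero => rfl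
    | succ n ih =>
      rw [pow_succ', mul_apply_eq_comp, coe_eulerSchwartz, ih,
        Function.iterate_succ_apply']
  funext x
  rw [eulerPoly_eq_sum_range p (Nat.lt_succ_self _)]
  simp [eulerPolySchwartz, ← key]

/-- The operator `p(x d/dx)` on test functions. -/
def eulerPolyTest (p : ℂ[X]) (f : TestFun) : TestFun :=
  ⟨eulerPoly p f, contDiff_eulerPoly p f.contDiff,
    f.hasCompactSupport.of_isClosed_subset (isClosed_tsupport _) (tsupport_eulerPoly_subset p f),
    fun _ _ => trivial⟩

theorem coe_eulerPolyTest (p : ℂ[X]) (f : TestFun) : ⇑(eulerPolyTest p f) = eulerPoly p f := rfl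

/-- Differentiating 𝓕 f inserts -2πi y under the transform, and multiplying by x then differentiates
y f(y). Since (y f)' = E f + f, the operator E corresponds to -E - 1. -/
theorem eulerOp_fourier (f : 𝓢(ℝ, ℂ)) :
    eulerOp (𝓕 f : 𝓢(ℝ, ℂ)) = (𝓕 (-eulerSchwartz f - f) : 𝓢(ℝ, ℂ)) := by
  funext x
  have hf : Integrable f := f.integrable
  let g : 𝓢(ℝ, ℂ) := SchwartzMap.smulLeftCLM ℂ (fun x : ℝ => (x : ℂ)) f
  have hg : ∀ y, g y = (y : ℂ) * f y := fun y => by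
    simp only [g]
    rw [SchwartzMap.smulLeftCLM_apply_apply (by fun_prop)]
    simp
  have h1 : deriv (𝓕 (f : ℝ → ℂ)) x = -2 * Real.pi * Complex.I * 𝓕 (g : ℝ → ℂ) x := by
    rw [Real.deriv_fourier hf]
    · rw [Real.fourier_eq, Real.fourier_eq, ← integral_const_mul]
      congr 1
      funext y
      rw [hg]
      simp only [smul_eq_mul, Circle.smul_def]
      ring
    · refine g.integrable.congr (Eventually.of_forall fun y => ?_)
      simp [hg]
  have h2 := Real.fourier_deriv (f := g) g.integrable g.differentiable
    ((SchwartzMap.derivCLM ℂ ℂ g).integrable) 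
  have h3 : deriv g = (eulerSchwartz f + f : 𝓢(ℝ, ℂ)) := by
    funext y
    have h : HasDerivAt (fun y : ℝ => (y : ℂ) * f y) _ y :=
      ((hasDerivAt_id y).ofReal_comp).mul (f.differentiable y).hasDerivAt
    rw [show (g : ℝ → ℂ) = fun y : ℝ => (y : ℂ) * f y from funext hg, h.deriv]
    simp [coe_eulerSchwartz, eulerOp]
    ring
  have h4 : (-eulerSchwartz f - f : 𝓢(ℝ, ℂ)) = -(eulerSchwartz f + f) := by abel
  rw [eulerOp, SchwartzMap.fourier_coe, h1, h4, FourierTransform.fourier_neg]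
  change _ = -(𝓕 (eulerSchwartz f + f) : 𝓢(ℝ, ℂ)) x
  rw [SchwartzMap.fourier_coe, ← h3, h2]
  simp
  ring

theorem eulerPoly_fourier (p : ℂ[X]) (f : 𝓢(ℝ, ℂ)) :
    eulerPoly p (𝓕 f : 𝓢(ℝ, ℂ)) = (𝓕 (eulerPolySchwartz (affComp p (-1) (-1)) f) : 𝓢(ℝ, ℂ)) := by
  induction p using Polynomial.induction_on' with
  | add p q hp hq =>
    have h1 : affComp (p + q) (-1) (-1) = affComp p (-1) (-1) + affComp q (-1) (-1) := by
      simp [affComp]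
    have h2 : eulerPolySchwartz (affComp (p + q) (-1) (-1)) f =
        eulerPolySchwartz (affComp p (-1) (-1)) f + eulerPolySchwartz (affComp q (-1) (-1)) f := by
      ext x
      simp [coe_eulerPolySchwartz, h1, eulerPoly_add]
    funext x
    rw [eulerPoly_add, hp, hq, h2, FourierTransform.fourier_add]
    rfl
  | monomial n c =>
    induction n generalizing f with
    | zero =>
      have h2 : eulerPolySchwartz (affComp (Polynomial.monomial 0 c) (-1) (-1)) f = c • f := by
        ext x
        simp [coe_eulerPolySchwartz, affComp, eulerPoly_C]
      funext x
      rw [h2, FourierTransform.fourier_smul, Polynomial.monomial_zero_left, eulerPoly_C]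
      rfl
    | succ n ih =>
      have h2 : eulerPolySchwartz (affComp (Polynomial.monomial (n + 1) c) (-1) (-1)) f =
          eulerPolySchwartz (affComp (Polynomial.monomial n c) (-1) (-1))
            (-eulerSchwartz f - f) := by
        ext x
        have h3 : affComp (Polynomial.monomial (n + 1) c) (-1) (-1) =
            affComp (Polynomial.monomial n c) (-1) (-1) *
              (Polynomial.C (-1) * Polynomial.X + Polynomial.C (-1)) := by
          rw [← Polynomial.monomial_mul_X]; simp [affComp]; ring
        rw [coe_eulerPolySchwartz, coe_eulerPolySchwartz, h3, eulerPoly_mul _ _ (f.smooth ⊤)]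
        congr 1
        funext y
        rw [eulerPoly_add, eulerPoly_C_mul, eulerPoly_X, eulerPoly_C]
        simp [coe_eulerSchwartz]
        ring
      funext x
      rw [h2, ← ih, ← Polynomial.monomial_mul_X, eulerPoly_mul_X, eulerOp_fourier]

/-! ### Absolutely convergent Mellin integrals and their holomorphy. -/

theorem integrable_of_even_of_integrableOn_Ioi {f : ℝ → ℝ} (hf : IntegrableOn f (Set.Ioi 0))
    (he : ∀ x, f (-x) = f x) : Integrable f := by
  rw [← integrableOn_univ, ← Set.Iio_union_Ici (a := (0 : ℝ)), integrableOn_union]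
  refine ⟨?_, (integrableOn_Ici_iff_integrableOn_Ioi (by simp)).2 hf⟩
  have h := (Measure.measurePreserving_neg (volume : Measure ℝ)).integrableOn_comp_preimage
    (Homeomorph.neg ℝ).measurableEmbedding (f := f) (s := Set.Ioi 0)
  have h2 : (f ∘ Neg.neg) = f := funext he
  have h3 : (Neg.neg ⁻¹' Set.Ioi (0 : ℝ)) = Set.Iio 0 := by ext; simp
  rw [h2, h3] at h
  exact h.2 hf

theorem integrable_ite_abs_rpow {a b : ℝ} (ha : -1 < a) (hb : b < -1) :
    Integrable fun x : ℝ => if |x| ≤ 1 then |x| ^ a else |x| ^ b := by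
  refine integrable_of_even_of_integrableOn_Ioi ?_ (by simp)
  rw [← Set.Ioc_union_Ioi_eq_Ioi (zero_le_one' ℝ), integrableOn_union]
  constructor
  · have h : IntegrableOn (fun x : ℝ => x ^ a) (Set.Ioc 0 1) :=
      (intervalIntegral.intervalIntegrable_rpow' ha (a := 0) (b := 1)).1
    refine h.congr_fun (fun x hx => ?_) measurableSet_Ioc
    simp only [abs_of_pos hx.1, hx.2, if_true]
  · refine (integrableOn_Ioi_rpow_of_lt hb one_pos).congr_fun (fun x hx => ?_) measurableSet_Ioi
    have : (1 : ℝ) < x := hx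
    simp only [abs_of_pos (one_pos.trans this), not_le.2 this, if_false]

theorem ae_ne_zero : ∀ᵐ x : ℝ, x ≠ 0 := by
  simp [ae_iff]

/-- `v` is `O(|x|^k₀)` near zero and `O(|x|^(-k₁))` near infinity. -/
def PowerBounded (k₀ k₁ : ℤ) (v : ℝ → ℂ) : Prop :=
  Measurable v ∧ ∃ C : ℝ, ∀ x : ℝ, x ≠ 0 →
    (|x| ≤ 1 → ‖v x‖ ≤ C * |x| ^ k₀) ∧ (1 ≤ |x| → ‖v x‖ ≤ C * |x| ^ (-k₁))

theorem PowerBounded.integrable_norm_mul_rpow {k₀ k₁ : ℤ} {v : ℝ → ℂ} (hv : PowerBounded k₀ k₁ v)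
    {c : ℝ} (h₀ : -(k₀ : ℝ) - 1 < c) (h₁ : c < k₁ - 1) :
    Integrable fun x => ‖v x‖ * |x| ^ c := by
  obtain ⟨hm, C, hC⟩ := hv
  have hI := (integrable_ite_abs_rpow (a := k₀ + c) (b := -k₁ + c) (by linarith)
    (by linarith)).const_mul C
  refine hI.mono' ?_ ?_
  · exact (hm.norm.mul (by fun_prop)).aestronglyMeasurable
  · filter_upwards [ae_ne_zero] with x hx
    have hp : 0 < |x| := abs_pos.2 hx
    rw [Real.norm_of_nonneg (by positivity)]
    split_ifs with h
    · rw [Real.rpow_add hp, ← mul_assoc, Real.rpow_intCast]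
      exact mul_le_mul_of_nonneg_right ((hC x hx).1 h) (by positivity)
    · rw [Real.rpow_add hp, ← mul_assoc, ← Int.cast_neg, Real.rpow_intCast]
      exact mul_le_mul_of_nonneg_right ((hC x hx).2 (not_le.1 h).le) (by positivity)

theorem PowerBounded.comp_inv {k₀ k₁ : ℤ} {v : ℝ → ℂ} (hv : PowerBounded k₀ k₁ v) :
    PowerBounded k₁ k₀ fun x => v x⁻¹ := by
  obtain ⟨hm, C, hC⟩ := hv
  refine ⟨hm.comp measurable_inv, C, fun x hx => ⟨fun h => ?_, fun h => ?_⟩⟩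
  · have := (hC x⁻¹ (inv_ne_zero hx)).2 (by rw [abs_inv]; exact (one_le_inv₀ (abs_pos.2 hx)).2 h)
    simpa [abs_inv] using this
  · have := (hC x⁻¹ (inv_ne_zero hx)).1 (by rw [abs_inv]; exact inv_le_one_of_one_le₀ h)
    simpa [abs_inv] using this

theorem measurable_signedPower (δ : ZMod 2) (α : ℂ) : Measurable (signedPower δ α) := by
  have hs : Measurable Real.sign := by
    have : Real.sign = fun r : ℝ => if r < 0 then (-1 : ℝ) else if 0 < r then 1 else 0 := rfl
    rw [this]
    exact Measurable.ite measurableSet_Iio measurable_const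
      (Measurable.ite measurableSet_Ioi measurable_const measurable_const)
  have h2 : Measurable fun x : ℝ => (((|x| : ℝ) : ℂ)) := by fun_prop
  exact ((Complex.measurable_ofReal.comp hs).pow_const _).mul (h2.pow_const _)

theorem norm_sign_pow (δ : ZMod 2) {x : ℝ} (hx : x ≠ 0) : ‖(Real.sign x : ℂ) ^ δ.val‖ = 1 := by
  rw [norm_pow, Complex.norm_real]
  rcases Real.sign_apply_eq_of_ne_zero x hx with h | h <;> simp [h]

theorem norm_signedPower (δ : ZMod 2) (α : ℂ) {x : ℝ} (hx : x ≠ 0) :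
    ‖signedPower δ α x‖ = |x| ^ α.re := by
  rw [signedPower, norm_mul, norm_sign_pow δ hx, one_mul,
    Complex.norm_cpow_eq_rpow_re_of_pos (abs_pos.2 hx)]

theorem integrable_mul_signedPower {u : ℝ → ℂ} (δ : ZMod 2) {α : ℂ}
    (hu : AEStronglyMeasurable u) (h : Integrable fun x => ‖u x‖ * |x| ^ α.re) :
    Integrable fun x => u x * signedPower δ α x := by
  refine h.mono' (hu.mul (measurable_signedPower δ α).aestronglyMeasurable) ?_
  filter_upwards [ae_ne_zero] with x hx
  rw [norm_mul, norm_signedPower δ α hx]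

theorem PowerBounded.integrable_mul_signedPower {k₀ k₁ : ℤ} {v : ℝ → ℂ}
    (hv : PowerBounded k₀ k₁ v) (δ : ZMod 2) {α : ℂ} (h₀ : -(k₀ : ℝ) - 1 < α.re)
    (h₁ : α.re < k₁ - 1) : Integrable fun x => v x * signedPower δ α x :=
  SignedMellin.integrable_mul_signedPower δ hv.1.aestronglyMeasurable
    (hv.integrable_norm_mul_rpow h₀ h₁)

theorem hasDerivAt_signedPower (δ : ZMod 2) (α : ℂ) {x : ℝ} (hx : x ≠ 0) :
    HasDerivAt (fun α => signedPower δ α x) (Real.log |x| * signedPower δ α x) α := by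
  have hx' : ((|x| : ℝ) : ℂ) ≠ 0 := by exact_mod_cast (abs_pos.2 hx).ne'
  have h := ((hasDerivAt_id α).const_cpow (c := ((|x| : ℝ) : ℂ)) (Or.inl hx')).const_mul
    ((Real.sign x : ℂ) ^ δ.val)
  refine h.congr_deriv ?_
  rw [signedPower, Complex.ofReal_log (abs_nonneg x)]
  simp
  ring

/-- Apply log u ≤ u^ε/ε to both t and 1/t. Thus a logarithm costs an arbitrarily small shift of the
exponent in either direction. -/
theorem abs_log_mul_rpow_le {t c ε : ℝ} (ht : 0 < t) (hε : 0 < ε) :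
    |Real.log t| * t ^ c ≤ (t ^ (c - ε) + t ^ (c + ε)) / ε := by
  have h1 : |Real.log t| ≤ (t ^ (-ε) + t ^ ε) / ε := by
    have a := Real.log_le_rpow_div ht.le hε
    have b := Real.log_le_rpow_div (inv_pos.2 ht).le hε
    rw [Real.log_inv, Real.inv_rpow ht.le, ← Real.rpow_neg ht.le] at b
    have c1 : 0 ≤ t ^ (-ε) / ε := by positivity
    have c2 : 0 ≤ t ^ ε / ε := by positivity
    rw [add_div]
    exact abs_le.2 ⟨by linarith, by linarith⟩
  calc |Real.log t| * t ^ c ≤ (t ^ (-ε) + t ^ ε) / ε * t ^ c := by gcongr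
    _ = _ := by
      rw [sub_eq_neg_add, Real.rpow_add ht, add_comm c, Real.rpow_add ht]
      ring

theorem rpow_le_add_rpow {t a b c : ℝ} (ht : 0 < t) (h1 : a ≤ b) (h2 : b ≤ c) :
    t ^ b ≤ t ^ a + t ^ c := by
  have ha : 0 ≤ t ^ a := by positivity
  have hc : 0 ≤ t ^ c := by positivity
  rcases le_total t 1 with h | h
  · linarith [Real.rpow_le_rpow_of_exponent_ge ht h h1]
  · linarith [Real.rpow_le_rpow_of_exponent_le h h2]

/-- Differentiation under the integral sign. The exponent interval is open, which leaves room to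
absorb the logarithm created by the derivative in α. -/
theorem differentiableAt_integral_mul_signedPower {u : ℝ → ℂ} (δ : ZMod 2) {a b : ℝ}
    (hu : AEStronglyMeasurable u)
    (h : ∀ c, a < c → c < b → Integrable fun x => ‖u x‖ * |x| ^ c)
    {α : ℂ} (ha : a < α.re) (hb : α.re < b) :
    DifferentiableAt ℂ (fun α => ∫ x, u x * signedPower δ α x) α := by
  obtain ⟨ε, hε, h1, h2⟩ : ∃ ε : ℝ, 0 < ε ∧ a < α.re - 2 * ε ∧ α.re + 2 * ε < b := by
    refine ⟨min (α.re - a) (b - α.re) / 4, ?_, ?_, ?_⟩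
    · have : 0 < min (α.re - a) (b - α.re) := lt_min (by linarith) (by linarith)
      positivity
    · linarith [min_le_left (α.re - a) (b - α.re)]
    · linarith [min_le_right (α.re - a) (b - α.re)]
  -- One ε accounts for the radius of the ball in which the exponent moves, the other for the
  -- logarithm.
  let bound : ℝ → ℝ := fun x => ‖u x‖ * |x| ^ (α.re - 2 * ε) * (2 / ε) +
    ‖u x‖ * |x| ^ (α.re + 2 * ε) * (2 / ε)
  have hbd : Integrable bound :=
    ((h _ h1 (by linarith)).mul_const _).add ((h _ (by linarith) h2).mul_const _)
  have hmeas : ∀ β, AEStronglyMeasurable fun x => u x * signedPower δ β x := fun β =>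
    hu.mul (measurable_signedPower δ β).aestronglyMeasurable
  have key := hasDerivAt_integral_of_dominated_loc_of_deriv_le (μ := (volume : Measure ℝ))
    (F := fun α x => u x * signedPower δ α x)
    (F' := fun α x => u x * (Real.log |x| * signedPower δ α x)) (bound := bound)
    (s := Metric.ball α ε) (x₀ := α) (Metric.ball_mem_nhds α hε)
    (Eventually.of_forall hmeas)
    (integrable_mul_signedPower δ hu (h _ ha hb))
    (hu.mul ((by fun_prop : Measurable fun x : ℝ => ((Real.log |x| : ℝ) : ℂ)).mul
      (measurable_signedPower δ α)).aestronglyMeasurable)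
    ?_ hbd ?_
  · exact key.2.differentiableAt
  · filter_upwards [ae_ne_zero] with x hx β hβ
    have hp : 0 < |x| := abs_pos.2 hx
    have hre : |(β - α).re| < ε := (Complex.abs_re_le_norm _).trans_lt (by simpa [dist_eq_norm] using hβ)
    rw [Complex.sub_re, abs_lt] at hre
    rw [norm_mul, norm_mul, norm_signedPower δ β hx, Complex.norm_real, Real.norm_eq_abs]
    have e1 := abs_log_mul_rpow_le (c := β.re) hp hε
    have e2 := rpow_le_add_rpow hp (a := α.re - 2 * ε) (b := β.re - ε) (c := α.re + 2 * ε)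
      (by linarith) (by linarith)
    have e3 := rpow_le_add_rpow hp (a := α.re - 2 * ε) (b := β.re + ε) (c := α.re + 2 * ε)
      (by linarith) (by linarith)
    calc ‖u x‖ * (abs (Real.log (abs x)) * abs x ^ β.re)
        ≤ ‖u x‖ * ((2 * (|x| ^ (α.re - 2 * ε) + |x| ^ (α.re + 2 * ε))) / ε) := by
          gcongr
          refine e1.trans ?_
          gcongr
          linarith
      _ = bound x := by simp only [bound]; ring
  · filter_upwards [ae_ne_zero] with x hx β _
    exact (hasDerivAt_signedPower δ β hx).const_mul (u x)

/-! ### Algebra of signed powers, and inversion of the line. -/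

theorem signedPower_add (δ : ZMod 2) (α β : ℂ) {x : ℝ} (hx : x ≠ 0) :
    signedPower δ (α + β) x = signedPower δ α x * ((|x| : ℝ) : ℂ) ^ β := by
  have hx' : ((|x| : ℝ) : ℂ) ≠ 0 := by exact_mod_cast (abs_pos.2 hx).ne'
  rw [signedPower, signedPower, Complex.cpow_add _ _ hx', mul_assoc]

theorem sign_inv (x : ℝ) : Real.sign x⁻¹ = Real.sign x := by
  rcases lt_trichotomy x 0 with h | h | h
  · rw [Real.sign_of_neg h, Real.sign_of_neg (inv_lt_zero.2 h)]
  · simp [h]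
  · rw [Real.sign_of_pos h, Real.sign_of_pos (inv_pos.2 h)]

theorem signedPower_inv (δ : ZMod 2) (α : ℂ) (x : ℝ) :
    signedPower δ α x⁻¹ = signedPower δ (-α) x := by
  rw [signedPower, signedPower, sign_inv, abs_inv, Complex.ofReal_inv,
    Complex.inv_cpow _ _ (by
      rw [Complex.arg_ofReal_of_nonneg (abs_nonneg x)]; exact Real.pi_pos.ne), Complex.cpow_neg]

theorem signedPower_mul_left (δ : ZMod 2) (α : ℂ) (x y : ℝ) :
    signedPower δ α (x * y) = signedPower δ α x * signedPower δ α y := by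
  have h : Real.sign (x * y) = Real.sign x * Real.sign y := by
    rcases lt_trichotomy x 0 with h | h | h <;> rcases lt_trichotomy y 0 with h' | h' | h' <;>
      simp [h, h', Real.sign_of_neg, Real.sign_of_pos, mul_pos_of_neg_of_neg, mul_neg_of_neg_of_pos,
        mul_neg_of_pos_of_neg]
  rw [signedPower, signedPower, signedPower, h, abs_mul, Complex.ofReal_mul, Complex.ofReal_mul,
    Complex.mul_cpow_ofReal_nonneg (abs_nonneg x) (abs_nonneg y), mul_pow]
  ring

theorem image_inv_compl_zero : (fun x : ℝ => x⁻¹) '' {0}ᶜ = {0}ᶜ := by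
  ext x
  constructor
  · rintro ⟨y, hy, rfl⟩
    exact inv_ne_zero hy
  · intro hx
    exact ⟨x⁻¹, inv_ne_zero hx, inv_inv x⟩

theorem restrict_compl_zero : (volume : Measure ℝ).restrict {0}ᶜ = volume :=
  Measure.restrict_eq_self_of_ae_mem ae_ne_zero

/-- Change of variables on the complement of the null set {0}. The factor x⁻² is the Jacobian that
also occurs in `IsExtensionAcrossInfinity`. -/
theorem integral_comp_inv_mul (F : ℝ → ℂ) : ∫ x : ℝ, ((x : ℂ) ^ 2)⁻¹ * F x⁻¹ = ∫ x, F x := by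
  have h := integral_image_eq_integral_abs_deriv_smul (s := {(0 : ℝ)}ᶜ) (f := fun x : ℝ => x⁻¹)
    (f' := fun x => -(x ^ 2)⁻¹) (measurableSet_singleton 0).compl
    (fun x hx => (hasDerivAt_inv hx).hasDerivWithinAt) (inv_injective.injOn) F
  rw [image_inv_compl_zero, restrict_compl_zero] at h
  rw [h]
  congr 1
  funext x
  rw [abs_neg, abs_of_nonneg (by positivity), Complex.real_smul]
  push_cast
  rfl

/-! ### Finite sums of Euler operators applied to functions -/

/-- On `V`, the functional `L` is a finite sum of terms `f ↦ ∫ v * p(x d/dx) f`, with coefficients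
`v` satisfying `B`. -/
def IsEulerSum (V : Set TestFun) (B : (ℝ → ℂ) → Prop) (L : TestFun → ℂ) : Prop :=
  ∃ (ι : Type) (_ : Fintype ι) (v : ι → ℝ → ℂ) (p : ι → ℂ[X]), (∀ j, B (v j)) ∧
    ∀ f ∈ V, L f = ∑ j, ∫ x, v j x * eulerPoly (p j) f x

theorem IsEulerSum.congr {V : Set TestFun} {B : (ℝ → ℂ) → Prop} {L L' : TestFun → ℂ}
    (h : IsEulerSum V B L) (hL : ∀ f ∈ V, L' f = L f) : IsEulerSum V B L' := by
  obtain ⟨ι, hι, v, p, hv, hf⟩ := h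
  exact ⟨ι, hι, v, p, hv, fun f hV => (hL f hV).trans (hf f hV)⟩

theorem isEulerSum_single (V : Set TestFun) {B : (ℝ → ℂ) → Prop} {v : ℝ → ℂ} (p : ℂ[X])
    (hv : B v) : IsEulerSum V B fun f => ∫ x, v x * eulerPoly p f x :=
  ⟨Unit, inferInstance, fun _ => v, fun _ => p, fun _ => hv, fun f _ => by simp⟩

theorem IsEulerSum.add {V : Set TestFun} {B : (ℝ → ℂ) → Prop} {L L' : TestFun → ℂ}
    (h : IsEulerSum V B L) (h' : IsEulerSum V B L') : IsEulerSum V B fun f => L f + L' f := by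
  obtain ⟨ι, hι, v, p, hv, hf⟩ := h
  obtain ⟨ι', hι', v', p', hv', hf'⟩ := h'
  refine ⟨ι ⊕ ι', inferInstance, Sum.elim v v', Sum.elim p p', ?_, fun f hV => ?_⟩
  · rintro (j | j)
    · exact hv j
    · exact hv' j
  · simp only [hf f hV, hf' f hV, Fintype.sum_sum_type, Sum.elim_inl, Sum.elim_inr]

theorem isEulerSum_zero (V : Set TestFun) (B : (ℝ → ℂ) → Prop) : IsEulerSum V B fun _ => 0 :=
  ⟨Empty, inferInstance, Empty.elim, Empty.elim, fun j => j.elim, fun f _ => by simp⟩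

theorem isEulerSum_sum {V : Set TestFun} {B : (ℝ → ℂ) → Prop} {κ : Type*} (s : Finset κ)
    {L : κ → TestFun → ℂ} (h : ∀ i ∈ s, IsEulerSum V B (L i)) :
    IsEulerSum V B fun f => ∑ i ∈ s, L i f := by
  classical
  induction s using Finset.induction_on with
  | empty => simpa using isEulerSum_zero V B
  | insert a s ha ih =>
    simp only [Finset.sum_insert ha]
    exact (h a (by simp)).add (ih fun i hi => h i (by simp [hi]))

/-! ### Bounded coefficients near the origin -/

/-- `v` is measurable and bounded by a multiple of `|x| ^ k`. -/
def PowBounded (k : ℕ) (v : ℝ → ℂ) : Prop :=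
  Measurable v ∧ ∃ C : ℝ, ∀ x, ‖v x‖ ≤ C * |x| ^ k

theorem PowBounded.integrable_mul {k : ℕ} {v F : ℝ → ℂ} (hv : PowBounded k v) (hF : Continuous F)
    (hF' : HasCompactSupport F) : Integrable fun x => v x * F x := by
  obtain ⟨hm, C, hC⟩ := hv
  have h : Integrable fun x : ℝ => C * (|x| ^ k * ‖F x‖) := by
    refine (Continuous.integrable_of_hasCompactSupport (by fun_prop) ?_).const_mul C
    exact hF'.norm.mul_left
  refine h.mono' (hm.aestronglyMeasurable.mul hF.aestronglyMeasurable)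
    (Eventually.of_forall fun x => ?_)
  rw [norm_mul, ← mul_assoc]
  exact mul_le_mul_of_nonneg_right (hC x) (norm_nonneg _)

theorem hasCompactSupport_eulerPoly (p : ℂ[X]) {f : ℝ → ℂ} (hf : HasCompactSupport f) :
    HasCompactSupport (eulerPoly p f) :=
  hf.of_isClosed_subset (isClosed_tsupport _) (tsupport_eulerPoly_subset p f)

theorem continuous_eulerPoly (p : ℂ[X]) {f : ℝ → ℂ} (hf : ContDiff ℝ ∞ f) :
    Continuous (eulerPoly p f) := (contDiff_eulerPoly p hf).continuous

theorem tsupport_iterate_eulerOp_subset (n : ℕ) (f : ℝ → ℂ) :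
    tsupport (eulerOp^[n] f) ⊆ tsupport f := by
  induction n with
  | zero => exact subset_rfl
  | succ n ih =>
    rw [Function.iterate_succ_apply']
    exact (tsupport_eulerOp_subset _).trans ih

theorem exists_bound_iterate_eulerOp {f : ℝ → ℂ} (hf : ContDiff ℝ ∞ f) (hc : HasCompactSupport f)
    (n : ℕ) : ∃ C, ∀ x, ‖(eulerOp^[n] f) x‖ ≤ C :=
  HasCompactSupport.exists_bound_of_continuous (hc.of_isClosed_subset (isClosed_tsupport _)
    (tsupport_iterate_eulerOp_subset n f)) (contDiff_iterate_eulerOp hf n).continuous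

/-! ### Tangential operators -/

theorem iteratedDeriv_ofReal_pow (i m : ℕ) (x : ℝ) :
    iteratedDeriv i (fun y : ℝ => (y : ℂ) ^ m) x = m.descFactorial i * (x : ℂ) ^ (m - i) := by
  induction i generalizing x with
  | zero => simp
  | succ i ih =>
    rw [iteratedDeriv_succ, funext ih, ((hasDerivAt_ofReal_pow (m - i) x).const_mul _).deriv,
      Nat.descFactorial_succ, Nat.sub_sub]
    push_cast
    ring

theorem MemIdealPow.add {U : Set ℝ} {k : ℕ} {u v : ℝ → ℂ} (hu : MemIdealPow U k u)
    (hv : MemIdealPow U k v) : MemIdealPow U k fun x => u x + v x := by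
  obtain ⟨a, ha, hu⟩ := hu
  obtain ⟨b, hb, hv⟩ := hv
  exact ⟨fun x => a x + b x, ha.add hb, fun x hx => by simp only [hu x hx, hv x hx]; ring⟩

theorem MemIdealPow.const_mul {U : Set ℝ} {k : ℕ} {u : ℝ → ℂ} (c : ℂ) (hu : MemIdealPow U k u) :
    MemIdealPow U k fun x => c * u x := by
  obtain ⟨a, ha, hu⟩ := hu
  exact ⟨fun x => c * a x, contDiffOn_const.mul ha, fun x hx => by simp only [hu x hx]; ring⟩

theorem memIdealPow_sum {U : Set ℝ} {k : ℕ} {κ : Type*} (s : Finset κ) {u : κ → ℝ → ℂ}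
    (h : ∀ i ∈ s, MemIdealPow U k (u i)) : MemIdealPow U k fun x => ∑ i ∈ s, u i x := by
  classical
  induction s using Finset.induction_on with
  | empty => exact ⟨fun _ => 0, contDiffOn_const, fun x _ => by simp⟩
  | insert a s ha ih =>
    simp only [Finset.sum_insert ha]
    exact (h a (by simp)).add (ih fun i hi => h i (by simp [hi]))

theorem MemIdealPow.congr {U : Set ℝ} {k : ℕ} {u v : ℝ → ℂ} (hu : MemIdealPow U k u)
    (h : ∀ x ∈ U, v x = u x) : MemIdealPow U k v := by
  obtain ⟨a, ha, hu⟩ := hu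
  exact ⟨a, ha, fun x hx => (h x hx).trans (hu x hx)⟩

/-- Test D on x^m: the result lies in the m-th power of the ideal and equals Σ m(m-1)⋯(m-i+1) c_i
x^(m-i) over i ≤ m. By induction the terms with i < m already lie in that ideal power, which leaves
m! c_m. -/
theorem DiffOp.TangentialOn.memIdealPow_coeff {D : DiffOp} {U : Set ℝ} (hD : D.TangentialOn U)
    (m : ℕ) (hm : m ≤ D.order) : MemIdealPow U m (D.coeff m) := by
  induction m using Nat.strong_induction_on with
  | _ m ih =>
  have h1 : MemIdealPow U m (D.apply fun y : ℝ => (y : ℂ) ^ m) :=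
    hD m _ ⟨fun _ => 1, contDiffOn_const, fun x _ => by simp⟩
  have h2 : MemIdealPow U m fun x => ∑ i ∈ Finset.range m,
      (m.descFactorial i : ℂ) * (D.coeff i x * (x : ℂ) ^ (m - i)) := by
    refine memIdealPow_sum _ fun i hi => MemIdealPow.const_mul _ ?_
    have him : i < m := Finset.mem_range.1 hi
    obtain ⟨b, hb, hbx⟩ := ih i him (him.le.trans hm)
    refine ⟨b, hb, fun x hx => ?_⟩
    simp only
    rw [hbx x hx, show (x : ℂ) ^ m = (x : ℂ) ^ i * (x : ℂ) ^ (m - i) by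
      rw [← pow_add, Nat.add_sub_cancel' him.le]]
    ring
  have h3 := (h1.add (h2.const_mul (-1))).const_mul ((m.factorial : ℂ)⁻¹)
  refine h3.congr fun x _ => ?_
  have hsub : Finset.range (m + 1) ⊆ Finset.range (D.order + 1) :=
    Finset.range_mono (Nat.succ_le_succ hm)
  have h4 : D.apply (fun y : ℝ => (y : ℂ) ^ m) x = ∑ i ∈ Finset.range (m + 1),
      (m.descFactorial i : ℂ) * (D.coeff i x * (x : ℂ) ^ (m - i)) := by
    rw [DiffOp.apply, ← Finset.sum_subset hsub]
    · refine Finset.sum_congr rfl fun i _ => ?_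
      rw [iteratedDeriv_ofReal_pow]
      ring
    · intro i _ hi
      rw [iteratedDeriv_ofReal_pow, Nat.descFactorial_eq_zero_iff_lt.2 (by simpa using hi)]
      simp
  rw [h4, Finset.sum_range_succ, Nat.descFactorial_self]
  have : (m.factorial : ℂ) ≠ 0 := by exact_mod_cast m.factorial_ne_zero
  simp
  field_simp

theorem contDiff_mul_of_tsupport_subset {U : Set ℝ} (hU : IsOpen U) {χ w : ℝ → ℂ}
    (hχ : ContDiff ℝ ∞ χ) (hs : tsupport χ ⊆ U) (hw : ContDiffOn ℝ ∞ w U) :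
    ContDiff ℝ ∞ fun x => χ x * w x := by
  rw [contDiff_iff_contDiffAt]
  intro x
  by_cases hx : x ∈ U
  · exact hχ.contDiffAt.mul (hw.contDiffAt (hU.mem_nhds hx))
  · have h0 : χ =ᶠ[𝓝 x] 0 := notMem_tsupport_iff_eventuallyEq.1 fun h => hx (hs h)
    have : (fun x => χ x * w x) =ᶠ[𝓝 x] fun _ => 0 := by
      filter_upwards [h0] with y hy
      simp [hy]
    exact contDiffAt_const.congr_of_eventuallyEq this

/-- A smooth cutoff function, equal to one on `[-r, r]` and supported in `[-2r, 2r]`. -/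
theorem exists_cutoff {r : ℝ} (hr : 0 < r) : ∃ χ : TestFun, (∀ x, |x| ≤ r → χ x = 1) ∧
    (∀ x, 2 * r ≤ |x| → χ x = 0) ∧ tsupport χ ⊆ Metric.closedBall 0 (2 * r) ∧
    ∀ x, χ (-x) = χ x := by
  let b : ContDiffBump (0 : ℝ) := ⟨r, 2 * r, hr, by linarith⟩
  have hts : tsupport (fun x => ((b x : ℝ) : ℂ)) = Metric.closedBall 0 (2 * r) := by
    rw [← b.tsupport_eq]
    refine congrArg closure ?_
    ext x
    simp
  refine ⟨⟨fun x => ((b x : ℝ) : ℂ), Complex.ofRealCLM.contDiff.comp b.contDiff, ?_,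
    fun _ _ => trivial⟩, fun x hx => ?_, fun x hx => ?_, hts.le, fun x => ?_⟩
  · rw [HasCompactSupport, hts]
    exact isCompact_closedBall _ _
  · change ((b x : ℝ) : ℂ) = 1
    rw [b.one_of_mem_closedBall (by simpa using hx)]
    simp
  · change ((b x : ℝ) : ℂ) = 0
    rw [b.zero_of_le_dist (by simpa using hx)]
    simp
  · change ((b (-x) : ℝ) : ℂ) = ((b x : ℝ) : ℂ)
    rw [b.neg]

/-- `PowBounded` asks for genuine measurability and a bound at every point, while L^∞ membership
gives both only almost everywhere. The representative is set to 0 where it exceeds the essential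
supremum. -/
theorem exists_bounded_measurable_ae_eq {K : Set ℝ} {h : ℝ → ℂ} (hK : MeasurableSet K)
    (hh : MemLp h ⊤ (volume.restrict K)) :
    ∃ g : ℝ → ℂ, Measurable g ∧ (∃ C, ∀ x, ‖g x‖ ≤ C) ∧ ∀ᵐ x, x ∈ K → h x = g x := by
  obtain ⟨hm, hb⟩ := hh
  have hb' : eLpNormEssSup h (volume.restrict K) ≠ ⊤ := by
    rw [← eLpNorm_exponent_top]; exact hb.ne
  let C : ℝ := (eLpNormEssSup h (volume.restrict K)).toReal
  have h1 : ∀ᵐ x ∂(volume.restrict K), ‖h x‖ ≤ C := by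
    filter_upwards [enorm_ae_le_eLpNormEssSup h (volume.restrict K)] with x hx
    rw [← toReal_enorm]
    exact ENNReal.toReal_mono hb' hx
  let m := hm.mk h
  have hmm : Measurable m := hm.stronglyMeasurable_mk.measurable
  refine ⟨fun x => if ‖m x‖ ≤ C then m x else 0,
    Measurable.ite (measurableSet_le hmm.norm measurable_const) hmm measurable_const,
    ⟨C, fun x => ?_⟩, ?_⟩
  · simp only
    split_ifs with hx
    · exact hx
    · rw [norm_zero]; exact ENNReal.toReal_nonneg
  · rw [← ae_restrict_iff' hK]
    filter_upwards [h1, hm.ae_eq_mk] with x hx hx'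
    have : h x = m x := hx'
    rw [← this, if_pos hx]

/-- Near the origin, `T` is a finite sum of Euler operators applied to functions of size
`O(|x| ^ k)`. -/
def IsLocalEulerSum (T : Distr) (k : ℕ) : Prop :=
  ∃ r : ℝ, 0 < r ∧ IsEulerSum {f | tsupport f ⊆ Set.Ioo (-r) r} (PowBounded k) T

/-- By tangentiality the i-th coefficient is x^i b_i, and f = x^k w. The transposed term is
therefore ∂^i x^i applied to x^k (b_i w g). Here ∂^i x^i is a polynomial in E, passing x^k to the
left shifts that polynomial by k, and the Leibniz formula moves b_i w into the coefficient. -/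
theorem VanishesToNatOrder.isLocalEulerSum {T : Distr} {k : ℕ} (hT : VanishesToNatOrder T k) :
    IsLocalEulerSum T k := by
  obtain ⟨U, hU, h0, N, f, D, h, hf, hDs, hDt, hh, hrep⟩ := hT
  obtain ⟨ρ, hρ, hρU⟩ := Metric.isOpen_iff.1 hU 0 h0
  obtain ⟨r, hr, hrρ⟩ : ∃ r : ℝ, 0 < r ∧ 2 * r < ρ := ⟨ρ / 4, by positivity, by linarith⟩
  have hKU : Metric.closedBall (0 : ℝ) (2 * r) ⊆ U :=
    (Metric.closedBall_subset_ball hrρ).trans hρU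
  obtain ⟨χ, hχ1, -, hχs, -⟩ := exists_cutoff hr
  have hIK : Set.Ioo (-r) r ⊆ Metric.closedBall (0 : ℝ) (2 * r) := fun x hx => by
    rw [Metric.mem_closedBall, Real.dist_0_eq_abs, abs_le]
    exact ⟨by linarith [hx.1], by linarith [hx.2]⟩
  refine ⟨r, hr, IsEulerSum.congr (isEulerSum_sum Finset.univ
    (L := fun j g => ∫ x, h j x * (D j).transpose (fun y => f j y * g y) x) fun j _ => ?_)
    fun g hg => hrep g ((show tsupport g ⊆ _ from hg).trans (hIK.trans hKU))⟩
  obtain ⟨h', hm', ⟨C', hC'⟩, hae⟩ := exists_bounded_measurable_ae_eq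
    Metric.isClosed_closedBall.measurableSet (hh j _ hKU (isCompact_closedBall _ _))
  obtain ⟨w, hw, hfw⟩ := hf j
  choose! b hb hcb using (hDt j).memIdealPow_coeff
  -- The functions b_i and w are smooth only on U. The cutoff makes the product smooth on ℝ without
  -- changing it on the supports of the test functions considered.
  let W : ℕ → ℝ → ℂ := fun i x => χ x * (b i x * w x)
  have hW : ∀ i ≤ (D j).order, ContDiff ℝ ∞ (W i) := fun i hi =>
    contDiff_mul_of_tsupport_subset hU χ.contDiff (hχs.trans hKU) ((hb i hi).mul hw)
  have hWc : ∀ i, HasCompactSupport (W i) := fun i => χ.hasCompactSupport.mul_right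
  let q : ℕ → ℂ[X] := fun i => affComp (risingPoly i) 1 k
  let n : ℕ → ℕ := fun i => (q i).natDegree + 1
  have hterm : ∀ i ≤ (D j).order, ∀ l, PowBounded k fun x =>
      h' x * ((-1) ^ i * (x : ℂ) ^ k * (eulerOp^[l] (W i)) x) := by
    intro i hi l
    obtain ⟨C, hC⟩ := exists_bound_iterate_eulerOp (hW i hi) (hWc i) l
    refine ⟨hm'.mul ((by fun_prop : Measurable fun x : ℝ => (-1 : ℂ) ^ i * (x : ℂ) ^ k).mul
      (contDiff_iterate_eulerOp (hW i hi) l).continuous.measurable), C' * C, fun x => ?_⟩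
    have e : ‖h' x * ((-1) ^ i * (x : ℂ) ^ k * (eulerOp^[l] (W i)) x)‖ =
        ‖h' x‖ * ‖(eulerOp^[l] (W i)) x‖ * |x| ^ k := by
      simp [norm_pow]
      ring
    rw [e]
    gcongr
    · exact (norm_nonneg _).trans (hC' x)
    · exact hC' x
    · exact hC x
  refine IsEulerSum.congr (isEulerSum_sum (Finset.range ((D j).order + 1)) fun i hi =>
    isEulerSum_sum (Finset.range (n i)) fun l _ =>
      isEulerSum_single _ (Polynomial.hasseDeriv l (q i))
        (hterm i (Nat.lt_succ_iff.1 (Finset.mem_range.1 hi)) l)) fun g hg => ?_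
  have hg' : tsupport g ⊆ Set.Ioo (-r) r := hg
  have hgz : ∀ x, x ∉ Set.Ioo (-r) r → g x = 0 := fun x hx =>
    image_eq_zero_of_notMem_tsupport fun h => hx (hg' h)
  have hpt : ∀ x, (D j).transpose (fun y => f j y * g y) x =
      ∑ i ∈ Finset.range ((D j).order + 1), ∑ l ∈ Finset.range (n i),
        (-1) ^ i * (x : ℂ) ^ k * (eulerOp^[l] (W i)) x *
          eulerPoly (Polynomial.hasseDeriv l (q i)) g x := by
    intro x
    refine Finset.sum_congr rfl fun i hi => ?_
    have hi' : i ≤ (D j).order := Nat.lt_succ_iff.1 (Finset.mem_range.1 hi)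
    have e1 : (fun y => (D j).coeff i y * (f j y * g y)) =
        fun y : ℝ => (y : ℂ) ^ i * ((y : ℂ) ^ k * (W i y * g y)) := by
      funext y
      by_cases hy : y ∈ Set.Ioo (-r) r
      · rw [hcb i hi' y (hKU (hIK hy)), hfw y (hKU (hIK hy))]
        simp only [W]
        rw [hχ1 y (abs_le.2 ⟨hy.1.le, hy.2.le⟩)]
        ring
      · rw [hgz y hy]; ring
    have hWg : ContDiff ℝ ∞ fun y => W i y * g y := (hW i hi').mul g.contDiff
    rw [e1, iteratedDeriv_pow_mul i ((contDiff_ofReal_pow k).mul hWg), eulerPoly_pow_mul k _ hWg,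
      eulerPoly_leibniz (affComp (risingPoly i) 1 k) (Nat.lt_succ_self _) (hW i hi') g.contDiff,
      Finset.mul_sum, Finset.mul_sum]
    exact Finset.sum_congr rfl fun l _ => by simp only [q]; ring
  have hzero : ∀ x, x ∉ Metric.closedBall (0 : ℝ) (2 * r) →
      (D j).transpose (fun y => f j y * g y) x = 0 := by
    intro x hx
    rw [hpt x]
    refine Finset.sum_eq_zero fun i _ => Finset.sum_eq_zero fun l _ => ?_
    rw [eulerPoly_eq_zero_of_notMem_tsupport _ fun h => hx (hIK (hg' h)), mul_zero]
  have hint : ∀ i ≤ (D j).order, ∀ l, Integrable fun x =>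
      h' x * ((-1) ^ i * (x : ℂ) ^ k * (eulerOp^[l] (W i)) x) *
        eulerPoly (Polynomial.hasseDeriv l (q i)) g x := fun i hi l =>
    (hterm i hi l).integrable_mul (continuous_eulerPoly _ g.contDiff)
      (hasCompactSupport_eulerPoly _ g.hasCompactSupport)
  have e2 : ∫ x, h j x * (D j).transpose (fun y => f j y * g y) x =
      ∫ x, ∑ i ∈ Finset.range ((D j).order + 1), ∑ l ∈ Finset.range (n i),
        h' x * ((-1) ^ i * (x : ℂ) ^ k * (eulerOp^[l] (W i)) x) *
          eulerPoly (Polynomial.hasseDeriv l (q i)) g x := by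
    refine integral_congr_ae ?_
    filter_upwards [hae] with x hx
    by_cases hxK : x ∈ Metric.closedBall (0 : ℝ) (2 * r)
    · rw [hx hxK, hpt x, Finset.mul_sum]
      refine Finset.sum_congr rfl fun i _ => ?_
      rw [Finset.mul_sum]
      exact Finset.sum_congr rfl fun l _ => by ring
    · rw [hzero x hxK, mul_zero]
      refine (Finset.sum_eq_zero fun i _ => Finset.sum_eq_zero fun l _ => ?_).symm
      rw [eulerPoly_eq_zero_of_notMem_tsupport _ fun h => hxK (hIK (hg' h)), mul_zero]
  rw [e2, integral_finsetSum]
  · refine Finset.sum_congr rfl fun i hi => ?_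
    rw [integral_finsetSum]
    exact fun l _ => hint i (Nat.lt_succ_iff.1 (Finset.mem_range.1 hi)) l
  · exact fun i hi => integrable_finsetSum _ fun l _ =>
      hint i (Nat.lt_succ_iff.1 (Finset.mem_range.1 hi)) l

/-- The span contains 1 and is stable under multiplication by X, because X r_i = r_(i+1) - (i+1)
r_i. Hence each p(E) is a combination of the operators ∂^i x^i, which are transposes of tangential
operators up to sign. -/
theorem risingPoly_mem_span (p : ℂ[X]) : p ∈ Submodule.span ℂ (Set.range risingPoly) := by
  have hX : ∀ q ∈ Submodule.span ℂ (Set.range risingPoly),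
      q * Polynomial.X ∈ Submodule.span ℂ (Set.range risingPoly) := by
    intro q hq
    induction hq using Submodule.span_induction with
    | mem q hq =>
      obtain ⟨i, rfl⟩ := hq
      have : risingPoly i * Polynomial.X = risingPoly (i + 1) - ((i : ℂ) + 1) • risingPoly i := by
        rw [risingPoly_succ, Polynomial.smul_eq_C_mul]
        ring
      rw [this]
      exact sub_mem (Submodule.subset_span ⟨_, rfl⟩)
        (Submodule.smul_mem _ _ (Submodule.subset_span ⟨_, rfl⟩))
    | zero => simp
    | add a b _ _ ha hb => rw [add_mul]; exact add_mem ha hb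
    | smul c a _ ha => rw [smul_mul_assoc]; exact Submodule.smul_mem _ _ ha
  induction p using Polynomial.induction_on' with
  | add p q hp hq => exact add_mem hp hq
  | monomial n c =>
    induction n with
    | zero =>
      have : Polynomial.monomial 0 c = c • risingPoly 0 := by
        rw [risingPoly, Finset.prod_range_zero, Polynomial.smul_eq_C_mul, mul_one]
        rfl
      rw [this]
      exact Submodule.smul_mem _ _ (Submodule.subset_span ⟨_, rfl⟩)
    | succ n ih => rw [← Polynomial.monomial_mul_X]; exact hX _ ih

theorem exists_eq_sum_risingPoly (p : ℂ[X]) :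
    ∃ (n : ℕ) (c : ℕ → ℂ), p = ∑ i ∈ Finset.range n, c i • risingPoly i := by
  obtain ⟨c, hc⟩ := Finsupp.mem_span_range_iff_exists_finsupp.1 (risingPoly_mem_span p)
  obtain ⟨n, hn⟩ := c.support.exists_nat_subset_range
  refine ⟨n, c, ?_⟩
  rw [← hc, Finsupp.sum]
  refine Finset.sum_subset hn fun i _ hi => ?_
  rw [Finsupp.notMem_support_iff.1 hi, zero_smul]

theorem contDiffOn_iteratedDeriv {U : Set ℝ} (hU : IsOpen U) {u : ℝ → ℂ}
    (hu : ContDiffOn ℝ ∞ u U) (i : ℕ) : ContDiffOn ℝ ∞ (iteratedDeriv i u) U := by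
  induction i with
  | zero => simpa using hu
  | succ i ih =>
    rw [iteratedDeriv_succ]
    exact ((contDiffOn_infty_iff_deriv_of_isOpen hU).1 ih).2

/-- Differentiate x^i u^(i) = x^k v and multiply by x: then x^(i+1) u^(i+1) is x^k times k v + x v'
- i v. -/
theorem MemIdealPow.pow_mul_iteratedDeriv {U : Set ℝ} (hU : IsOpen U) {k : ℕ} {u : ℝ → ℂ}
    (hu : MemIdealPow U k u) (i : ℕ) :
    MemIdealPow U k fun x => (x : ℂ) ^ i * iteratedDeriv i u x := by
  have hsm : ContDiffOn ℝ ∞ u U := by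
    obtain ⟨v, hv, huv⟩ := hu
    exact (((contDiff_ofReal_pow k).contDiffOn).mul hv).congr huv
  induction i with
  | zero => simpa using hu
  | succ i ih =>
    obtain ⟨v, hv, huv⟩ := ih
    have hv' := (contDiffOn_infty_iff_deriv_of_isOpen hU).1 hv
    have hd := (contDiffOn_infty_iff_deriv_of_isOpen hU).1 (contDiffOn_iteratedDeriv hU hsm i)
    refine ⟨fun x => k * v x + x * deriv v x - i * v x, ?_, fun x hx => ?_⟩
    · exact ((contDiffOn_const.mul hv).add (Complex.ofRealCLM.contDiff.contDiffOn.mul hv'.2)).sub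
        (contDiffOn_const.mul hv)
    · have hxU := hU.mem_nhds hx
      have h1 : HasDerivAt (fun y : ℝ => (y : ℂ) ^ i * iteratedDeriv i u y) _ x :=
        (hasDerivAt_ofReal_pow i x).mul (hd.1.differentiableAt hxU).hasDerivAt
      have h2 : HasDerivAt (fun y : ℝ => (y : ℂ) ^ k * v y) _ x :=
        (hasDerivAt_ofReal_pow k x).mul (hv'.1.differentiableAt hxU).hasDerivAt
      have h3 : (fun y : ℝ => (y : ℂ) ^ i * iteratedDeriv i u y) =ᶠ[𝓝 x]
          fun y : ℝ => (y : ℂ) ^ k * v y := by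
        filter_upwards [hxU] with y hy using huv y hy
      have h4 := h1.unique (h2.congr_of_eventuallyEq h3)
      have e1 : ∀ m : ℕ, (x : ℂ) * (m * (x : ℂ) ^ (m - 1)) = m * (x : ℂ) ^ m := by
        rintro (_ | m)
        · simp
        · simp only [Nat.add_sub_cancel, pow_succ]; ring
      have h5 := huv x hx
      simp only at h5
      rw [iteratedDeriv_succ]
      linear_combination (x : ℂ) * h4 - (iteratedDeriv i u x) * e1 i + v x * e1 k - i * h5

/-- The coefficients `c i * x ^ i`. -/
def eulerDiffOp (n : ℕ) (c : ℕ → ℂ) : DiffOp where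
  order := n
  coeff i x := c i * (x : ℂ) ^ i

theorem eulerDiffOp_smoothOn (n : ℕ) (c : ℕ → ℂ) (U : Set ℝ) : (eulerDiffOp n c).SmoothOn U :=
  fun i _ => (contDiff_const.mul (contDiff_ofReal_pow i)).contDiffOn

theorem eulerDiffOp_tangentialOn (n : ℕ) (c : ℕ → ℂ) {U : Set ℝ} (hU : IsOpen U) :
    (eulerDiffOp n c).TangentialOn U := by
  intro k u hu
  refine (memIdealPow_sum (Finset.range (n + 1)) fun i _ =>
    (hu.pow_mul_iteratedDeriv hU i).const_mul (c i)).congr fun x _ => ?_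
  exact Finset.sum_congr rfl fun i _ => by simp only [eulerDiffOp]; ring

theorem eulerPoly_sum {κ : Type*} (s : Finset κ) (q : κ → ℂ[X]) (g : ℝ → ℂ) (x : ℝ) :
    eulerPoly (∑ m ∈ s, q m) g x = ∑ m ∈ s, eulerPoly (q m) g x :=
  map_sum (AddMonoidHom.mk' (fun q => eulerPoly q g x) fun p q => eulerPoly_add p q g x) q s

theorem exists_diffOp_transpose_eq (p : ℂ[X]) : ∃ D : DiffOp, (∀ U, D.SmoothOn U) ∧
    (∀ U, IsOpen U → D.TangentialOn U) ∧
    ∀ u : ℝ → ℂ, ContDiff ℝ ∞ u → D.transpose u = eulerPoly p u := by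
  obtain ⟨n, c, hc⟩ := exists_eq_sum_risingPoly p
  -- A `DiffOp` of order n has n + 1 coefficients, one more than the expansion of p, so the top one
  -- is set to 0. The sign cancels the one in the transpose.
  refine ⟨eulerDiffOp n fun i => if i < n then (-1) ^ i * c i else 0, eulerDiffOp_smoothOn _ _,
    fun U hU => eulerDiffOp_tangentialOn _ _ hU, fun u hu => ?_⟩
  funext x
  rw [hc, eulerPoly_sum, DiffOp.transpose]
  simp only [eulerDiffOp]
  rw [Finset.sum_range_succ]
  simp only [lt_self_iff_false, if_false, zero_mul]
  have h0 : iteratedDeriv n (fun _ : ℝ => (0 : ℂ)) x = 0 := by simp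
  rw [h0, mul_zero, add_zero]
  refine Finset.sum_congr rfl fun i hi => ?_
  rw [if_pos (Finset.mem_range.1 hi), Polynomial.smul_eq_C_mul, eulerPoly_C_mul]
  have e1 : (fun y : ℝ => (-1) ^ i * c i * (y : ℂ) ^ i * u y) =
      fun y : ℝ => (y : ℂ) ^ i * (((-1) ^ i * c i) * u y) := by funext y; ring
  rw [e1, iteratedDeriv_pow_mul i (contDiff_const.mul hu), eulerPoly_fun_const_mul _ _ hu,
    ← mul_assoc, ← mul_assoc, ← pow_add, Even.neg_one_pow ⟨i, rfl⟩, one_mul]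

/-- Write v = x^k h, where h = v / x^k is bounded off 0. The power x^k serves as the smooth factor
and h as the locally bounded one. -/
theorem IsLocalEulerSum.vanishesToNatOrder {T : Distr} {k : ℕ} (hT : IsLocalEulerSum T k) :
    VanishesToNatOrder T k := by
  obtain ⟨r, hr, ι, hι, v, p, hv, hrep⟩ := hT
  -- The transpose will act on x^k g, and p(E - k) x^k = x^k p(E).
  choose D hDs hDt hDeq using fun j => exists_diffOp_transpose_eq (affComp (p j) 1 (-k))
  let e := (Fintype.equivFin ι).symm
  refine ⟨Set.Ioo (-r) r, isOpen_Ioo, ⟨by linarith, hr⟩, Fintype.card ι,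
    fun _ x => (x : ℂ) ^ k, fun j => D (e j), fun j x => v (e j) x / (x : ℂ) ^ k,
    fun j => ⟨fun _ => 1, contDiffOn_const, fun x _ => by simp⟩, fun j => hDs _ _,
    fun j => hDt _ _ isOpen_Ioo, fun j K _ _ => ?_, fun g hg => ?_⟩
  · obtain ⟨hm, C, hC⟩ := hv (e j)
    refine MemLp.restrict K (memLp_top_of_bound
      (hm.div (by fun_prop)).aestronglyMeasurable C ?_)
    filter_upwards [ae_ne_zero] with x hx
    have hp : 0 < |x| ^ k := by have := abs_pos.2 hx; positivity
    rw [norm_div, norm_pow, Complex.norm_real, Real.norm_eq_abs, div_le_iff₀ hp]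
    exact hC x
  · rw [hrep g hg, ← e.sum_comp]
    refine Finset.sum_congr rfl fun j _ => integral_congr_ae ?_
    filter_upwards [ae_ne_zero] with x hx
    have hx' : (x : ℂ) ^ k ≠ 0 := pow_ne_zero _ (by exact_mod_cast hx)
    rw [hDeq _ _ ((contDiff_ofReal_pow k).mul g.contDiff), eulerPoly_pow_mul k _ g.contDiff,
      affComp_affComp]
    simp only [mul_one, one_mul, add_neg_cancel, affComp_one_zero]
    field_simp

theorem vanishesToNatOrder_iff {T : Distr} {k : ℕ} :
    VanishesToNatOrder T k ↔ IsLocalEulerSum T k :=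
  ⟨fun h => h.isLocalEulerSum, fun h => h.vanishesToNatOrder⟩

/-! ### Dilations, and uniqueness of extensions across the origin. -/

theorem iterate_eulerOp_comp_mul_left (n : ℕ) {f : ℝ → ℂ} (hf : ContDiff ℝ ∞ f) (c x : ℝ) :
    (eulerOp^[n] fun y => f (c * y)) x = (eulerOp^[n] f) (c * x) := by
  induction n generalizing f with
  | zero => rfl
  | succ n ih =>
    rw [Function.iterate_succ_apply, Function.iterate_succ_apply, ← ih (contDiff_eulerOp hf)]
    refine congrFun (congrArg _ (funext fun y => ?_)) x
    have hd : HasDerivAt (fun y => f (c * y)) (c • deriv f (c * y)) y := by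
      have h1 : HasDerivAt (fun y => c * y) c y := by simpa using (hasDerivAt_id y).const_mul c
      exact (differentiable_of_contDiff hf (c * y)).hasDerivAt.scomp y h1
    rw [eulerOp, hd.deriv, eulerOp, Complex.real_smul]
    push_cast
    ring

theorem eulerPoly_comp_mul_left (p : ℂ[X]) {f : ℝ → ℂ} (hf : ContDiff ℝ ∞ f) (c x : ℝ) :
    eulerPoly p (fun y => f (c * y)) x = eulerPoly p f (c * x) := by
  simp only [eulerPoly, iterate_eulerOp_comp_mul_left _ hf]

/-- Multiplication of test functions. -/
def mulTestFun (W f : TestFun) : TestFun :=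
  ⟨fun x => W x * f x, W.contDiff.mul f.contDiff, W.hasCompactSupport.mul_right, fun _ _ => trivial⟩

theorem mulTestFun_apply (W f : TestFun) (x : ℝ) : mulTestFun W f x = W x * f x := rfl

theorem tsupport_mulTestFun_subset_left (W f : TestFun) :
    tsupport (mulTestFun W f) ⊆ tsupport W := tsupport_mul_subset_left

theorem tsupport_mulTestFun_subset_right (W f : TestFun) :
    tsupport (mulTestFun W f) ⊆ tsupport f := tsupport_mul_subset_right

/-- The dilated test function `f(c x)`. -/
def dilateTest (c : ℝ) (hc : c ≠ 0) (f : TestFun) : TestFun :=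
  ⟨fun x => f (c * x), f.contDiff.comp (contDiff_const.mul contDiff_id),
    f.hasCompactSupport.comp_homeomorph (Homeomorph.mulLeft₀ c hc), fun _ _ => trivial⟩

theorem dilateTest_apply (c : ℝ) (hc : c ≠ 0) (f : TestFun) (x : ℝ) :
    dilateTest c hc f x = f (c * x) := rfl

theorem notMem_tsupport_of_eqOn_zero {f : ℝ → ℂ} {r : ℝ} (hr : 0 < r)
    (h : ∀ x, |x| < r → f x = 0) : (0 : ℝ) ∉ tsupport f := by
  rw [notMem_tsupport_iff_eventuallyEq]
  filter_upwards [Metric.ball_mem_nhds (0 : ℝ) hr] with x hx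
  exact h x (by simpa using hx)

/-- A distribution supported at the origin which vanishes to order zero there is zero. -/
theorem eq_zero_of_vanishesToNatOrder {T : Distr} (hT : VanishesToNatOrder T 0)
    (h0 : ∀ f : TestFun, (0 : ℝ) ∉ tsupport f → T f = 0) (f : TestFun) : T f = 0 := by
  obtain ⟨r, hr, ι, hι, v, p, hv, hrep⟩ := hT.isLocalEulerSum
  obtain ⟨χ, hχ1, hχ0, hχs, -⟩ := exists_cutoff (r := r / 4) (by positivity)
  have hc : ∀ n : ℕ, ((n : ℝ) + 1) ≠ 0 := fun n => by positivity
  -- T f depends only on f near 0, so f may be cut off by χ((n+1)x) without changing T f. Since E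
  -- commutes with dilations, Euler derivatives of these cutoffs stay bounded uniformly in n, and
  -- dominated convergence applies.
  let g : ℕ → TestFun := fun n => mulTestFun (dilateTest (n + 1) (hc n) χ) f
  have hg : ∀ n, T f = T (g n) := fun n => by
    have : T (f - g n) = 0 := by
      refine h0 _ (notMem_tsupport_of_eqOn_zero (r := r / 4 / (n + 1)) (by positivity)
        fun x hx => ?_)
      change f x - χ ((n + 1) * x) * f x = 0
      rw [hχ1, one_mul, sub_self]
      rw [abs_mul, abs_of_pos (by positivity : (0 : ℝ) < n + 1), mul_comm]
      exact ((lt_div_iff₀ (by positivity)).1 hx).le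
    rw [map_sub] at this
    exact sub_eq_zero.1 this
  have hgs : ∀ n, tsupport (g n) ⊆ Set.Ioo (-r) r := fun n => by
    refine subset_trans (closure_minimal (t := Metric.closedBall 0 (r / 2)) (fun x hx => ?_)
      Metric.isClosed_closedBall) (fun x hx => ?_)
    · by_contra hx'
      refine hx ?_
      change χ ((n + 1) * x) * f x = 0
      rw [hχ0, zero_mul]
      rw [Metric.mem_closedBall, Real.dist_0_eq_abs, not_le] at hx'
      rw [abs_mul, abs_of_pos (by positivity : (0 : ℝ) < n + 1)]
      have : (0 : ℝ) ≤ n * |x| := by positivity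
      linarith
    · rw [Metric.mem_closedBall, Real.dist_0_eq_abs, abs_le] at hx
      exact ⟨by linarith, by linarith⟩
  have hlim : Tendsto (fun n => T (g n)) atTop (𝓝 0) := by
    have e : ∀ n, T (g n) = ∑ j, ∫ x, v j x * eulerPoly (p j) (g n) x := fun n =>
      hrep (g n) (hgs n)
    simp only [e]
    rw [← Finset.sum_const_zero (s := (Finset.univ : Finset ι))]
    refine tendsto_finsetSum _ fun j _ => ?_
    let N := (p j).natDegree + 1
    choose C hC using fun l => exists_bound_iterate_eulerOp χ.contDiff χ.hasCompactSupport l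
    have e2 : ∀ n x, eulerPoly (p j) (g n) x = ∑ l ∈ Finset.range N,
        (eulerOp^[l] χ) ((n + 1) * x) * eulerPoly (Polynomial.hasseDeriv l (p j)) f x := by
      intro n x
      refine (eulerPoly_leibniz (p j) (Nat.lt_succ_self _)
        (dilateTest (n + 1) (hc n) χ).contDiff f.contDiff x).trans ?_
      refine Finset.sum_congr rfl fun l _ => ?_
      congr 1
      exact iterate_eulerOp_comp_mul_left l χ.contDiff _ _
    have hint : ∀ l, Integrable fun x => v j x * eulerPoly (Polynomial.hasseDeriv l (p j)) f x :=
      fun l => (hv j).integrable_mul (continuous_eulerPoly _ f.contDiff)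
        (hasCompactSupport_eulerPoly _ f.hasCompactSupport)
    rw [← integral_zero ℝ ℂ]
    refine tendsto_integral_of_dominated_convergence
      (fun x => ∑ l ∈ Finset.range N,
        C l * ‖v j x * eulerPoly (Polynomial.hasseDeriv l (p j)) f x‖) ?_ ?_ ?_ ?_
    · exact fun n => ((hv j).1.mul
        (continuous_eulerPoly _ (g n).contDiff).measurable).aestronglyMeasurable
    · exact integrable_finsetSum _ fun l _ => ((hint l).norm.const_mul _)
    · refine fun n => Eventually.of_forall fun x => ?_
      rw [e2, Finset.mul_sum]
      refine (norm_sum_le _ _).trans (Finset.sum_le_sum fun l _ => ?_)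
      rw [mul_left_comm, norm_mul]
      exact mul_le_mul_of_nonneg_right (hC l _) (norm_nonneg _)
    -- For fixed x ≠ 0 the point (n+1)x eventually leaves the support of χ, so the integrand is
    -- eventually 0.
    · filter_upwards [ae_ne_zero] with x hx
      refine tendsto_const_nhds.congr' ?_
      have h1 : Tendsto (fun n : ℕ => ((n : ℝ) + 1) * |x|) atTop atTop :=
        (tendsto_atTop_add_const_right _ _ tendsto_natCast_atTop_atTop).atTop_mul_const
          (abs_pos.2 hx)
      filter_upwards [h1.eventually_gt_atTop (2 * (r / 4))] with n hn
      rw [e2]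
      have hz : ∀ l, (eulerOp^[l] χ) ((n + 1) * x) = 0 := fun l => by
        refine image_eq_zero_of_notMem_tsupport fun h => ?_
        have := hχs (tsupport_iterate_eulerOp_subset l _ h)
        rw [Metric.mem_closedBall, Real.dist_0_eq_abs, abs_mul,
          abs_of_pos (by positivity : (0 : ℝ) < n + 1)] at this
        linarith
      simp [hz]
  exact tendsto_nhds_unique (tendsto_const_nhds.congr hg) hlim

/-! ### Structure of tempered distributions -/

/-- The bound lets L factor through the range of A as a continuous functional. It is extended to H
by Hahn–Banach and represented by Riesz. -/
theorem exists_inner_representation {V H : Type*} [AddCommGroup V] [Module ℂ V]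
    [NormedAddCommGroup H] [InnerProductSpace ℂ H] [CompleteSpace H] (A : V →ₗ[ℂ] H)
    (L : V →ₗ[ℂ] ℂ) (C : ℝ) (h : ∀ f, ‖L f‖ ≤ C * ‖A f‖) :
    ∃ w : H, ∀ f, L f = inner ℂ w (A f) := by
  have hker : LinearMap.ker A ≤ LinearMap.ker L := fun f hf => by
    have := h f
    rw [LinearMap.mem_ker.1 hf, norm_zero, mul_zero] at this
    exact LinearMap.mem_ker.2 (norm_le_zero_iff.1 this)
  let l : LinearMap.range A →ₗ[ℂ] ℂ :=
    ((LinearMap.ker A).liftQ L hker) ∘ₗ A.quotKerEquivRange.symm.toLinearMap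
  have hl : ∀ f, l ⟨A f, LinearMap.mem_range_self A f⟩ = L f := fun f => by
    have : A.quotKerEquivRange.symm ⟨A f, LinearMap.mem_range_self A f⟩ =
        (LinearMap.ker A).mkQ f := by
      rw [LinearEquiv.symm_apply_eq]
      rfl
    simp only [l, LinearMap.comp_apply, LinearEquiv.coe_coe, this]
    rfl
  let l' : LinearMap.range A →L[ℂ] ℂ := l.mkContinuous C (by
    rintro ⟨_, f, rfl⟩
    rw [hl f]
    exact h f)
  obtain ⟨g, hg, -⟩ := exists_extension_norm_eq (LinearMap.range A) l'
  refine ⟨(InnerProductSpace.toDual ℂ H).symm g, fun f => ?_⟩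
  rw [InnerProductSpace.toDual_symm_apply]
  have := hg ⟨A f, LinearMap.mem_range_self A f⟩
  rw [this]
  exact (hl f).symm

theorem hasTemperateGrowth_weight (m : ℕ) :
    Function.HasTemperateGrowth fun x : ℝ => (1 + (x : ℂ) ^ 2) ^ m := by
  fun_prop

/-- Multiplication by `(1 + x ^ 2) ^ m` on Schwartz functions. -/
def weightCLM (m : ℕ) : 𝓢(ℝ, ℂ) →L[ℂ] 𝓢(ℝ, ℂ) :=
  SchwartzMap.smulLeftCLM ℂ fun x : ℝ => (1 + (x : ℂ) ^ 2) ^ m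

theorem weightCLM_apply (m : ℕ) (f : 𝓢(ℝ, ℂ)) (x : ℝ) :
    weightCLM m f x = (1 + (x : ℂ) ^ 2) ^ m * f x := by
  rw [weightCLM, SchwartzMap.smulLeftCLM_apply_apply (hasTemperateGrowth_weight m), smul_eq_mul]

theorem norm_weight (m : ℕ) (x : ℝ) : ‖(1 + (x : ℂ) ^ 2) ^ m‖ = (1 + x ^ 2) ^ m := by
  rw [norm_pow]
  congr 1
  have : (1 + (x : ℂ) ^ 2) = ((1 + x ^ 2 : ℝ) : ℂ) := by push_cast; rfl
  rw [this, Complex.norm_real, Real.norm_of_nonneg (by positivity)]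

/-- Integrate g' from x to infinity on the side away from the origin. There |x| ≤ |t|, so |x|^k is
dominated by the weight (1 + t²)^k under the integral. -/
theorem norm_pow_mul_le_integral_deriv (k : ℕ) (g : 𝓢(ℝ, ℂ)) (x : ℝ) :
    |x| ^ k * ‖g x‖ ≤ ∫ t, ‖weightCLM k (SchwartzMap.derivCLM ℂ ℂ g) t‖ := by
  have hint : Integrable fun t => ‖weightCLM k (SchwartzMap.derivCLM ℂ ℂ g) t‖ :=
    (weightCLM k (SchwartzMap.derivCLM ℂ ℂ g)).integrable.norm
  have hg' : Integrable (deriv g) := (SchwartzMap.derivCLM ℂ ℂ g).integrable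
  have hw : ∀ t, |x| ≤ |t| →
      |x| ^ k * ‖deriv g t‖ ≤ ‖weightCLM k (SchwartzMap.derivCLM ℂ ℂ g) t‖ := fun t ht => by
    rw [weightCLM_apply, norm_mul, norm_weight, SchwartzMap.derivCLM_apply]
    gcongr
    refine ht.trans ?_
    nlinarith [sq_abs t, sq_nonneg (|t| - 1), abs_nonneg t]
  have key : ∀ s : Set ℝ, MeasurableSet s → (∀ t ∈ s, |x| ≤ |t|) → ‖g x‖ ≤ ‖∫ t in s, deriv g t‖ →
      |x| ^ k * ‖g x‖ ≤ ∫ t, ‖weightCLM k (SchwartzMap.derivCLM ℂ ℂ g) t‖ := by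
    intro s hs hsx hle
    calc |x| ^ k * ‖g x‖ ≤ |x| ^ k * ∫ t in s, ‖deriv g t‖ := by
          gcongr
          exact hle.trans (norm_integral_le_integral_norm _)
      _ = ∫ t in s, |x| ^ k * ‖deriv g t‖ := (integral_const_mul _ _).symm
      _ ≤ ∫ t in s, ‖weightCLM k (SchwartzMap.derivCLM ℂ ℂ g) t‖ :=
          setIntegral_mono_on (hg'.norm.const_mul _).integrableOn hint.integrableOn hs
            fun t ht => hw t (hsx t ht)
      _ ≤ _ := setIntegral_le_integral hint (Eventually.of_forall fun _ => norm_nonneg _)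
  have hlim := g.tendsto_cocompact
  rcases le_total 0 x with hx | hx
  · refine key (Set.Ioi x) measurableSet_Ioi (fun t ht => ?_) ?_
    · exact abs_le_abs_of_nonneg hx (Set.mem_Ioi.1 ht).le
    · rw [integral_Ioi_of_hasDerivAt_of_tendsto' (fun t _ => g.hasDerivAt t) hg'.integrableOn
        (hlim.mono_left atTop_le_cocompact)]
      simp
  · refine key (Set.Iic x) measurableSet_Iic (fun t ht => ?_) ?_
    · exact abs_le_abs_of_nonpos hx ht
    · rw [integral_Iic_of_hasDerivAt_of_tendsto' (fun t _ => g.hasDerivAt t) hg'.integrableOn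
        (hlim.mono_left atBot_le_cocompact)]
      simp

theorem memLp_inv_weight : MemLp (fun x : ℝ => (1 + x ^ 2)⁻¹) 2 := by
  have h1 : Integrable fun x : ℝ => (1 + x ^ 2)⁻¹ := integrable_inv_one_add_sq
  have hm : AEStronglyMeasurable (fun x : ℝ => (1 + x ^ 2)⁻¹) := h1.aestronglyMeasurable
  rw [memLp_two_iff_integrable_sq_norm hm]
  refine h1.mono' (hm.norm.pow 2) (Eventually.of_forall fun x => ?_)
  have h3 : (1 + x ^ 2)⁻¹ ≤ 1 := inv_le_one_of_one_le₀ (by nlinarith [sq_nonneg x])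
  have h4 : 0 ≤ (1 + x ^ 2)⁻¹ := by positivity
  rw [norm_pow, norm_norm, Real.norm_of_nonneg h4]
  nlinarith

/-- Cauchy–Schwarz against (1 + t²)⁻¹, which is square integrable; this raises the weight exponent
by one. -/
theorem exists_integral_norm_le : ∃ C : ℝ, ∀ (k : ℕ) (g : 𝓢(ℝ, ℂ)),
    ∫ t, ‖weightCLM k g t‖ ≤ C * ‖SchwartzMap.toLpCLM ℂ ℂ 2 volume (weightCLM (k + 1) g)‖ := by
  refine ⟨(eLpNorm (fun x : ℝ => (1 + x ^ 2)⁻¹) 2 volume).toReal, fun k g => ?_⟩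
  let G := weightCLM (k + 1) g
  have hG : MemLp G 2 := G.memLp 2
  have e1 : ∀ t, ‖weightCLM k g t‖ = ‖((1 + t ^ 2)⁻¹ : ℝ) • G t‖ := fun t => by
    have : (1 + t ^ 2 : ℝ) ≠ 0 := by positivity
    rw [norm_smul, weightCLM_apply, weightCLM_apply, norm_mul, norm_mul, norm_weight, norm_weight,
      norm_inv, Real.norm_of_nonneg (by positivity : (0 : ℝ) ≤ 1 + t ^ 2), pow_succ]
    field_simp
    ring
  have h2 := eLpNorm_smul_le_mul_eLpNorm (p := 2) (q := 2) (r := 1) hG.1 memLp_inv_weight.1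
  have h3 : Integrable fun t => ((1 + t ^ 2)⁻¹ : ℝ) • G t :=
    memLp_one_iff_integrable.1 (hG.smul memLp_inv_weight)
  calc ∫ t, ‖weightCLM k g t‖ = ∫ t, ‖((1 + t ^ 2)⁻¹ : ℝ) • G t‖ := by simp only [e1]
    _ = (eLpNorm (fun t => ((1 + t ^ 2)⁻¹ : ℝ) • G t) 1 volume).toReal := by
        rw [integral_norm_eq_lintegral_enorm h3.1, eLpNorm_one_eq_lintegral_enorm]
    _ ≤ (eLpNorm (fun x : ℝ => (1 + x ^ 2)⁻¹) 2 volume * eLpNorm G 2 volume).toReal :=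
        ENNReal.toReal_mono (ENNReal.mul_ne_top memLp_inv_weight.2.ne hG.2.ne) h2
    _ = _ := by
        rw [ENNReal.toReal_mul, SchwartzMap.toLpCLM_apply, SchwartzMap.norm_toLp]

theorem seminorm_sum_apply {ι : Type*} (s : Finset ι) (q : ι → Seminorm ℂ 𝓢(ℝ, ℂ)) (f : 𝓢(ℝ, ℂ)) :
    (∑ i ∈ s, q i) f = ∑ i ∈ s, q i f := by
  classical
  induction s using Finset.induction_on with
  | empty => simp
  | insert a s ha ih => rw [Finset.sum_insert ha, Finset.sum_insert ha, add_apply, ih]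

theorem derivCLM_pow_apply (n : ℕ) (f : 𝓢(ℝ, ℂ)) :
    ((SchwartzMap.derivCLM ℂ ℂ) ^ n) f = (SchwartzMap.derivCLM ℂ ℂ)^[n] f := by
  induction n with
  | zero => simp
  | succ n ih => rw [pow_succ', mul_apply_eq_comp, ih, Function.iterate_succ_apply']

theorem coe_iterate_derivCLM (n : ℕ) (f : 𝓢(ℝ, ℂ)) :
    ⇑((SchwartzMap.derivCLM ℂ ℂ)^[n] f) = iteratedDeriv n f := by
  induction n with
  | zero => simp
  | succ n ih =>
    rw [Function.iterate_succ_apply', iteratedDeriv_succ, ← ih]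
    rfl

/-- Every tempered distribution is a finite sum of derivatives, of order at least one, of
functions which are square integrable up to a polynomial factor. -/
theorem exists_structure (L : 𝓢(ℝ, ℂ) →L[ℂ] ℂ) :
    ∃ (s : Finset (ℕ × ℕ)) (w : ℕ × ℕ → Lp ℂ 2 (volume : Measure ℝ)), ∀ f,
      L f = ∑ i ∈ s, inner ℂ (w i) (SchwartzMap.toLpCLM ℂ ℂ 2 volume
        (weightCLM (i.1 + 1) ((SchwartzMap.derivCLM ℂ ℂ)^[i.2 + 1] f))) := by
  have hq : Continuous ((normSeminorm ℂ ℂ).comp (L : 𝓢(ℝ, ℂ) →ₗ[ℂ] ℂ)) :=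
    continuous_norm.comp L.continuous
  obtain ⟨s, C, -, hC⟩ := Seminorm.bound_of_continuous (schwartz_withSeminorms ℂ ℝ ℂ) _ hq
  obtain ⟨C', hC'⟩ := exists_integral_norm_le
  let A₀ : ℕ × ℕ → 𝓢(ℝ, ℂ) →L[ℂ] Lp ℂ 2 (volume : Measure ℝ) := fun i =>
    (SchwartzMap.toLpCLM ℂ ℂ 2 volume).comp
      ((weightCLM (i.1 + 1)).comp ((SchwartzMap.derivCLM ℂ ℂ) ^ (i.2 + 1)))
  let A : 𝓢(ℝ, ℂ) →ₗ[ℂ] PiLp 2 fun _ : s => Lp ℂ 2 (volume : Measure ℝ) :=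
    (WithLp.linearEquiv 2 ℂ (s → Lp ℂ 2 (volume : Measure ℝ))).symm.toLinearMap ∘ₗ
      LinearMap.pi fun i : s => (A₀ i : 𝓢(ℝ, ℂ) →ₗ[ℂ] _)
  have hA : ∀ f (i : s), A f i = A₀ i f := fun f i => rfl
  -- A supremum of the n-th derivative is controlled by a weighted L² norm of the (n+1)-st. This
  -- surplus derivative is what later gives antiderivatives.
  have hsem : ∀ (i : ℕ × ℕ) f, SchwartzMap.seminorm ℂ i.1 i.2 f ≤ |C'| * ‖A₀ i f‖ := by
    intro i f
    refine SchwartzMap.seminorm_le_bound' ℂ _ _ f (by positivity) fun x => ?_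
    have h1 : iteratedDeriv i.2 f x = ((SchwartzMap.derivCLM ℂ ℂ) ^ i.2) f x := by
      rw [derivCLM_pow_apply, coe_iterate_derivCLM]
    rw [h1]
    refine (norm_pow_mul_le_integral_deriv i.1 _ x).trans ((hC' i.1 _).trans ?_)
    have e : A₀ i f = SchwartzMap.toLpCLM ℂ ℂ 2 volume (weightCLM (i.1 + 1)
        (SchwartzMap.derivCLM ℂ ℂ (((SchwartzMap.derivCLM ℂ ℂ) ^ i.2) f))) := by
      simp only [A₀, ContinuousLinearMap.comp_apply, pow_succ', mul_apply_eq_comp]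
    rw [← e]
    exact mul_le_mul_of_nonneg_right (le_abs_self _) (norm_nonneg _)
  obtain ⟨w, hw⟩ := exists_inner_representation A (L : 𝓢(ℝ, ℂ) →ₗ[ℂ] ℂ)
    (C * (s.card * |C'|)) fun f => by
      have h1 : ‖L f‖ ≤ C * (s.sup (schwartzSeminormFamily ℂ ℝ ℂ)) f := hC f
      have h2 : (s.sup (schwartzSeminormFamily ℂ ℝ ℂ)) f ≤ s.card * (|C'| * ‖A f‖) := by
        refine (Seminorm.finset_sup_le_sum _ s f).trans ?_
        rw [seminorm_sum_apply, ← nsmul_eq_mul]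
        refine Finset.sum_le_card_nsmul _ _ _ fun i hi => ?_
        refine (hsem i f).trans (mul_le_mul_of_nonneg_left ?_ (abs_nonneg _))
        exact PiLp.norm_apply_le (A f) ⟨i, hi⟩
      calc ‖L f‖ ≤ C * (s.card * (|C'| * ‖A f‖)) :=
            h1.trans (mul_le_mul_of_nonneg_left h2 C.2)
        _ = _ := by ring
  classical
  refine ⟨s, fun i => if h : i ∈ s then w ⟨i, h⟩ else 0, fun f => ?_⟩
  have h3 := hw f
  rw [PiLp.inner_apply] at h3
  rw [show L f = _ from h3, ← Finset.sum_coe_sort s]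
  refine Finset.sum_congr rfl fun i _ => ?_
  simp only [dif_pos i.2, hA, A₀, ContinuousLinearMap.comp_apply, derivCLM_pow_apply]

/-! ### Antiderivatives, and division by powers of `x`. -/

/-- Every tempered distribution has an antiderivative. -/
theorem exists_antideriv (L : 𝓢(ℝ, ℂ) →L[ℂ] ℂ) :
    ∃ M : 𝓢(ℝ, ℂ) →L[ℂ] ℂ, ∀ f, M (SchwartzMap.derivCLM ℂ ℂ f) = L f := by
  obtain ⟨s, w, hw⟩ := exists_structure L
  refine ⟨∑ i ∈ s, (innerSL ℂ (w i)).comp ((SchwartzMap.toLpCLM ℂ ℂ 2 volume).comp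
    ((weightCLM (i.1 + 1)).comp ((SchwartzMap.derivCLM ℂ ℂ) ^ i.2))), fun f => ?_⟩
  rw [hw f, sum_apply]
  refine Finset.sum_congr rfl fun i _ => ?_
  simp only [ContinuousLinearMap.comp_apply, innerSL_apply_apply, derivCLM_pow_apply,
    Function.iterate_succ_apply]

/-- Multiplication by `x` on Schwartz functions. -/
def mulXCLM : 𝓢(ℝ, ℂ) →L[ℂ] 𝓢(ℝ, ℂ) := SchwartzMap.smulLeftCLM ℂ fun x : ℝ => (x : ℂ)

theorem mulXCLM_apply (f : 𝓢(ℝ, ℂ)) (x : ℝ) : mulXCLM f x = (x : ℂ) * f x := by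
  rw [mulXCLM, SchwartzMap.smulLeftCLM_apply_apply (by fun_prop), smul_eq_mul]

theorem derivCLM_fourier (f : 𝓢(ℝ, ℂ)) :
    SchwartzMap.derivCLM ℂ ℂ (𝓕 f) = (-2 * Real.pi * Complex.I : ℂ) • 𝓕 (mulXCLM f) := by
  ext x
  have h := Real.deriv_fourier f.integrable ((mulXCLM f).integrable.congr
    (Eventually.of_forall fun y => by simp [mulXCLM_apply]))
  rw [SchwartzMap.derivCLM_apply, SchwartzMap.fourier_coe, h]
  change _ = (-2 * Real.pi * Complex.I : ℂ) * (𝓕 (mulXCLM f) : 𝓢(ℝ, ℂ)) x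
  rw [SchwartzMap.fourier_coe, Real.fourier_eq, Real.fourier_eq, ← integral_const_mul]
  congr 1
  funext y
  rw [mulXCLM_apply]
  simp only [smul_eq_mul, Circle.smul_def]
  ring

/-- Division of tempered distributions by `x`. -/
theorem exists_div_mulX (L : 𝓢(ℝ, ℂ) →L[ℂ] ℂ) :
    ∃ M : 𝓢(ℝ, ℂ) →L[ℂ] ℂ, ∀ f, M (mulXCLM f) = L f := by
  -- Under the Fourier transform, multiplication by x becomes differentiation up to the constant
  -- -2πi. Division by x is thus the taking of an antiderivative.
  obtain ⟨M, hM⟩ := exists_antideriv (L.comp (FourierTransform.fourierInvCLM ℂ 𝓢(ℝ, ℂ)))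
  have hc : (-2 * Real.pi * Complex.I : ℂ) ≠ 0 := by simp [Real.pi_ne_zero]
  refine ⟨(-2 * Real.pi * Complex.I : ℂ) • M.comp (FourierTransform.fourierCLM ℂ 𝓢(ℝ, ℂ)),
    fun f => ?_⟩
  have h := hM (𝓕 f)
  rw [derivCLM_fourier, map_smul] at h
  simpa using h

theorem exists_div_mulX_pow (L : 𝓢(ℝ, ℂ) →L[ℂ] ℂ) (n : ℕ) :
    ∃ M : 𝓢(ℝ, ℂ) →L[ℂ] ℂ, ∀ f, M (mulXCLM^[n] f) = L f := by
  induction n with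
  | zero => exact ⟨L, fun _ => rfl⟩
  | succ n ih =>
    obtain ⟨M, hM⟩ := ih
    obtain ⟨M', hM'⟩ := exists_div_mulX M
    exact ⟨M', fun f => by rw [Function.iterate_succ_apply', hM', hM]⟩

theorem iterate_mulXCLM_apply (n : ℕ) (f : 𝓢(ℝ, ℂ)) (x : ℝ) :
    (mulXCLM^[n] f) x = (x : ℂ) ^ n * f x := by
  induction n with
  | zero => simp
  | succ n ih => rw [Function.iterate_succ_apply', mulXCLM_apply, ih, pow_succ]; ring

/-! ### Density of test functions among Schwartz functions -/

/-- The derivative of a test function. -/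
def derivTest (f : TestFun) : TestFun :=
  ⟨deriv f, contDiff_infty_iff_deriv.1 f.contDiff |>.2, f.hasCompactSupport.deriv, fun _ _ => trivial⟩

theorem derivTest_apply (f : TestFun) (x : ℝ) : derivTest f x = deriv f x := rfl

/-- The derivative of the product is (χ(εy) - χ(0)) f' + ε(χ'(εy) - χ'(0)) f + ε χ'(0) f. The first
two terms have the original shape, so the induction has to allow an arbitrary χ, with χ(0) in place
of 1. -/
theorem exists_iteratedDeriv_dilate_sub_le (l k : ℕ) (χ : TestFun) (f : 𝓢(ℝ, ℂ)) :
    ∃ C : ℝ, ∀ ε : ℝ, 0 < ε → ε ≤ 1 → ∀ x : ℝ,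
      |x| ^ k * ‖iteratedDeriv l (fun y => (χ (ε * y) - χ 0) * f y) x‖ ≤ C * ε := by
  induction l generalizing χ f with
  | zero =>
    obtain ⟨C, hC⟩ := (derivTest χ).continuous.bounded_above_of_compact_support
      (derivTest χ).hasCompactSupport
    have hC0 : 0 ≤ C := (norm_nonneg _).trans (hC 0)
    refine ⟨C * SchwartzMap.seminorm ℂ (k + 1) 0 f, fun ε hε _ x => ?_⟩
    have h1 : ‖χ (ε * x) - χ 0‖ ≤ C * ‖ε * x - 0‖ :=
      convex_univ.norm_image_sub_le_of_norm_deriv_le (f := χ)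
        (fun y _ => (differentiable_of_contDiff χ.contDiff) y) (fun y _ => hC y)
        (Set.mem_univ _) (Set.mem_univ _)
    have h2 := f.norm_pow_mul_le_seminorm ℂ (k + 1) x
    rw [sub_zero, norm_mul, Real.norm_of_nonneg hε.le, Real.norm_eq_abs] at h1
    rw [Real.norm_eq_abs] at h2
    rw [iteratedDeriv_zero, norm_mul]
    calc |x| ^ k * (‖χ (ε * x) - χ 0‖ * ‖f x‖) ≤ |x| ^ k * (C * (ε * |x|) * ‖f x‖) := by gcongr
      _ = C * (|x| ^ (k + 1) * ‖f x‖) * ε := by ring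
      _ ≤ _ := by gcongr
  | succ l ih =>
    obtain ⟨C₁, h₁⟩ := ih χ (SchwartzMap.derivCLM ℂ ℂ f)
    obtain ⟨C₂, h₂⟩ := ih (derivTest χ) f
    refine ⟨C₁ + C₂ + ‖derivTest χ 0‖ * SchwartzMap.seminorm ℂ k l f, fun ε hε hε1 x => ?_⟩
    have hd (η : TestFun) : ContDiff ℝ ∞ fun y : ℝ => η (ε * y) - η 0 :=
      (η.contDiff.comp (contDiff_const.mul contDiff_id)).sub contDiff_const
    have hF (g : 𝓢(ℝ, ℂ)) (η : TestFun) :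
        ContDiff ℝ ∞ fun y : ℝ => (η (ε * y) - η 0) * g y := (hd η).mul (g.smooth ⊤)
    have e : deriv (fun y => (χ (ε * y) - χ 0) * f y) =
        (fun y => (χ (ε * y) - χ 0) * SchwartzMap.derivCLM ℂ ℂ f y) + ((fun y =>
          (ε : ℂ) * ((derivTest χ (ε * y) - derivTest χ 0) * f y)) +
          fun y => ((ε : ℂ) * derivTest χ 0) * f y) := by
      funext y
      have hχ : HasDerivAt (fun y : ℝ => χ (ε * y) - χ 0) (ε * deriv χ (ε * y)) y := by
        have h1 := ((differentiable_of_contDiff χ.contDiff) (ε * y)).hasDerivAt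
        have h2 : HasDerivAt (fun y : ℝ => ε * y) ε y := by
          simpa using (hasDerivAt_id y).const_mul ε
        have := (h1.scomp y h2).sub_const (χ 0)
        simpa [Function.comp_def] using this
      refine (hχ.mul (f.hasDerivAt y)).deriv.trans ?_
      simp only [Pi.add_apply, derivTest_apply, SchwartzMap.derivCLM_apply]
      ring
    have c1 := (hF (SchwartzMap.derivCLM ℂ ℂ f) χ).of_le (m := (l : WithTop ℕ∞)) (by exact_mod_cast le_top)
    have c2 := (hF f (derivTest χ)).of_le (m := (l : WithTop ℕ∞)) (by exact_mod_cast le_top)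
    have c3 : ContDiff ℝ (l : WithTop ℕ∞) f := (f.smooth ⊤).of_le (by exact_mod_cast le_top)
    have c4 : ContDiff ℝ (l : WithTop ℕ∞) ((fun y : ℝ =>
        (ε : ℂ) * ((derivTest χ (ε * y) - derivTest χ 0) * f y)) +
        fun y => ((ε : ℂ) * derivTest χ 0) * f y) :=
      (contDiff_const.mul c2).add (contDiff_const.mul c3)
    rw [iteratedDeriv_succ', e,
      iteratedDeriv_add c1.contDiffAt c4.contDiffAt,
      iteratedDeriv_add (contDiff_const.mul c2).contDiffAt (contDiff_const.mul c3).contDiffAt,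
      iteratedDeriv_const_mul _ c2.contDiffAt, iteratedDeriv_const_mul _ c3.contDiffAt]
    have t1 := h₁ ε hε hε1 x
    have t2 := h₂ ε hε hε1 x
    have t3 := f.le_seminorm' ℂ k l x
    have hε' : ‖(ε : ℂ)‖ = ε := by rw [Complex.norm_real, Real.norm_of_nonneg hε.le]
    refine (mul_le_mul_of_nonneg_left ((norm_add_le _ _).trans (add_le_add_right
      (norm_add_le _ _) _)) (by positivity)).trans ?_
    rw [norm_mul, norm_mul, norm_mul, hε']
    have t4 : ε * (|x| ^ k * ‖iteratedDeriv l (fun y => (derivTest χ (ε * y) - derivTest χ 0) * f y) x‖)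
        ≤ 1 * (C₂ * ε) := mul_le_mul hε1 t2 (by positivity) zero_le_one
    have t5 := mul_le_mul_of_nonneg_left t3 (by positivity : 0 ≤ ε * ‖derivTest χ 0‖)
    nlinarith [t1, t4, t5]

/-- Test functions are dense: χ(εx) f differs from f by O(ε) in every Schwartz seminorm when χ(0) =
1. -/
theorem clm_ext_testFun {L M : 𝓢(ℝ, ℂ) →L[ℂ] ℂ}
    (h : ∀ f : TestFun, L (testToSchwartz f) = M (testToSchwartz f)) : L = M := by
  rw [← sub_eq_zero]
  set N := L - M with hN
  have hN0 : ∀ f : TestFun, N (testToSchwartz f) = 0 := fun f => by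
    rw [hN, sub_apply, h f, sub_self]
  ext f
  obtain ⟨χ, hχ1, -, -, -⟩ := exists_cutoff one_pos
  have hχ0 : χ 0 = 1 := hχ1 0 (by simp)
  have hq : Continuous ((normSeminorm ℂ ℂ).comp (N : 𝓢(ℝ, ℂ) →ₗ[ℂ] ℂ)) :=
    continuous_norm.comp N.continuous
  obtain ⟨s, C, -, hC⟩ := Seminorm.bound_of_continuous (schwartz_withSeminorms ℂ ℝ ℂ) _ hq
  choose B hB using fun i : ℕ × ℕ => exists_iteratedDeriv_dilate_sub_le i.2 i.1 χ f
  have key : ∀ ε : ℝ, 0 < ε → ε ≤ 1 → ‖N f‖ ≤ C * (∑ i ∈ s, |B i|) * ε := by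
    intro ε hε hε1
    let F : TestFun := ⟨fun y => χ (ε * y) * f y,
      (χ.contDiff.comp (contDiff_const.mul contDiff_id)).mul (f.smooth ⊤),
      ((dilateTest ε hε.ne' χ).hasCompactSupport).mul_right, fun _ _ => trivial⟩
    let G := testToSchwartz F - f
    have hG : N G = -N f := by rw [map_sub, hN0, zero_sub]
    have hGf : ⇑G = fun y => (χ (ε * y) - χ 0) * f y := by
      funext y
      change χ (ε * y) * f y - f y = _
      rw [hχ0]
      ring
    have h1 : ‖N G‖ ≤ C * (s.sup (schwartzSeminormFamily ℂ ℝ ℂ)) G := hC G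
    have h2 : (s.sup (schwartzSeminormFamily ℂ ℝ ℂ)) G ≤ (∑ i ∈ s, |B i|) * ε := by
      refine (Seminorm.finset_sup_le_sum _ s G).trans ?_
      rw [seminorm_sum_apply, Finset.sum_mul]
      refine Finset.sum_le_sum fun i _ => ?_
      refine SchwartzMap.seminorm_le_bound' ℂ _ _ G (by positivity) fun x => ?_
      rw [hGf]
      exact (hB i ε hε hε1 x).trans (mul_le_mul_of_nonneg_right (le_abs_self _) hε.le)
    rw [hG, norm_neg] at h1
    rw [mul_assoc]
    exact h1.trans (mul_le_mul_of_nonneg_left h2 C.2)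
  have hlim : Tendsto (fun ε : ℝ => C * (∑ i ∈ s, |B i|) * ε) (𝓝[>] 0) (𝓝 0) := by
    have : Tendsto (fun ε : ℝ => C * (∑ i ∈ s, |B i|) * ε) (𝓝 0) (𝓝 (C * (∑ i ∈ s, |B i|) * 0)) :=
      tendsto_id.const_mul _
    rw [mul_zero] at this
    exact this.mono_left nhdsWithin_le_nhds
  have hle : ‖N f‖ ≤ 0 := ge_of_tendsto hlim (by
    filter_upwards [Ioc_mem_nhdsGT (one_pos : (0:ℝ) < 1)] with ε hε using key ε hε.1 hε.2)
  simpa using hle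

/-- A tempered distribution as a continuous linear functional for the usual topology. -/
def temperedCLM (σ : 𝓢'(ℝ, ℂ)) : 𝓢(ℝ, ℂ) →L[ℂ] ℂ where
  toFun f := σ f
  map_add' f g := by simp
  map_smul' c f := by simp
  cont := map_continuous σ

theorem temperedCLM_apply (σ : 𝓢'(ℝ, ℂ)) (f : 𝓢(ℝ, ℂ)) : temperedCLM σ f = σ f := rfl

theorem toDistr_apply (σ : 𝓢'(ℝ, ℂ)) (f : TestFun) : toDistr σ f = σ (testToSchwartz f) := rfl

/-! ### Tempered distributions away from the origin -/

theorem PowerBounded.mono {k₀ k₁ l₀ l₁ : ℤ} {v : ℝ → ℂ} (hv : PowerBounded k₀ k₁ v)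
    (h₀ : l₀ ≤ k₀) (h₁ : l₁ ≤ k₁) : PowerBounded l₀ l₁ v := by
  obtain ⟨hm, C, hC⟩ := hv
  have hC0 : 0 ≤ C := by
    have := (hC 1 one_ne_zero).1 (by simp)
    simpa using (norm_nonneg _).trans this
  refine ⟨hm, C, fun x hx => ⟨fun h => ((hC x hx).1 h).trans ?_, fun h => ((hC x hx).2 h).trans ?_⟩⟩
  · exact mul_le_mul_of_nonneg_left (zpow_le_zpow_right_of_le_one₀ (abs_pos.2 hx) h h₀) hC0
  · exact mul_le_mul_of_nonneg_left (zpow_le_zpow_right₀ h (neg_le_neg h₁)) hC0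

/-- The exponent 2m + l is crude at both ends; only the finiteness of the orders matters. -/
theorem powerBounded_of_norm_mul_le {v : ℝ → ℂ} (hv : Measurable v) {m l : ℕ} {C : ℝ}
    (h : ∀ x, x ≠ 0 → ‖v x‖ * |x| ^ l ≤ C * (1 + x ^ 2) ^ m) :
    PowerBounded (-(2 * m + l : ℕ)) (-(2 * m + l : ℕ)) v := by
  have hC0 : 0 ≤ C := by
    have := (mul_nonneg (norm_nonneg _) (by positivity)).trans (h 1 one_ne_zero)
    exact nonneg_of_mul_nonneg_left this (by positivity)
  refine ⟨hv, C * 2 ^ m, fun x hx => ⟨fun h1 => ?_, fun h1 => ?_⟩⟩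
  · have hx0 := abs_pos.2 hx
    rw [zpow_neg, zpow_natCast, ← div_eq_mul_inv, le_div_iff₀ (by positivity), pow_add, mul_left_comm,
      mul_comm]
    calc ‖v x‖ * |x| ^ l * |x| ^ (2 * m) ≤ C * (1 + x ^ 2) ^ m * 1 := by
          exact mul_le_mul (h x hx) (pow_le_one₀ hx0.le h1) (by positivity) (by positivity)
      _ ≤ C * 2 ^ m := by
          rw [mul_one]
          gcongr
          nlinarith [sq_abs x]
  · rw [neg_neg, zpow_natCast, pow_add]
    have h2 : (1 : ℝ) ≤ |x| ^ l := one_le_pow₀ h1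
    calc ‖v x‖ ≤ ‖v x‖ * |x| ^ l := le_mul_of_one_le_right (norm_nonneg _) h2
      _ ≤ C * (1 + x ^ 2) ^ m := h x hx
      _ ≤ C * (2 * |x| ^ 2) ^ m := by
          gcongr
          nlinarith [sq_abs x]
      _ = C * 2 ^ m * |x| ^ (2 * m) := by rw [mul_pow, pow_mul]; ring
      _ ≤ C * 2 ^ m * (|x| ^ (2 * m) * |x| ^ l) := by
          gcongr
          exact le_mul_of_one_le_right (by positivity) h2

/-- Take U to be the primitive of u vanishing at -∞, and integrate by parts through Fubini. This
replaces an integrable coefficient by a pointwise bounded one at the cost of one derivative. -/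
theorem exists_integral_mul_eq_neg_integral_deriv {u : ℝ → ℂ} (hu : Integrable u) :
    ∃ U : ℝ → ℂ, Measurable U ∧ (∃ C, ∀ t, ‖U t‖ ≤ C) ∧
      ∀ G : 𝓢(ℝ, ℂ), ∫ x, u x * G x = -∫ t, U t * deriv G t := by
  obtain ⟨u', hu'm, hu'⟩ := hu.1
  have hui : Integrable u' := hu.congr hu'
  let U : ℝ → ℂ := fun t => ∫ x, if x < t then u' x else 0
  have hset : MeasurableSet {q : ℝ × ℝ | q.2 < q.1} := measurableSet_lt measurable_snd measurable_fst
  have hUm : StronglyMeasurable U := by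
    refine StronglyMeasurable.integral_prod_right (f := fun t x : ℝ => if x < t then u' x else 0) ?_
    exact StronglyMeasurable.ite hset (hu'm.comp_measurable measurable_snd) stronglyMeasurable_const
  refine ⟨U, hUm.measurable, ⟨∫ x, ‖u' x‖, fun t => ?_⟩, fun G => ?_⟩
  · refine (norm_integral_le_integral_norm _).trans (integral_mono_of_nonneg
      (Eventually.of_forall fun _ => norm_nonneg _) hui.norm (Eventually.of_forall fun x => ?_))
    dsimp only
    split_ifs
    · exact le_rfl
    · simp
  · have hG' : Integrable (deriv G) := (SchwartzMap.derivCLM ℂ ℂ G).integrable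
    have h1 : ∀ x, G x = -∫ t, if x < t then deriv G t else 0 := fun x => by
      have := integral_Ioi_of_hasDerivAt_of_tendsto' (a := x) (fun t _ => G.hasDerivAt t)
        hG'.integrableOn (G.tendsto_cocompact.mono_left atTop_le_cocompact)
      rw [← integral_indicator measurableSet_Ioi] at this
      simp only [Set.indicator, Set.mem_Ioi] at this
      rw [this]
      simp
    have hint : Integrable (Function.uncurry fun x t : ℝ => if x < t then u' x * deriv G t else 0)
        (volume.prod volume) := by
      have := (hui.mul_prod hG').indicator (measurableSet_lt measurable_fst measurable_snd)
      refine this.congr (Eventually.of_forall fun q => ?_)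
      simp [Set.indicator, Function.uncurry]
    calc ∫ x, u x * G x = ∫ x, u' x * G x :=
          integral_congr_ae (hu'.mono fun x hx => by simp only [hx])
      _ = ∫ x, -∫ t, if x < t then u' x * deriv G t else 0 := by
          congr 1
          funext x
          rw [h1 x, mul_neg, ← integral_const_mul]
          simp only [mul_ite, mul_zero]
      _ = -∫ t, ∫ x, if x < t then u' x * deriv G t else 0 := by
          rw [integral_neg, integral_integral_swap hint]
      _ = -∫ t, U t * deriv G t := by
          congr 2
          funext t
          rw [← integral_mul_const]
          simp only [ite_mul, zero_mul]

theorem hasDerivAt_weight (m : ℕ) (x : ℝ) : HasDerivAt (fun x : ℝ => (1 + (x : ℂ) ^ 2) ^ m)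
    (2 * m * x * (1 + (x : ℂ) ^ 2) ^ (m - 1)) x := by
  have h := ((hasDerivAt_ofReal_pow 2 x).const_add 1).pow m
  have e : 2 * m * x * (1 + (x : ℂ) ^ 2) ^ (m - 1) =
      m * (1 + (x : ℂ) ^ 2) ^ (m - 1) * ((2 : ℕ) * (x : ℂ) ^ (2 - 1)) := by
    push_cast
    simp only [pow_one]
    ring
  rw [e]
  exact h

/-- A tempered distribution is, away from the origin, a finite sum of Euler operators applied to
functions with polynomial growth. -/
theorem exists_isEulerSum_off_zero (L : 𝓢(ℝ, ℂ) →L[ℂ] ℂ) : ∃ K : ℕ,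
    IsEulerSum {f : TestFun | (0 : ℝ) ∉ tsupport f} (PowerBounded (-K) (-K))
      fun f => L (testToSchwartz f) := by
  obtain ⟨s, w, hw⟩ := exists_structure L
  let K := s.sup fun i => 2 * (i.1 + 2) + (i.2 + 2)
  refine ⟨K, ?_⟩
  simp only [hw]
  refine isEulerSum_sum s fun i hi => ?_
  let m := i.1 + 2
  let l := i.2 + 1
  -- The factor (1 + x²)⁻¹ turns a square integrable function into an integrable one. It is
  -- compensated by the weight exponent m, which is one larger than in the structure theorem.
  let u : ℝ → ℂ := fun x => (starRingEnd ℂ) (w i x) * ((1 + x ^ 2)⁻¹ : ℝ)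
  have hu : Integrable u := by
    have h1 := (Lp.memLp (w i)).star
    have h2 : MemLp (fun x : ℝ => (((1 + x ^ 2)⁻¹ : ℝ) : ℂ)) 2 := memLp_inv_weight.ofReal
    exact h1.integrable_mul h2
  obtain ⟨U, hUm, ⟨C, hC⟩, hU⟩ := exists_integral_mul_eq_neg_integral_deriv hu
  have hC0 : 0 ≤ C := (norm_nonneg _).trans (hC 0)
  have hK : 2 * m + (l + 1) ≤ K := Finset.le_sup (f := fun i : ℕ × ℕ => 2 * (i.1 + 2) + (i.2 + 2)) hi
  -- The two coefficients come from the product rule for the derivative of weight times ∂^l f. Off 0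
  -- one has ∂^l = x^(-l) E(E-1)⋯(E-l+1), which accounts for the negative powers.
  let v₁ : ℝ → ℂ := fun x => -U x * (2 * m * x * (1 + (x : ℂ) ^ 2) ^ (m - 1)) * ((x : ℂ) ^ l)⁻¹
  let v₂ : ℝ → ℂ := fun x => -U x * (1 + (x : ℂ) ^ 2) ^ m * ((x : ℂ) ^ (l + 1))⁻¹
  have hv₁ : PowerBounded (-K) (-K) v₁ := by
    have hb : PowerBounded (-(2 * m + l : ℕ)) (-(2 * m + l : ℕ)) v₁ := by
      refine powerBounded_of_norm_mul_le (C := C * (2 * m)) (by fun_prop) fun x hx => ?_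
      have hx0 := abs_pos.2 hx
      simp only [v₁, norm_mul, norm_neg, norm_weight, norm_inv, norm_pow (x : ℂ), Complex.norm_real,
        Complex.norm_ofNat, Complex.norm_natCast, Real.norm_eq_abs]
      rw [inv_mul_cancel_right₀ (by positivity)]
      have hm : m = (m - 1) + 1 := by simp [m]
      have h3 : |x| * (1 + x ^ 2) ^ (m - 1) ≤ (1 + x ^ 2) ^ m := by
        conv_rhs => rw [hm, pow_succ', ]
        gcongr
        nlinarith [sq_abs x, sq_nonneg (|x| - 1)]
      calc ‖U x‖ * (2 * m * |x| * (1 + x ^ 2) ^ (m - 1))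
          = ‖U x‖ * (2 * m) * (|x| * (1 + x ^ 2) ^ (m - 1)) := by ring
        _ ≤ C * (2 * m) * (1 + x ^ 2) ^ m := by gcongr; exact hC x
    exact hb.mono (by push_cast; omega) (by push_cast; omega)
  have hv₂ : PowerBounded (-K) (-K) v₂ := by
    have hb : PowerBounded (-(2 * m + (l + 1) : ℕ)) (-(2 * m + (l + 1) : ℕ)) v₂ := by
      refine powerBounded_of_norm_mul_le (C := C) (by fun_prop) fun x hx => ?_
      have hx0 := abs_pos.2 hx
      simp only [v₂, norm_mul, norm_neg, norm_weight, norm_inv, norm_pow (x : ℂ), Complex.norm_real,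
        Real.norm_eq_abs]
      rw [inv_mul_cancel_right₀ (by positivity)]
      gcongr
      exact hC x
    exact hb.mono (by push_cast; omega) (by push_cast; omega)
  refine ((isEulerSum_single _ (fallingPoly l) hv₁).add
    (isEulerSum_single _ (fallingPoly (l + 1)) hv₂)).congr fun f hf => ?_
  have hD : ∀ j, ContDiff ℝ ∞ (iteratedDeriv j f) := fun j => contDiff_iteratedDeriv f.contDiff j
  have hcs : ∀ j, HasCompactSupport (iteratedDeriv j f) := fun j => by
    have : ∀ j, HasCompactSupport (iteratedDeriv j f) := fun j => by
      induction j with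
      | zero => simpa using f.hasCompactSupport
      | succ j ih => rw [iteratedDeriv_succ]; exact ih.deriv
    exact this j
  let G := weightCLM m ((SchwartzMap.derivCLM ℂ ℂ)^[l] (testToSchwartz f))
  have hder : ∀ x, ((SchwartzMap.derivCLM ℂ ℂ)^[l] (testToSchwartz f)) x = iteratedDeriv l f x :=
    fun x => by rw [coe_iterate_derivCLM]; rfl
  have e1 : inner ℂ (w i) (SchwartzMap.toLpCLM ℂ ℂ 2 volume (weightCLM (i.1 + 1)
      ((SchwartzMap.derivCLM ℂ ℂ)^[i.2 + 1] (testToSchwartz f)))) = ∫ x, u x * G x := by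
    rw [MeasureTheory.L2.inner_def]
    refine integral_congr_ae ?_
    filter_upwards [SchwartzMap.coeFn_toLp (weightCLM (i.1 + 1)
      ((SchwartzMap.derivCLM ℂ ℂ)^[i.2 + 1] (testToSchwartz f))) 2 volume] with x hx
    rw [SchwartzMap.toLpCLM_apply, hx]
    simp only [u, G, weightCLM_apply, m, l, RCLike.inner_apply]
    have hx : (1 + (x : ℂ) ^ 2) ≠ 0 := by
      have : (1 + (x : ℂ) ^ 2) = ((1 + x ^ 2 : ℝ) : ℂ) := by push_cast; rfl
      rw [this, Complex.ofReal_ne_zero]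
      positivity
    push_cast
    field_simp
    ring
  have e2 : ∀ x, deriv G x = 2 * m * x * (1 + (x : ℂ) ^ 2) ^ (m - 1) * iteratedDeriv l f x +
      (1 + (x : ℂ) ^ 2) ^ m * iteratedDeriv (l + 1) f x := fun x => by
    have : ⇑G = fun x : ℝ => (1 + (x : ℂ) ^ 2) ^ m * iteratedDeriv l f x :=
      funext fun x => by simp only [G, weightCLM_apply, hder]
    rw [this, iteratedDeriv_succ (n := l)]
    exact ((hasDerivAt_weight m x).mul ((differentiable_of_contDiff (hD l)) x).hasDerivAt).deriv
  have hUint : ∀ {F : ℝ → ℂ}, Continuous F → HasCompactSupport F → Integrable fun x => U x * F x :=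
    fun hF hF' => PowBounded.integrable_mul (k := 0) ⟨hUm, C, fun x => by simpa using hC x⟩ hF hF'
  have i1 : Integrable fun x : ℝ => U x * (2 * m * x * (1 + (x : ℂ) ^ 2) ^ (m - 1) * iteratedDeriv l f x) :=
    hUint ((by fun_prop : Continuous fun x : ℝ => 2 * (m : ℂ) * x * (1 + (x : ℂ) ^ 2) ^ (m - 1)).mul (hD l).continuous) (hcs l).mul_left
  have i2 : Integrable fun x : ℝ => U x * ((1 + (x : ℂ) ^ 2) ^ m * iteratedDeriv (l + 1) f x) :=
    hUint ((by fun_prop : Continuous fun x : ℝ => (1 + (x : ℂ) ^ 2) ^ m).mul (hD (l + 1)).continuous) (hcs (l + 1)).mul_left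
  rw [e1, hU G]
  simp only [e2, mul_add]
  rw [integral_add i1 i2, neg_add, ← integral_neg, ← integral_neg]
  congr 1
  · refine integral_congr_ae (ae_ne_zero.mono fun x hx => ?_)
    have hx' : (x : ℂ) ≠ 0 := Complex.ofReal_ne_zero.2 hx
    simp only [v₁, ← pow_mul_iteratedDeriv l f.contDiff x]
    field_simp
  · refine integral_congr_ae (ae_ne_zero.mono fun x hx => ?_)
    have hx' : (x : ℂ) ≠ 0 := Complex.ofReal_ne_zero.2 hx
    simp only [v₂, ← pow_mul_iteratedDeriv (l + 1) f.contDiff x]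
    field_simp

/-! ### Test functions vanishing near the origin -/

/-- The test functions which vanish near the origin. -/
def OffZero : Set TestFun := {f | (0 : ℝ) ∉ tsupport f}

theorem exists_radius (f : TestFun) : ∃ R : ℝ, 0 < R ∧ ∀ x, R ≤ |x| → f x = 0 := by
  obtain ⟨R, hR, h⟩ := f.hasCompactSupport.exists_pos_le_norm
  exact ⟨R, hR, fun x hx => h x hx⟩

theorem exists_inner_radius {f : ℝ → ℂ} (hf : (0 : ℝ) ∉ tsupport f) :
    ∃ r : ℝ, 0 < r ∧ ∀ x, |x| < r → f x = 0 := by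
  rw [notMem_tsupport_iff_eventuallyEq] at hf
  obtain ⟨r, hr, h⟩ := Metric.eventually_nhds_iff.1 hf
  exact ⟨r, hr, fun x hx => h (by simpa using hx)⟩

/-- The product of a test function vanishing near the origin with a function which is smooth away
from the origin. -/
def mulOff (a : ℝ → ℂ) (ha : ContDiffOn ℝ ∞ a {0}ᶜ) (f : TestFun) (hf : (0 : ℝ) ∉ tsupport f) :
    TestFun :=
  ⟨fun x => f x * a x, contDiff_mul_of_tsupport_subset isOpen_compl_singleton f.contDiff
    (by rintro x hx rfl; exact hf hx) ha, f.hasCompactSupport.mul_right, fun _ _ => trivial⟩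

theorem mulOff_apply (a : ℝ → ℂ) (ha : ContDiffOn ℝ ∞ a {0}ᶜ) (f : TestFun)
    (hf : (0 : ℝ) ∉ tsupport f) (x : ℝ) : mulOff a ha f hf x = f x * a x := rfl

theorem tsupport_mulOff_subset (a : ℝ → ℂ) (ha : ContDiffOn ℝ ∞ a {0}ᶜ) (f : TestFun)
    (hf : (0 : ℝ) ∉ tsupport f) : tsupport (mulOff a ha f hf) ⊆ tsupport f :=
  tsupport_mul_subset_left

theorem contDiffOn_inv_pow (n : ℕ) : ContDiffOn ℝ ∞ (fun x : ℝ => ((x : ℂ) ^ n)⁻¹) {0}ᶜ :=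
  (contDiff_ofReal_pow n).contDiffOn.inv fun _ hx => pow_ne_zero _ (Complex.ofReal_ne_zero.2 hx)

theorem hasDerivAt_inv_pow (n : ℕ) {x : ℝ} (hx : x ≠ 0) :
    ∃ w', HasDerivAt (fun x : ℝ => ((x : ℂ) ^ n)⁻¹) w' x ∧ x * w' = -n * ((x : ℂ) ^ n)⁻¹ := by
  have hx' : (x : ℂ) ≠ 0 := Complex.ofReal_ne_zero.2 hx
  refine ⟨_, (hasDerivAt_ofReal_pow n x).fun_inv (pow_ne_zero _ hx'), ?_⟩
  rcases n with _ | n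
  · simp
  · simp only [Nat.add_sub_cancel]
    field_simp
    ring

theorem signedPower_eventuallyEq (δ : ZMod 2) (α : ℂ) {x : ℝ} (hx : x ≠ 0) :
    signedPower δ α =ᶠ[𝓝 x] fun y =>
      (Real.sign x : ℂ) ^ δ.val * Complex.exp ((Real.log y : ℂ) * α) := by
  have hs : ∀ᶠ y in 𝓝 x, Real.sign y = Real.sign x := by
    rcases lt_or_gt_of_ne hx with h | h
    · filter_upwards [eventually_lt_nhds h] with y hy
      rw [Real.sign_of_neg h, Real.sign_of_neg hy]
    · filter_upwards [eventually_gt_nhds h] with y hy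
      rw [Real.sign_of_pos h, Real.sign_of_pos hy]
  filter_upwards [hs, isOpen_ne.mem_nhds hx] with y hy hy0
  have hy' : ((|y| : ℝ) : ℂ) ≠ 0 := by exact_mod_cast (abs_pos.2 hy0).ne'
  rw [signedPower, hy, Complex.cpow_def_of_ne_zero hy', ← Complex.ofReal_log (abs_nonneg y),
    Real.log_abs]

theorem contDiffOn_signedPower (δ : ZMod 2) (α : ℂ) : ContDiffOn ℝ ∞ (signedPower δ α) {0}ᶜ := by
  intro x hx
  have hx : x ≠ 0 := hx
  refine (ContDiffAt.congr_of_eventuallyEq ?_ (signedPower_eventuallyEq δ α hx)).contDiffWithinAt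
  refine contDiffAt_const.mul (ContDiffAt.cexp (ContDiffAt.mul ?_ contDiffAt_const))
  exact Complex.ofRealCLM.contDiff.contDiffAt.comp x (Real.contDiffAt_log.2 hx)

theorem hasDerivAt_signedPower_right (δ : ZMod 2) (α : ℂ) {x : ℝ} (hx : x ≠ 0) :
    ∃ w', HasDerivAt (signedPower δ α) w' x ∧ x * w' = α * signedPower δ α x := by
  have hx' : (x : ℂ) ≠ 0 := Complex.ofReal_ne_zero.2 hx
  have h := (((Real.hasDerivAt_log hx).ofReal_comp.mul_const α).cexp.const_mul
    ((Real.sign x : ℂ) ^ δ.val))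
  refine ⟨_, h.congr_of_eventuallyEq (signedPower_eventuallyEq δ α hx), ?_⟩
  rw [(signedPower_eventuallyEq δ α hx).eq_of_nhds]
  push_cast
  field_simp

theorem eulerPoly_mulOff (p : ℂ[X]) {a : ℝ → ℂ} (ha : ContDiffOn ℝ ∞ a {0}ᶜ) {b : ℂ}
    (hab : ∀ x : ℝ, x ≠ 0 → ∃ w', HasDerivAt a w' x ∧ x * w' = b * a x) (f : TestFun)
    (hf : (0 : ℝ) ∉ tsupport f) {x : ℝ} (hx : x ≠ 0) :
    eulerPoly p (mulOff a ha f hf) x = a x * eulerPoly (affComp p 1 b) f x := by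
  have := eulerPoly_mul_comp (U := {0}ᶜ) isOpen_compl_singleton (w := a) (m := fun y => y)
    (a := 1) (b := b) (fun x hx => hab x hx)
    (fun x _ => ⟨1, hasDerivAt_id x, by simp⟩) p (F := mulOff a ha f hf) f.contDiff
    (fun x _ => by rw [mulOff_apply, mul_comm]) x hx
  simpa using this

/-- The test function `x⁻² f(1 / x)`. -/
def invTest (f : TestFun) (hf : (0 : ℝ) ∉ tsupport f) : TestFun :=
  ⟨fun x => ((x : ℂ) ^ 2)⁻¹ * f x⁻¹, by
    rw [contDiff_iff_contDiffAt]
    intro x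
    by_cases hx : x = 0
    · obtain ⟨R, hR, h⟩ := exists_radius f
      have : (fun x : ℝ => ((x : ℂ) ^ 2)⁻¹ * f x⁻¹) =ᶠ[𝓝 x] fun _ => 0 := by
        rw [hx]
        filter_upwards [Metric.ball_mem_nhds (0 : ℝ) (inv_pos.2 hR)] with y hy
        by_cases hy0 : y = 0
        · simp [hy0]
        · rw [h y⁻¹ ?_, mul_zero]
          rw [abs_inv, le_inv_comm₀ hR (abs_pos.2 hy0)]
          simpa using (Metric.mem_ball.1 hy).le
      exact contDiffAt_const.congr_of_eventuallyEq this
    · exact ((contDiffOn_inv_pow 2).contDiffAt (isOpen_ne.mem_nhds hx)).mul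
        (f.contDiff.contDiffAt.comp x (contDiffAt_inv ℝ hx)), by
    obtain ⟨r, hr, h⟩ := exists_inner_radius hf
    refine HasCompactSupport.of_support_subset_isCompact (isCompact_closedBall (0 : ℝ) r⁻¹)
      fun x hx => ?_
    by_contra hx'
    refine hx ?_
    have h1 : r⁻¹ < |x| := by simpa using hx'
    simp only
    rw [h x⁻¹ (by rw [abs_inv]; exact inv_lt_of_inv_lt₀ hr h1), mul_zero], fun _ _ => trivial⟩

theorem invTest_apply (f : TestFun) (hf : (0 : ℝ) ∉ tsupport f) (x : ℝ) :
    invTest f hf x = ((x : ℂ) ^ 2)⁻¹ * f x⁻¹ := rfl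

theorem zero_notMem_tsupport_invTest (f : TestFun) (hf : (0 : ℝ) ∉ tsupport f) :
    (0 : ℝ) ∉ tsupport (invTest f hf) := by
  obtain ⟨R, hR, h⟩ := exists_radius f
  refine notMem_tsupport_of_eqOn_zero (inv_pos.2 hR) fun x hx => ?_
  by_cases hx0 : x = 0
  · simp [invTest_apply, hx0]
  · rw [invTest_apply, h x⁻¹ ?_, mul_zero]
    rw [abs_inv, le_inv_comm₀ hR (abs_pos.2 hx0)]
    exact hx.le

theorem apply_zero_of_notMem {f : ℝ → ℂ} (hf : (0 : ℝ) ∉ tsupport f) : f 0 = 0 :=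
  image_eq_zero_of_notMem_tsupport hf

theorem apply_eq_invTest (f : TestFun) (hf : (0 : ℝ) ∉ tsupport f) (x : ℝ) :
    f x = ((x : ℂ) ^ 2)⁻¹ * invTest f hf x⁻¹ := by
  by_cases hx : x = 0
  · simp [hx, apply_zero_of_notMem hf]
  · have hx' : (x : ℂ) ≠ 0 := Complex.ofReal_ne_zero.2 hx
    rw [invTest_apply, inv_inv]
    push_cast
    field_simp

theorem IsExtensionAcrossInfinity.apply_invTest {S T : Distr} (h : IsExtensionAcrossInfinity S T)
    (f : TestFun) (hf : (0 : ℝ) ∉ tsupport f) : T (invTest f hf) = S f :=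
  h _ _ (zero_notMem_tsupport_invTest f hf) (apply_eq_invTest f hf)

theorem isExtensionAcrossInfinity_of {S T : Distr}
    (h : ∀ (f : TestFun) (hf : (0 : ℝ) ∉ tsupport f), T f = S (invTest f hf)) :
    IsExtensionAcrossInfinity S T := fun f g hf hg => by
  rw [h f hf]
  congr 1
  ext x
  rw [invTest_apply, hg]

theorem hasDerivAt_inv_euler {x : ℝ} (hx : x ≠ 0) :
    ∃ m', HasDerivAt (fun x : ℝ => x⁻¹) m' x ∧ x * m' = (-1 : ℝ) * x⁻¹ :=
  ⟨_, hasDerivAt_inv hx, by field_simp⟩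

/-- Inversion turns E into -E, and the Jacobian x⁻² contributes the shift by -2. -/
theorem eulerPoly_invTest (p : ℂ[X]) (f : TestFun) (hf : (0 : ℝ) ∉ tsupport f) {x : ℝ}
    (hx : x ≠ 0) : eulerPoly p (invTest f hf) x =
      ((x : ℂ) ^ 2)⁻¹ * eulerPoly (affComp p (-1) (-2)) f x⁻¹ := by
  have := eulerPoly_mul_comp (U := {0}ᶜ) isOpen_compl_singleton
    (w := fun x : ℝ => ((x : ℂ) ^ 2)⁻¹) (m := fun y => y⁻¹)
    (a := -1) (b := -2) (fun x hx => by simpa using hasDerivAt_inv_pow 2 hx)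
    (fun x hx => hasDerivAt_inv_euler hx) p (F := invTest f hf) f.contDiff
    (fun x _ => rfl) x hx
  simpa using this

/-! ### Integrability and localization away from the origin -/

theorem zpow_le_add_zpow {r R t : ℝ} (hr : 0 < r) (h₁ : r ≤ t) (h₂ : t ≤ R) (k : ℤ) :
    t ^ k ≤ r ^ k + R ^ k := by
  have ht := hr.trans_le h₁
  have hR := ht.trans_le h₂
  have h3 : 0 < r ^ k := zpow_pos hr k
  have h4 : 0 < R ^ k := zpow_pos hR k
  rcases le_total 0 k with hk | hk
  · linarith [zpow_le_zpow_left₀ hk ht.le h₂]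
  · have h5 : t ^ k ≤ r ^ k := by
      have := inv_anti₀ (zpow_pos hr (-k)) (zpow_le_zpow_left₀ (neg_nonneg.2 hk) hr.le h₁)
      simpa only [← zpow_neg, neg_neg] using this
    linarith

theorem PowerBounded.exists_bound {k₀ k₁ : ℤ} {v : ℝ → ℂ} (hv : PowerBounded k₀ k₁ v) {r : ℝ}
    (hr : 0 < r) (R : ℝ) : ∃ C : ℝ, ∀ x, r ≤ |x| → |x| ≤ R → ‖v x‖ ≤ C := by
  obtain ⟨-, C, hC⟩ := hv
  refine ⟨|C| * ((r ^ k₀ + R ^ k₀) + (r ^ (-k₁) + R ^ (-k₁))), fun x h1 h2 => ?_⟩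
  have hx : x ≠ 0 := abs_pos.1 (hr.trans_le h1)
  have hR : 0 < R := hr.trans_le (h1.trans h2)
  have e1 := zpow_le_add_zpow hr h1 h2 k₀
  have e2 := zpow_le_add_zpow hr h1 h2 (-k₁)
  have p1 : 0 < |x| ^ k₀ := zpow_pos (abs_pos.2 hx) _
  have p2 : 0 < |x| ^ (-k₁) := zpow_pos (abs_pos.2 hx) _
  rcases le_total |x| 1 with h | h
  · calc ‖v x‖ ≤ C * |x| ^ k₀ := (hC x hx).1 h
      _ ≤ |C| * |x| ^ k₀ := by gcongr; exact le_abs_self C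
      _ ≤ _ := by gcongr; linarith
  · calc ‖v x‖ ≤ C * |x| ^ (-k₁) := (hC x hx).2 h
      _ ≤ |C| * |x| ^ (-k₁) := by gcongr; exact le_abs_self C
      _ ≤ _ := by gcongr; linarith

/-- The support of F lies in an annulus, where v is bounded and any two powers of |x| are
comparable. All orders are therefore available. -/
theorem PowerBounded.mul_of_notMem {k₀ k₁ : ℤ} {v F : ℝ → ℂ} (hv : PowerBounded k₀ k₁ v)
    (hF : Continuous F) (hc : HasCompactSupport F) (h0 : (0 : ℝ) ∉ tsupport F) (l₀ l₁ : ℤ) :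
    PowerBounded l₀ l₁ fun x => v x * F x := by
  obtain ⟨R, hR, hR'⟩ := hc.exists_pos_le_norm
  obtain ⟨r, hr, hr'⟩ := exists_inner_radius h0
  obtain ⟨C, hC⟩ := hv.exists_bound hr R
  obtain ⟨M, hM⟩ := hc.exists_bound_of_continuous hF
  have hM0 : 0 ≤ M := (norm_nonneg _).trans (hM 0)
  have key : ∀ (l : ℤ) (x : ℝ), x ≠ 0 →
      ‖v x * F x‖ ≤ (|C| * M * (r ^ (-l) + R ^ (-l))) * |x| ^ l := by
    intro l x hx
    have px : 0 < |x| := abs_pos.2 hx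
    have p0 : 0 ≤ (|C| * M * (r ^ (-l) + R ^ (-l))) * |x| ^ l := by positivity
    by_cases h1 : |x| < r
    · rwa [hr' x h1, mul_zero, norm_zero]
    by_cases h2 : R ≤ |x|
    · rwa [hR' x h2, mul_zero, norm_zero]
    have e := zpow_le_add_zpow hr (not_lt.1 h1) (not_le.1 h2).le (-l)
    calc ‖v x * F x‖ ≤ |C| * M := by
          rw [norm_mul]
          exact mul_le_mul ((hC x (not_lt.1 h1) (not_le.1 h2).le).trans (le_abs_self C)) (hM x)
            (norm_nonneg _) (abs_nonneg _)
      _ = |C| * M * |x| ^ (-l) * |x| ^ l := by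
          rw [mul_assoc, ← zpow_add₀ px.ne', neg_add_cancel, zpow_zero, mul_one]
      _ ≤ _ := by gcongr
  refine ⟨hv.1.mul hF.measurable, max (|C| * M * (r ^ (-l₀) + R ^ (-l₀)))
    (|C| * M * (r ^ (-(-l₁)) + R ^ (-(-l₁)))), fun x hx => ⟨fun _ => ?_, fun _ => ?_⟩⟩
  · exact (key l₀ x hx).trans (mul_le_mul_of_nonneg_right (le_max_left _ _) (by positivity))
  · exact (key (-l₁) x hx).trans (mul_le_mul_of_nonneg_right (le_max_right _ _) (by positivity))

theorem PowerBounded.integrable_of_lt {k₀ k₁ : ℤ} {v : ℝ → ℂ} (hv : PowerBounded k₀ k₁ v)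
    (h₀ : -1 < k₀) (h₁ : 1 < k₁) : Integrable v := by
  have h := hv.integrable_norm_mul_rpow (c := 0)
    (by have : (-1 : ℝ) < k₀ := by exact_mod_cast h₀
        linarith) (by have : (1 : ℝ) < k₁ := by exact_mod_cast h₁
                      linarith)
  simp only [Real.rpow_zero, mul_one] at h
  exact (integrable_norm_iff hv.1.aestronglyMeasurable).1 h

theorem PowerBounded.integrable_mul {k₀ k₁ : ℤ} {v F : ℝ → ℂ} (hv : PowerBounded k₀ k₁ v)
    (hF : Continuous F) (hc : HasCompactSupport F) (h0 : (0 : ℝ) ∉ tsupport F) :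
    Integrable fun x => v x * F x :=
  (hv.mul_of_notMem hF hc h0 0 2).integrable_of_lt (by norm_num) (by norm_num)

theorem PowerBounded.integrable_mul_eulerPoly {k₀ k₁ : ℤ} {v : ℝ → ℂ} (hv : PowerBounded k₀ k₁ v)
    (p : ℂ[X]) {f : TestFun} (hf : f ∈ OffZero) : Integrable fun x => v x * eulerPoly p f x :=
  hv.integrable_mul (continuous_eulerPoly p f.contDiff)
    (hasCompactSupport_eulerPoly p f.hasCompactSupport)
    fun h => hf (tsupport_eulerPoly_subset p f h)

/-- The Leibniz formula transfers the cutoff, through its Euler derivatives, to the coefficients.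
Local formulas thus become formulas for all test functions off 0. -/
theorem IsEulerSum.comp_mulTestFun {V : Set TestFun} {B : (ℝ → ℂ) → Prop} {L : TestFun → ℂ}
    (h : IsEulerSum V B L) (W : TestFun) (hV : ∀ f ∈ OffZero, mulTestFun W f ∈ V) {k₀ k₁ : ℤ}
    (hB : ∀ v, B v → ∀ i, PowerBounded k₀ k₁ fun x => v x * (eulerOp^[i] W) x) :
    IsEulerSum OffZero (PowerBounded k₀ k₁) fun f => L (mulTestFun W f) := by
  obtain ⟨ι, hι, v, p, hv, hf⟩ := h
  refine (isEulerSum_sum Finset.univ fun j _ =>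
    isEulerSum_sum (Finset.range ((p j).natDegree + 1)) fun i _ => isEulerSum_single OffZero
      (Polynomial.hasseDeriv i (p j)) (hB _ (hv j) i)).congr fun f hf0 => ?_
  rw [hf _ (hV f hf0)]
  refine Finset.sum_congr rfl fun j _ => ?_
  rw [← integral_finsetSum _ fun i _ => (hB _ (hv j) i).integrable_mul_eulerPoly _ hf0]
  congr 1
  funext x
  rw [show eulerPoly (p j) (mulTestFun W f) x = eulerPoly (p j) (fun y => W y * f y) x from rfl,
    eulerPoly_leibniz (p j) (Nat.lt_succ_self _) W.contDiff f.contDiff, Finset.mul_sum]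
  refine Finset.sum_congr rfl fun i _ => ?_
  ring

theorem integral_mul_eulerPoly_invTest (v : ℝ → ℂ) (p : ℂ[X]) (f : TestFun)
    (hf : (0 : ℝ) ∉ tsupport f) : ∫ x, v x * eulerPoly p (invTest f hf) x =
      ∫ x, v x⁻¹ * eulerPoly (affComp p (-1) (-2)) f x := by
  rw [← integral_comp_inv_mul]
  refine integral_congr_ae (ae_ne_zero.mono fun x hx => ?_)
  have hx' : (x : ℂ) ≠ 0 := Complex.ofReal_ne_zero.2 hx
  simp only
  rw [eulerPoly_invTest _ _ _ (inv_ne_zero hx), inv_inv]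
  push_cast
  field_simp

theorem IsEulerSum.comp_invTest {k₀ k₁ : ℤ} {L L' : TestFun → ℂ}
    (h : IsEulerSum OffZero (PowerBounded k₀ k₁) L)
    (hL : ∀ (f : TestFun) (hf : (0 : ℝ) ∉ tsupport f), L' f = L (invTest f hf)) :
    IsEulerSum OffZero (PowerBounded k₁ k₀) L' := by
  obtain ⟨ι, hι, v, p, hv, hf⟩ := h
  refine ⟨ι, hι, fun j x => v j x⁻¹, fun j => affComp (p j) (-1) (-2), fun j => (hv j).comp_inv,
    fun f hf0 => ?_⟩
  have hf0 : (0 : ℝ) ∉ tsupport f := hf0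
  rw [hL f hf0, hf _ (zero_notMem_tsupport_invTest f hf0)]
  exact Finset.sum_congr rfl fun j _ => integral_mul_eulerPoly_invTest _ _ f hf0

/-! ### Localization near the origin -/

/-- For negative k the formula is that of x^n T; on functions supported off 0 it can be evaluated at
x^(-n) f, which divides the coefficients by x^n and shifts the polynomials. -/
theorem VanishesToOrder.exists_isEulerSum {T : Distr} {k : ℤ} (hT : VanishesToOrder T k) :
    ∃ r : ℝ, 0 < r ∧ IsEulerSum {f | (0 : ℝ) ∉ tsupport f ∧ tsupport f ⊆ Set.Ioo (-r) r}
      (fun v => Measurable v ∧ ∃ C : ℝ, ∀ x, x ≠ 0 → ‖v x‖ ≤ C * |x| ^ k) T := by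
  rcases k with k | n
  · obtain ⟨r, hr, ι, hι, v, p, hv, hf⟩ := VanishesToNatOrder.isLocalEulerSum hT
    exact ⟨r, hr, ι, hι, v, p, fun j => ⟨(hv j).1, (hv j).2.imp fun C hC x _ => by
      simpa using hC x⟩, fun f h => hf f h.2⟩
  · obtain ⟨r, hr, ι, hι, v, p, hv, hf⟩ := VanishesToNatOrder.isLocalEulerSum hT
    refine ⟨r, hr, ι, hι, fun j x => v j x * ((x : ℂ) ^ (n + 1))⁻¹,
      fun j => affComp (p j) 1 (-(n + 1 : ℕ)), fun j => ⟨(hv j).1.mul (by fun_prop), ?_⟩,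
      fun f h => ?_⟩
    · obtain ⟨C, hC⟩ := (hv j).2
      refine ⟨C, fun x hx => ?_⟩
      have := hC x
      rw [pow_zero, mul_one] at this
      rw [norm_mul, norm_inv, norm_pow, Complex.norm_real, Real.norm_eq_abs, zpow_negSucc]
      gcongr
    · let g := mulOff _ (contDiffOn_inv_pow (n + 1)) f h.1
      have e : T f = mulPow (n + 1) T g := by
        change T f = T (mulTest _ _ g)
        congr 1
        ext x
        rw [mulTest_apply, mulOff_apply]
        by_cases hx : x = 0
        · simp [hx, apply_zero_of_notMem h.1]
        · have hx' : (x : ℂ) ≠ 0 := Complex.ofReal_ne_zero.2 hx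
          field_simp
      rw [e, hf g ((tsupport_mulOff_subset _ _ _ _).trans h.2)]
      refine Finset.sum_congr rfl fun j _ => integral_congr_ae (ae_ne_zero.mono fun x hx => ?_)
      simp only [g]
      rw [eulerPoly_mulOff (p j) _ (fun x hx => hasDerivAt_inv_pow (n + 1) hx) f h.1 hx, mul_assoc]

/-- The cutoff W is supported in |x| < 1, so the new coefficients vanish for |x| ≥ 1. The order l at
∞ is therefore arbitrary. -/
theorem VanishesToOrder.isEulerSum_mulTestFun {T : Distr} {k : ℤ} (hT : VanishesToOrder T k) :
    ∃ r : ℝ, 0 < r ∧ ∀ W : TestFun, tsupport W ⊆ Metric.ball 0 r → ∀ l : ℤ,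
      IsEulerSum OffZero (PowerBounded k l) fun f => T (mulTestFun W f) := by
  obtain ⟨r, hr, h⟩ := hT.exists_isEulerSum
  refine ⟨min r 1, by positivity, fun W hW l => h.comp_mulTestFun W (fun f hf => ⟨fun h0 => hf
    (tsupport_mulTestFun_subset_right W f h0), fun x hx => ?_⟩) fun v hv i => ?_⟩
  · have := hW (tsupport_mulTestFun_subset_left W f hx)
    rw [Metric.mem_ball, dist_zero_right, Real.norm_eq_abs] at this
    exact abs_lt.1 (this.trans_le (min_le_left _ _))
  · obtain ⟨hm, C, hC⟩ := hv
    obtain ⟨M, hM⟩ := exists_bound_iterate_eulerOp W.contDiff W.hasCompactSupport i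
    have hM0 : 0 ≤ M := (norm_nonneg _).trans (hM 0)
    refine ⟨hm.mul (contDiff_iterate_eulerOp W.contDiff i).continuous.measurable, C * M,
      fun x hx => ⟨fun _ => ?_, fun h1 => ?_⟩⟩
    · rw [norm_mul, mul_right_comm]
      exact mul_le_mul (hC x hx) (hM x) (norm_nonneg _) ((norm_nonneg _).trans (hC x hx))
    · have h0 : (eulerOp^[i] W) x = 0 := image_eq_zero_of_notMem_tsupport fun h => by
        have := hW (tsupport_iterate_eulerOp_subset i W h)
        rw [Metric.mem_ball, dist_zero_right, Real.norm_eq_abs] at this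
        exact absurd (this.trans_le (min_le_right _ _)) (not_lt.2 h1)
      have hC0 : 0 ≤ C := by
        have := (norm_nonneg _).trans (hC 1 one_ne_zero)
        simpa using this
      simp only [h0, mul_zero, norm_zero]
      positivity

/-- Smooth partitions of unity on `ℝ ∪ {∞}` subordinate to neighborhoods of `0` and of `∞`. -/
theorem exists_partition {r : ℝ} (hr : 0 < r) : ∃ φ ψ : TestFun,
    (∀ x : ℝ, x ≠ 0 → φ x + ψ x⁻¹ = 1) ∧ (∀ x, |x| ≤ r → φ x = 1) ∧
    tsupport φ ⊆ Metric.closedBall 0 (2 * r) ∧ tsupport ψ ⊆ Metric.closedBall 0 r⁻¹ ∧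
    ∀ x, φ (-x) = φ x := by
  obtain ⟨φ, hφ1, hφ0, hφs, hφe⟩ := exists_cutoff hr
  -- The partner of φ at ∞ is 1 - φ(1/y), with value 1 at y = 0; it is constant near 0 because φ has
  -- compact support.
  have hsm : ContDiff ℝ ∞ fun y : ℝ => if y = 0 then (1 : ℂ) else 1 - φ y⁻¹ := by
    rw [contDiff_iff_contDiffAt]
    intro x
    by_cases hx : x = 0
    · refine contDiffAt_const (c := (1 : ℂ)).congr_of_eventuallyEq ?_
      rw [hx]
      filter_upwards [Metric.ball_mem_nhds (0 : ℝ) (inv_pos.2 (mul_pos two_pos hr))] with y hy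
      split_ifs with hy0
      · rfl
      · rw [hφ0 y⁻¹ ?_, sub_zero]
        rw [abs_inv, le_inv_comm₀ (by positivity) (abs_pos.2 hy0)]
        simpa using (Metric.mem_ball.1 hy).le
    · refine (contDiffAt_const.sub (φ.contDiff.contDiffAt.comp x
        (contDiffAt_inv ℝ hx))).congr_of_eventuallyEq (f₁ := fun y : ℝ => if y = 0 then (1 : ℂ) else 1 - φ y⁻¹) (f := fun y => (1 : ℂ) - (φ ∘ fun y => y⁻¹) y) ?_
      filter_upwards [isOpen_ne.mem_nhds hx] with y hy
      rw [if_neg hy]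
      rfl
  have hsupp : tsupport (fun y : ℝ => if y = 0 then (1 : ℂ) else 1 - φ y⁻¹) ⊆
      Metric.closedBall 0 r⁻¹ := by
    refine closure_minimal (fun x hx => ?_) Metric.isClosed_closedBall
    by_contra hx'
    refine hx ?_
    have h1 : r⁻¹ < |x| := by simpa using hx'
    have hx0 : x ≠ 0 := abs_pos.1 ((inv_pos.2 hr).trans h1)
    simp only [if_neg hx0]
    rw [hφ1 x⁻¹ (by rw [abs_inv]; exact (inv_lt_of_inv_lt₀ hr h1).le), sub_self]
  refine ⟨φ, ⟨fun y => if y = 0 then (1 : ℂ) else 1 - φ y⁻¹, hsm,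
    (isCompact_closedBall (0 : ℝ) r⁻¹).of_isClosed_subset (isClosed_tsupport _) hsupp,
    fun _ _ => trivial⟩, fun x hx => ?_, hφ1, hφs, hsupp, hφe⟩
  change φ x + (if x⁻¹ = 0 then (1 : ℂ) else 1 - φ x⁻¹⁻¹) = 1
  rw [if_neg (inv_ne_zero hx), inv_inv]
  ring

/-- A tempered distribution with prescribed orders of vanishing at `0` and at `∞` is, away from
the origin, a finite sum of Euler operators applied to functions with the corresponding bounds. -/
theorem isEulerSum_of_vanishesToOrder (σ : 𝓢'(ℝ, ℂ)) {T : Distr} {k₀ k₁ : ℤ}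
    (h₀ : VanishesToOrder (toDistr σ) k₀) (hT : IsExtensionAcrossInfinity (toDistr σ) T)
    (h₁ : VanishesToOrder T k₁) : IsEulerSum OffZero (PowerBounded k₀ k₁) (toDistr σ) := by
  obtain ⟨r, hr, hr'⟩ := h₀.isEulerSum_mulTestFun
  obtain ⟨ρ, hρ, hρ'⟩ := h₁.isEulerSum_mulTestFun
  obtain ⟨K, hK⟩ := exists_isEulerSum_off_zero (temperedCLM σ)
  -- Decompose 1 = φ + (φ' - φ) + (1 - φ'). The radii place φ in |x| ≤ 2r/3 and 1 - φ' = ψ(1/x) in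
  -- |1/x| ≤ ρ/2, inside the regions of the two local formulas. The middle piece lives in an
  -- annulus, where the global tempered formula applies with any orders.
  obtain ⟨φ, -, -, hφ1, hφs, -, -⟩ := exists_partition (r := r / 3) (by positivity)
  obtain ⟨φ', ψ, hψ, hφ1', -, hψs, -⟩ := exists_partition (r := 2 / ρ) (by positivity)
  have A := hr' φ (fun x hx => by
    have := hφs hx
    rw [Metric.mem_closedBall] at this
    rw [Metric.mem_ball]
    linarith) k₁
  have B : IsEulerSum OffZero (PowerBounded k₀ k₁) fun f => toDistr σ (mulTestFun (φ' - φ) f) := by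
    have h0 : (0 : ℝ) ∉ tsupport (φ' - φ) := by
      refine notMem_tsupport_of_eqOn_zero (r := min (r / 3) (2 / ρ)) (by positivity) fun x hx => ?_
      change φ' x - φ x = 0
      rw [hφ1 x (hx.le.trans (min_le_left _ _)), hφ1' x (hx.le.trans (min_le_right _ _)), sub_self]
    refine hK.comp_mulTestFun (φ' - φ) (fun f hf h => hf (tsupport_mulTestFun_subset_right _ f h))
      fun v hv i => hv.mul_of_notMem (contDiff_iterate_eulerOp (φ' - φ).contDiff i).continuous
        ((φ' - φ).hasCompactSupport.of_isClosed_subset (isClosed_tsupport _)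
          (tsupport_iterate_eulerOp_subset i _))
        (fun h => h0 (tsupport_iterate_eulerOp_subset i _ h)) _ _
  -- On (1 - φ') f the distribution agrees with its extension T evaluated on ψ times the inverted
  -- function. Inversion exchanges the roles of the two orders.
  have C := (hρ' ψ (fun x hx => by
    have := hψs hx
    rw [Metric.mem_closedBall, inv_div] at this
    rw [Metric.mem_ball]
    linarith) k₀).comp_invTest (L' := fun f => toDistr σ f - toDistr σ (mulTestFun φ' f))
      (fun f hf => by
        have h0 : (0 : ℝ) ∉ tsupport (f - mulTestFun φ' f) := by
          obtain ⟨r, hr, h⟩ := exists_inner_radius hf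
          refine notMem_tsupport_of_eqOn_zero hr fun x hx => ?_
          change f x - φ' x * f x = 0
          rw [h x hx, mul_zero, sub_self]
        rw [← map_sub, ← hT.apply_invTest _ h0]
        congr 1
        ext x
        rw [mulTestFun_apply, invTest_apply, invTest_apply]
        change _ * (f x⁻¹ - φ' x⁻¹ * f x⁻¹) = _
        by_cases hx : x = 0
        · simp [hx]
        · have := hψ x⁻¹ (inv_ne_zero hx)
          rw [inv_inv] at this
          rw [← eq_sub_iff_add_eq'] at this
          rw [this]
          ring)
  refine ((A.add B).add C).congr fun f _ => ?_
  have : toDistr σ (mulTestFun (φ' - φ) f) =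
      toDistr σ (mulTestFun φ' f) - toDistr σ (mulTestFun φ f) := by
    rw [← map_sub]
    congr 1
    ext x
    change (φ' x - φ x) * f x = φ' x * f x - φ x * f x
    ring
  rw [this]
  ring

/-! ### Distributions defined by locally integrable functions -/

/-- The distribution `f ↦ ∫ u * p(x d/dx) f`, for a locally integrable function `u`. -/
def eulerDistr (u : ℝ → ℂ) (p : ℂ[X]) : Distr :=
  ∑ i ∈ Finset.range (p.natDegree + 1), p.coeff i •
    (TestFunction.integralAgainstBilinCLM (ContinuousLinearMap.mul ℂ ℂ) volume u).comp
      (eulerTest ^ i)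

theorem coe_eulerTest_pow (i : ℕ) (f : TestFun) : ⇑((eulerTest ^ i) f) = eulerOp^[i] f := by
  induction i with
  | zero => rfl
  | succ n ih =>
    rw [pow_succ', mul_apply_eq_comp, coe_eulerTest, ih, Function.iterate_succ_apply']

theorem integrable_mul_of_locallyIntegrable {u F : ℝ → ℂ} (hu : LocallyIntegrable u)
    (hF : Continuous F) (hc : HasCompactSupport F) : Integrable fun x => u x * F x := by
  have := hu.integrable_smul_right_of_hasCompactSupport hF hc
  simpa only [smul_eq_mul] using this

theorem eulerDistr_apply {u : ℝ → ℂ} (hu : LocallyIntegrable u) (p : ℂ[X]) (f : TestFun) :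
    eulerDistr u p f = ∫ x, u x * eulerPoly p f x := by
  have hu' : LocallyIntegrableOn u ((⊤ : TopologicalSpace.Opens ℝ) : Set ℝ) volume := by
    simpa [locallyIntegrableOn_univ] using hu
  have h : ∀ i, Integrable fun x => u x * (p.coeff i * (eulerOp^[i] f) x) := fun i =>
    integrable_mul_of_locallyIntegrable hu
      (continuous_const.mul (contDiff_iterate_eulerOp f.contDiff i).continuous)
      (HasCompactSupport.mul_left (f.hasCompactSupport.of_isClosed_subset (isClosed_tsupport _)
        (tsupport_iterate_eulerOp_subset i f)))
  simp only [eulerPoly_eq_sum_range p (Nat.lt_succ_self _), Finset.mul_sum]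
  rw [integral_finsetSum _ fun i _ => h i, eulerDistr, sum_apply]
  refine Finset.sum_congr rfl fun i _ => ?_
  rw [smul_apply, ContinuousLinearMap.comp_apply,
    TestFunction.integralAgainstBilinCLM_eq_integral hu', smul_eq_mul, ← integral_const_mul]
  congr 1
  funext x
  rw [coe_eulerTest_pow, ContinuousLinearMap.mul_apply']
  ring

theorem PowerBounded.truncate {k₀ k₁ : ℤ} {v : ℝ → ℂ} (hv : PowerBounded k₀ k₁ v) {R : ℝ}
    (hR : 1 ≤ R) (l : ℤ) : PowerBounded k₀ l fun x => if |x| ≤ R then v x else 0 := by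
  obtain ⟨C', hC'⟩ := hv.exists_bound one_pos R
  obtain ⟨hm, C, hC⟩ := hv
  refine ⟨Measurable.ite (measurableSet_le measurable_norm measurable_const) hm measurable_const,
    max C (|C'| * (1 ^ l + R ^ l)), fun x hx => ⟨fun h => ?_, fun h => ?_⟩⟩ <;> dsimp only
  · rw [if_pos (h.trans hR)]
    exact ((hC x hx).1 h).trans (mul_le_mul_of_nonneg_right (le_max_left _ _) (by positivity))
  · have px : 0 < |x| := abs_pos.2 hx
    split_ifs with h'
    · refine le_trans ?_ (mul_le_mul_of_nonneg_right (le_max_right _ _) (by positivity))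
      have e := zpow_le_add_zpow one_pos h h' l
      calc ‖v x‖ ≤ |C'| := (hC' x h h').trans (le_abs_self _)
        _ = |C'| * |x| ^ l * |x| ^ (-l) := by
          rw [mul_assoc, ← zpow_add₀ px.ne', add_neg_cancel, zpow_zero, mul_one]
        _ ≤ _ := by gcongr
    · rw [norm_zero]
      have : 0 ≤ max C (|C'| * (1 ^ l + R ^ l)) := le_max_of_le_right (by positivity)
      positivity

theorem PowerBounded.mul_bounded {k₀ k₁ : ℤ} {v F : ℝ → ℂ} (hv : PowerBounded k₀ k₁ v)
    (hF : Measurable F) {M : ℝ} (hM : ∀ x, ‖F x‖ ≤ M) :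
    PowerBounded k₀ k₁ fun x => v x * F x := by
  obtain ⟨hm, C, hC⟩ := hv
  have hM0 : 0 ≤ M := (norm_nonneg _).trans (hM 0)
  refine ⟨hm.mul hF, C * M, fun x hx => ⟨fun h => ?_, fun h => ?_⟩⟩ <;>
    rw [norm_mul, mul_right_comm]
  · exact mul_le_mul ((hC x hx).1 h) (hM x) (norm_nonneg _)
      ((norm_nonneg _).trans ((hC x hx).1 h))
  · exact mul_le_mul ((hC x hx).2 h) (hM x) (norm_nonneg _)
      ((norm_nonneg _).trans ((hC x hx).2 h))

theorem PowerBounded.mul_hasCompactSupport {k₀ k₁ : ℤ} {v F : ℝ → ℂ} (hv : PowerBounded k₀ k₁ v)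
    (hF : Continuous F) (hc : HasCompactSupport F) (l : ℤ) :
    PowerBounded k₀ l fun x => v x * F x := by
  obtain ⟨R, hR, hR'⟩ := hc.exists_pos_le_norm
  obtain ⟨M, hM⟩ := hc.exists_bound_of_continuous hF
  have := (hv.truncate (le_max_right R 1) l).mul_bounded hF.measurable hM
  convert this using 2 with x
  split_ifs with h
  · rfl
  · rw [hR' x ((le_max_left R 1).trans (not_le.1 h).le), mul_zero, mul_zero]

theorem PowerBounded.locallyIntegrable_mul_signedPower {k₀ k₁ : ℤ} {v : ℝ → ℂ}
    (hv : PowerBounded k₀ k₁ v) (δ : ZMod 2) {α : ℂ} (h : -(k₀ : ℝ) - 1 < α.re) :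
    LocallyIntegrable fun x => v x * signedPower δ α x := by
  rw [locallyIntegrable_iff]
  intro K hK
  obtain ⟨R, hR⟩ := hK.isBounded.exists_norm_le
  obtain ⟨l, hl⟩ := exists_int_gt (α.re + 1)
  have := (hv.truncate (le_max_right R 1) l).integrable_mul_signedPower δ h (by linarith)
  refine this.integrableOn.congr_fun (fun x hx => ?_) hK.measurableSet
  simp only
  rw [if_pos (((Real.norm_eq_abs x).symm.le.trans (hR x hx)).trans (le_max_left _ _))]

theorem PowerBounded.locallyIntegrable {k₀ k₁ : ℤ} {v : ℝ → ℂ}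
    (hv : PowerBounded k₀ k₁ v) (h : 0 ≤ k₀) : LocallyIntegrable v := by
  rw [locallyIntegrable_iff]
  intro K hK
  obtain ⟨R, hR⟩ := hK.isBounded.exists_norm_le
  have := (hv.truncate (le_max_right R 1) 2).integrable_of_lt (by omega) (by norm_num)
  refine this.integrableOn.congr_fun (fun x hx => ?_) hK.measurableSet
  simp only
  rw [if_pos (((Real.norm_eq_abs x).symm.le.trans (hR x hx)).trans (le_max_left _ _))]

/-- Only the behavior on 0 < |x| ≤ 1 matters, so the coefficients are truncated there to satisfy a
bound at every point. -/
theorem vanishesToNatOrder_of_eq {T : Distr} {l : ℕ} {ι : Type} [Fintype ι] {u : ι → ℝ → ℂ}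
    {p : ι → ℂ[X]} (hm : ∀ j, Measurable (u j))
    (hu : ∀ j, ∃ C : ℝ, ∀ x : ℝ, x ≠ 0 → |x| ≤ 1 → ‖u j x‖ ≤ C * |x| ^ l)
    (hT : ∀ f : TestFun, tsupport f ⊆ Set.Ioo (-1) 1 → T f = ∑ j, ∫ x, u j x * eulerPoly (p j) f x) :
    VanishesToNatOrder T l := by
  refine vanishesToNatOrder_iff.2 ⟨1, one_pos, ι, inferInstance,
    fun j x => if x ≠ 0 ∧ |x| ≤ 1 then u j x else 0, p, fun j => ⟨?_, ?_⟩, fun f hf => ?_⟩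
  · exact Measurable.ite ((measurableSet_singleton (0 : ℝ)).compl.inter
      (measurableSet_le measurable_norm measurable_const)) (hm j) measurable_const
  · obtain ⟨C, hC⟩ := hu j
    refine ⟨|C|, fun x => ?_⟩
    dsimp only
    split_ifs with h
    · exact (hC x h.1 h.2).trans (mul_le_mul_of_nonneg_right (le_abs_self C) (by positivity))
    · rw [norm_zero]
      positivity
  · rw [hT f hf]
    refine Finset.sum_congr rfl fun j _ => integral_congr_ae (ae_ne_zero.mono fun x hx => ?_)
    simp only
    by_cases h : |x| ≤ 1
    · rw [if_pos ⟨hx, h⟩]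
    · rw [eulerPoly_eq_zero_of_notMem_tsupport (p j) (f := f) fun h' =>
        h (abs_le.2 ⟨(hf h').1.le, (hf h').2.le⟩), mul_zero, mul_zero]

/-! ### Multiplication by powers of the absolute value -/

/-- The canonical extension of `(sgn x)^δ |x|^α ∑ p_j(x d/dx)^* v_j` across the origin. -/
def powerExt {ι : Type} [Fintype ι] (v : ι → ℝ → ℂ) (p : ι → ℂ[X]) (δ : ZMod 2) (α : ℂ) : Distr :=
  ∑ j, eulerDistr (fun x => v j x * signedPower δ α x) (affComp (p j) 1 α)

section PowerExt

variable {ι : Type} [Fintype ι] {v : ι → ℝ → ℂ} {p : ι → ℂ[X]} {k₀ k₁ : ℤ} {S : Distr}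

theorem powerExt_apply (hv : ∀ j, PowerBounded k₀ k₁ (v j)) (δ : ZMod 2) {α : ℂ}
    (h : -(k₀ : ℝ) - 1 < α.re) (f : TestFun) : powerExt v p δ α f =
      ∑ j, ∫ x, v j x * signedPower δ α x * eulerPoly (affComp (p j) 1 α) f x := by
  rw [powerExt, sum_apply]
  exact Finset.sum_congr rfl fun j _ =>
    eulerDistr_apply ((hv j).locallyIntegrable_mul_signedPower δ h) _ f

theorem natDegree_affComp_le (p : ℂ[X]) (α : ℂ) : (affComp p 1 α).natDegree ≤ p.natDegree := by
  have h := Polynomial.natDegree_taylor p α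
  rw [Polynomial.taylor_apply] at h
  simp [affComp, h]

theorem coeff_affComp (p : ℂ[X]) (α : ℂ) (i : ℕ) :
    (affComp p 1 α).coeff i = (Polynomial.hasseDeriv i p).eval α := by
  rw [← Polynomial.taylor_coeff, Polynomial.taylor_apply]
  simp [affComp]

theorem signedPower_norm_le (δ : ZMod 2) {v : ℝ → ℂ} (hv : PowerBounded k₀ k₁ v) {α : ℂ} {l : ℕ}
    (hl : (l : ℝ) ≤ α.re + k₀) :
    ∃ C : ℝ, ∀ x : ℝ, x ≠ 0 → |x| ≤ 1 → ‖v x * signedPower δ α x‖ ≤ C * |x| ^ l := by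
  obtain ⟨hm, C, hC⟩ := hv
  refine ⟨|C|, fun x hx h => ?_⟩
  have px : 0 < |x| := abs_pos.2 hx
  rw [norm_mul, norm_signedPower δ α hx]
  calc ‖v x‖ * |x| ^ α.re ≤ |C| * |x| ^ k₀ * |x| ^ α.re := by
        gcongr
        exact ((hC x hx).1 h).trans (mul_le_mul_of_nonneg_right (le_abs_self C) (by positivity))
    _ = |C| * |x| ^ (α.re + k₀) := by
        rw [mul_assoc, ← Real.rpow_intCast, ← Real.rpow_add px, add_comm]
    _ ≤ |C| * |x| ^ (l : ℝ) := by
        gcongr |C| * ?_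
        exact Real.rpow_le_rpow_of_exponent_ge px h hl
    _ = _ := by rw [Real.rpow_natCast]

/-- Off 0 the formula is forced, because p(E) applied to |x|^α f is |x|^α p(E + α) f. The condition
Re α > -k₀ - 1 makes v_j |x|^α locally integrable, so the same formula makes sense across 0; the
orders of vanishing are read off from the size of v_j |x|^α. -/
theorem isPowerExtension_powerExt (hv : ∀ j, PowerBounded k₀ k₁ (v j))
    (hS : ∀ f ∈ OffZero, S f = ∑ j, ∫ x, v j x * eulerPoly (p j) f x) (δ : ZMod 2) :
    IsPowerExtension δ S k₀ (powerExt v p δ) where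
  extends_off_zero α hα f g hf hg := by
    have e : g = mulOff _ (contDiffOn_signedPower δ α) f hf := by
      ext x
      rw [hg, mulOff_apply, mul_comm]
    have hg0 : g ∈ OffZero := fun h => hf (tsupport_mulOff_subset _ _ _ _ (e ▸ h))
    rw [powerExt_apply hv δ hα, hS g hg0]
    refine Finset.sum_congr rfl fun j _ => integral_congr_ae (ae_ne_zero.mono fun x hx => ?_)
    simp only
    rw [e, eulerPoly_mulOff (p j) _ (fun x hx => hasDerivAt_signedPower_right δ α hx) f hf hx,
      mul_assoc]
  holomorphic f := by
    have hF : ∀ i, Continuous (eulerOp^[i] f) := fun i =>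
      (contDiff_iterate_eulerOp f.contDiff i).continuous
    have hc : ∀ i, HasCompactSupport (eulerOp^[i] f) := fun i =>
      f.hasCompactSupport.of_isClosed_subset (isClosed_tsupport _)
        (tsupport_iterate_eulerOp_subset i f)
    -- Expanding p(X + α) in powers of X separates the dependence on α into polynomials and
    -- holomorphic integrals.
    have key : ∀ α ∈ {α : ℂ | -(k₀ : ℝ) - 1 < α.re}, powerExt v p δ α f =
        ∑ j, ∑ i ∈ Finset.range ((p j).natDegree + 1), (Polynomial.hasseDeriv i (p j)).eval α *
          ∫ x, (v j x * (eulerOp^[i] f) x) * signedPower δ α x := by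
      intro α hα
      rw [powerExt_apply hv δ hα]
      refine Finset.sum_congr rfl fun j _ => ?_
      have hi : ∀ i, Integrable fun x => v j x * (eulerOp^[i] f) x * signedPower δ α x := fun i => by
        have := integrable_mul_of_locallyIntegrable
          ((hv j).locallyIntegrable_mul_signedPower δ hα) (hF i) (hc i)
        refine this.congr (Eventually.of_forall fun x => ?_)
        simp only
        ring
      simp only [← integral_const_mul]
      rw [← integral_finsetSum _ fun i _ => (hi i).const_mul _]
      congr 1
      funext x
      rw [eulerPoly_eq_sum_range _ (Nat.lt_succ_of_le (natDegree_affComp_le (p j) α)),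
        Finset.mul_sum]
      refine Finset.sum_congr rfl fun i _ => ?_
      rw [coeff_affComp]
      ring
    refine DifferentiableOn.congr (fun α hα => ?_) key
    refine (DifferentiableAt.fun_sum fun j _ => DifferentiableAt.fun_sum fun i _ =>
      DifferentiableAt.mul ?_ ?_).differentiableWithinAt
    · exact (Polynomial.differentiable _).differentiableAt
    · obtain ⟨l, hl⟩ := exists_int_gt (α.re + 2)
      have hu := (hv j).mul_hasCompactSupport (hF i) (hc i) l
      exact differentiableAt_integral_mul_signedPower δ hu.1.aestronglyMeasurable
        (a := -(k₀ : ℝ) - 1) (b := α.re + 1)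
        (fun c h1 h2 => hu.integrable_norm_mul_rpow h1 (by linarith)) hα (by linarith)
  vanishes α hα l hl :=
    vanishesToNatOrder_of_eq (fun j => (hv j).1.mul (measurable_signedPower δ α))
      (fun j => signedPower_norm_le δ (hv j) hl) fun f _ => powerExt_apply hv δ hα f

end PowerExt

theorem VanishesToNatOrder.sub {T T' : Distr} {k : ℕ} (h : VanishesToNatOrder T k)
    (h' : VanishesToNatOrder T' k) : VanishesToNatOrder (T - T') k := by
  rw [vanishesToNatOrder_iff] at *
  obtain ⟨r, hr, ι, hι, v, p, hv, hf⟩ := h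
  obtain ⟨r', hr', ι', hι', v', p', hv', hf'⟩ := h'
  have H : IsEulerSum {f | tsupport f ⊆ Set.Ioo (-min r r') (min r r')} (PowBounded k) T :=
    ⟨ι, hι, v, p, hv, fun f h => hf f (h.trans (Set.Ioo_subset_Ioo
      (neg_le_neg (min_le_left _ _)) (min_le_left _ _)))⟩
  have H' : IsEulerSum {f | tsupport f ⊆ Set.Ioo (-min r r') (min r r')} (PowBounded k)
      fun f => -T' f := by
    refine ⟨ι', hι', fun j x => -v' j x, p', fun j => ⟨(hv' j).1.neg, ?_⟩, fun f h => ?_⟩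
    · obtain ⟨C, hC⟩ := (hv' j).2
      exact ⟨C, fun x => by simpa using hC x⟩
    · dsimp only
      rw [hf' f (h.trans (Set.Ioo_subset_Ioo (neg_le_neg (min_le_right _ _)) (min_le_right _ _))),
        ← Finset.sum_neg_distrib]
      simp only [neg_mul, integral_neg]
  exact ⟨min r r', lt_min hr hr', (H.add H').congr fun f _ => by rw [sub_apply, sub_eq_add_neg]⟩

/-- For Re α ≥ -k both families vanish to order 0 and agree off 0, so they coincide there. The
remaining strip -k - 1 < Re α < -k is reached by analytic continuation. -/
theorem IsPowerExtension.eq {δ : ZMod 2} {T : Distr} {k : ℤ} {E E' : ℂ → Distr}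
    (h : IsPowerExtension δ T k E) (h' : IsPowerExtension δ T k E') {α : ℂ}
    (hα : -(k : ℝ) - 1 < α.re) : E α = E' α := by
  have key : ∀ α : ℂ, -(k : ℝ) ≤ α.re → ∀ f, E α f = E' α f := by
    intro α hα f
    have hα' : -(k : ℝ) - 1 < α.re := by linarith
    have h0 : ((0 : ℕ) : ℝ) ≤ α.re + k := by push_cast; linarith
    have := eq_zero_of_vanishesToNatOrder ((h.vanishes α hα' 0 h0).sub (h'.vanishes α hα' 0 h0))
      (fun f hf => by
        have e : ∀ x, mulOff _ (contDiffOn_signedPower δ α) f hf x = signedPower δ α x * f x :=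
          fun x => by rw [mulOff_apply, mul_comm]
        rw [sub_apply, h.extends_off_zero α hα' f _ hf e, h'.extends_off_zero α hα' f _ hf e,
          sub_self]) f
    rwa [sub_apply, sub_eq_zero] at this
  ext f
  have hopen : IsOpen {α : ℂ | -(k : ℝ) - 1 < α.re} := isOpen_lt continuous_const Complex.continuous_re
  have hz : ((-(k : ℝ) + 1 : ℝ) : ℂ) ∈ {α : ℂ | -(k : ℝ) - 1 < α.re} := by
    simp only [Set.mem_ofPred_eq, Complex.ofReal_re]
    linarith
  refine ((h.holomorphic f).analyticOnNhd hopen).eqOn_of_preconnected_of_eventuallyEq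
    ((h'.holomorphic f).analyticOnNhd hopen) (convex_halfSpace_re_gt _).isPreconnected hz ?_ hα
  have : {α : ℂ | -(k : ℝ) < α.re} ∈ 𝓝 ((-(k : ℝ) + 1 : ℝ) : ℂ) :=
    (isOpen_lt continuous_const Complex.continuous_re).mem_nhds (by
      simp only [Set.mem_ofPred_eq, Complex.ofReal_re]
      linarith)
  filter_upwards [this] with β hβ using key β (le_of_lt hβ) f

/-! ### The signed Mellin transform of a sum of Euler operators -/

theorem eulerPoly_fun_const (q : ℂ[X]) (c : ℂ) (x : ℝ) :
    eulerPoly q (fun _ => c) x = q.eval 0 * c := by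
  -- A constant function is the degenerate composition with m = 0, so both the slope a and the shift
  -- b are 0.
  have := eulerPoly_mul_comp (U := Set.univ) isOpen_univ (w := fun _ : ℝ => 1) (m := fun _ => 0)
    (a := 0) (b := 0) (fun x _ => ⟨0, hasDerivAt_const x 1, by simp⟩)
    (fun x _ => ⟨0, hasDerivAt_const x 0, by simp⟩) q (F := fun _ => c) (G := fun _ => c)
    contDiff_const (fun x _ => by simp) x trivial
  rw [this]
  have h : affComp q ((0 : ℝ) : ℂ) 0 = Polynomial.C (q.eval 0) := by simp [affComp]
  rw [h, eulerPoly_C, one_mul]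

/-- Apply q(E) to the identity 1 = φ(x) + ψ(1/x). On constants q(E) is q(0), and under inversion it
becomes q(-E). -/
theorem eulerPoly_partition (q : ℂ[X]) {φ ψ : TestFun} (h : ∀ x : ℝ, x ≠ 0 → φ x + ψ x⁻¹ = 1)
    {x : ℝ} (hx : x ≠ 0) :
    eulerPoly q φ x + eulerPoly (affComp q (-1) 0) ψ x⁻¹ = q.eval 0 := by
  have h1 := eulerPoly_mul_comp (U := {0}ᶜ) isOpen_compl_singleton
    (w := fun _ : ℝ => 1) (m := fun y => y⁻¹)
    (a := -1) (b := 0) (fun x hx => ⟨0, hasDerivAt_const x 1, by simp⟩)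
    (fun x hx => hasDerivAt_inv_euler hx) q (F := fun y => 1 - φ y) ψ.contDiff
    (fun x hx => by rw [one_mul]; exact sub_eq_iff_eq_add'.2 (h x hx).symm) x hx
  have h2 := eulerPoly_fun_sub q (f := fun _ => 1) (g := φ) contDiff_const φ.contDiff x
  rw [eulerPoly_fun_const, mul_one] at h2
  rw [one_mul] at h1
  push_cast at h1
  rw [← h1, h2]
  ring

/-- The value at `s` of the signed Mellin transform of `∑ p_j(x d/dx)^* v_j`. -/
def mellinSum {ι : Type} [Fintype ι] (v : ι → ℝ → ℂ) (p : ι → ℂ[X]) (δ : ZMod 2) (s : ℂ) : ℂ :=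
  ∑ j, (p j).eval (s - 1) * ∫ x, v j x * signedPower δ (s - 1) x

/-- The cutoff function `φ(x / (n + 1)) - φ((n + 1) x)`. -/
def annulus (φ : TestFun) (n : ℕ) : TestFun :=
  dilateTest ((n : ℝ) + 1)⁻¹ (by positivity) φ - dilateTest ((n : ℝ) + 1) (by positivity) φ

theorem annulus_apply (φ : TestFun) (n : ℕ) (x : ℝ) :
    annulus φ n x = φ (((n : ℝ) + 1)⁻¹ * x) - φ (((n : ℝ) + 1) * x) := rfl

theorem zero_notMem_tsupport_annulus {φ : TestFun} (hφ : ∀ x, |x| ≤ 1 → φ x = 1) (n : ℕ) :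
    (0 : ℝ) ∉ tsupport (annulus φ n) := by
  have h1 : (1 : ℝ) ≤ (n : ℝ) + 1 := by linarith [(Nat.cast_nonneg n : (0 : ℝ) ≤ n)]
  have h0 : (0 : ℝ) < (n : ℝ) + 1 := by positivity
  refine notMem_tsupport_of_eqOn_zero (inv_pos.2 h0) fun x hx => ?_
  rw [annulus_apply, hφ, hφ, sub_self]
  · rw [abs_mul, abs_of_pos h0]
    calc ((n : ℝ) + 1) * |x| ≤ ((n : ℝ) + 1) * ((n : ℝ) + 1)⁻¹ := by gcongr
      _ = 1 := mul_inv_cancel₀ h0.ne'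
  · rw [abs_mul, abs_of_pos (inv_pos.2 h0)]
    calc ((n : ℝ) + 1)⁻¹ * |x| ≤ 1 * 1 := by
          have := inv_le_one_of_one_le₀ h1
          gcongr
          exact hx.le.trans this
      _ = 1 := one_mul 1

theorem eulerPoly_annulus (q : ℂ[X]) (φ : TestFun) (n : ℕ) (x : ℝ) : eulerPoly q (annulus φ n) x =
    eulerPoly q φ (((n : ℝ) + 1)⁻¹ * x) - eulerPoly q φ (((n : ℝ) + 1) * x) := by
  rw [← eulerPoly_comp_mul_left q φ.contDiff, ← eulerPoly_comp_mul_left q φ.contDiff]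
  exact eulerPoly_fun_sub q (φ.contDiff.comp (contDiff_const.mul contDiff_id))
    (φ.contDiff.comp (contDiff_const.mul contDiff_id)) x

theorem tendsto_eulerPoly_annulus (q : ℂ[X]) {φ : TestFun} (hφ : ∀ x, |x| ≤ 1 → φ x = 1) {x : ℝ}
    (hx : x ≠ 0) : Tendsto (fun n => eulerPoly q (annulus φ n) x) atTop (𝓝 (q.eval 0)) := by
  have hc := continuous_eulerPoly q φ.contDiff
  have h0 : eulerPoly q φ 0 = q.eval 0 := by
    rw [eulerPoly_congr_of_isOpen (U := Metric.ball 0 1) Metric.isOpen_ball q (f := φ)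
      (g := fun _ => 1) (fun y hy => hφ y (by simpa using (Metric.mem_ball.1 hy).le)) 0 (by simp),
      eulerPoly_fun_const, mul_one]
  have hn : Tendsto (fun n : ℕ => (n : ℝ) + 1) atTop atTop :=
    tendsto_atTop_add_const_right _ _ tendsto_natCast_atTop_atTop
  have t1 : Tendsto (fun n : ℕ => eulerPoly q φ (((n : ℝ) + 1)⁻¹ * x)) atTop (𝓝 (q.eval 0)) := by
    rw [← h0]
    refine (hc.tendsto 0).comp ?_
    have := (tendsto_inv_atTop_zero.comp hn).mul_const x
    simpa using this
  have t2 : Tendsto (fun n : ℕ => eulerPoly q φ (((n : ℝ) + 1) * x)) atTop (𝓝 0) := by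
    obtain ⟨R, hR, h⟩ := (hasCompactSupport_eulerPoly q φ.hasCompactSupport).exists_pos_le_norm
    refine tendsto_const_nhds.congr' ?_
    filter_upwards [(hn.atTop_mul_const (abs_pos.2 hx)).eventually_ge_atTop R] with n hRn
    rw [h]
    rw [Real.norm_eq_abs, abs_mul, abs_of_nonneg (by positivity : (0 : ℝ) ≤ (n : ℝ) + 1)]
    exact hRn
  simpa only [eulerPoly_annulus, sub_zero] using t1.sub t2

section MellinSum

variable {ι : Type} [Fintype ι] {v : ι → ℝ → ℂ} {p : ι → ℂ[X]} {k₀ k₁ : ℤ} {S T : Distr}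

theorem apply_mulOff_signedPower
    (hS : ∀ f ∈ OffZero, S f = ∑ j, ∫ x, v j x * eulerPoly (p j) f x) (δ : ZMod 2) (α : ℂ)
    (f : TestFun) (hf : (0 : ℝ) ∉ tsupport f) : S (mulOff _ (contDiffOn_signedPower δ α) f hf) =
      ∑ j, ∫ x, v j x * signedPower δ α x * eulerPoly (affComp (p j) 1 α) f x := by
  rw [hS _ fun h => hf (tsupport_mulOff_subset _ _ _ _ h)]
  refine Finset.sum_congr rfl fun j _ => integral_congr_ae (ae_ne_zero.mono fun x hx => ?_)
  simp only
  rw [eulerPoly_mulOff (p j) _ (fun x hx => hasDerivAt_signedPower_right δ α hx) f hf hx, mul_assoc]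

/-- As the annuli exhaust ℝ \ {0}, p(E + s - 1) applied to the cutoff tends to p(s - 1). It stays
bounded because E commutes with dilations, and dominated convergence applies. -/
theorem tendsto_mellinSum (hv : ∀ j, PowerBounded k₀ k₁ (v j))
    (hS : ∀ f ∈ OffZero, S f = ∑ j, ∫ x, v j x * eulerPoly (p j) f x) (δ : ZMod 2) {s : ℂ}
    (h₀ : -(k₀ : ℝ) < s.re) (h₁ : s.re < k₁) {φ : TestFun} (hφ : ∀ x, |x| ≤ 1 → φ x = 1) :
    Tendsto (fun n => S (mulOff _ (contDiffOn_signedPower δ (s - 1)) (annulus φ n)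
      (zero_notMem_tsupport_annulus hφ n))) atTop (𝓝 (mellinSum v p δ s)) := by
  simp only [apply_mulOff_signedPower hS, mellinSum]
  refine tendsto_finsetSum _ fun j _ => ?_
  set q := affComp (p j) 1 (s - 1) with hq
  have hI : Integrable fun x => v j x * signedPower δ (s - 1) x :=
    (hv j).integrable_mul_signedPower δ (by simp; linarith) (by simp; linarith)
  obtain ⟨M, hM⟩ := (hasCompactSupport_eulerPoly q φ.hasCompactSupport).exists_bound_of_continuous
    (continuous_eulerPoly q φ.contDiff)
  have e : (p j).eval (s - 1) * ∫ x, v j x * signedPower δ (s - 1) x =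
      ∫ x, v j x * signedPower δ (s - 1) x * q.eval 0 := by
    rw [integral_mul_const, hq, eval_affComp, mul_zero, zero_add, mul_comm]
  rw [e]
  refine tendsto_integral_of_dominated_convergence
    (fun x => ‖v j x * signedPower δ (s - 1) x‖ * (M + M)) (fun n => ?_) (hI.norm.mul_const _)
    (fun n => Eventually.of_forall fun x => ?_) ?_
  · exact hI.1.mul (continuous_eulerPoly q (annulus φ n).contDiff).aestronglyMeasurable
  · rw [norm_mul, eulerPoly_annulus]
    exact mul_le_mul_of_nonneg_left ((norm_sub_le _ _).trans (add_le_add (hM _) (hM _)))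
      (norm_nonneg _)
  · filter_upwards [ae_ne_zero] with x hx
    exact (tendsto_eulerPoly_annulus q hφ hx).const_mul _

theorem apply_of_isExtensionAcrossInfinity
    (hS : ∀ f ∈ OffZero, S f = ∑ j, ∫ x, v j x * eulerPoly (p j) f x)
    (hT : IsExtensionAcrossInfinity S T) : ∀ f ∈ OffZero,
      T f = ∑ j, ∫ x, v j x⁻¹ * eulerPoly (affComp (p j) (-1) (-2)) f x := by
  intro f hf
  have hf : (0 : ℝ) ∉ tsupport f := hf
  rw [hT f (invTest f hf) hf fun x => rfl, hS _ (zero_notMem_tsupport_invTest f hf)]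
  exact Finset.sum_congr rfl fun j _ => integral_mul_eulerPoly_invTest _ _ f hf

/-- This explains the exponent -s - 1 in the coordinate 1/x: with the Jacobian it becomes s - 1 in
the coordinate x. -/
theorem sq_inv_mul_signedPower (δ : ZMod 2) (s : ℂ) {x : ℝ} (hx : x ≠ 0) :
    ((x : ℂ) ^ 2)⁻¹ * signedPower δ (-s - 1) x⁻¹ = signedPower δ (s - 1) x := by
  have hx' : (x : ℂ) ≠ 0 := Complex.ofReal_ne_zero.2 hx
  have e : -(-s - 1) = s - 1 + (2 : ℕ) := by push_cast; ring
  rw [signedPower_inv, e, signedPower_add δ _ _ hx, Complex.cpow_natCast]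
  have : ((|x| : ℝ) : ℂ) ^ 2 = (x : ℂ) ^ 2 := by
    rw [← Complex.ofReal_pow, sq_abs, Complex.ofReal_pow]
  rw [this]
  field_simp

/-- By uniqueness the extensions at 0 and at ∞ are the explicit ones. After inversion of the second
integral, the two are joined by the partition of unity, which replaces p(E + s - 1) by the number
p(s - 1). -/
theorem mellin_eq_mellinSum (hv : ∀ j, PowerBounded k₀ k₁ (v j))
    (hS : ∀ f ∈ OffZero, S f = ∑ j, ∫ x, v j x * eulerPoly (p j) f x)
    (hT : IsExtensionAcrossInfinity S T) {δ : ZMod 2} {s : ℂ}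
    (h₀ : -(k₀ : ℝ) < s.re) (h₁ : s.re < k₁) {E₀ E₁ : ℂ → Distr}
    (hE₀ : IsPowerExtension δ S k₀ E₀) (hE₁ : IsPowerExtension δ T k₁ E₁) {φ ψ : TestFun}
    (hφψ : ∀ x : ℝ, x ≠ 0 → φ x + ψ x⁻¹ = 1) :
    E₀ (s - 1) φ + E₁ (-s - 1) ψ = mellinSum v p δ s := by
  have hα₀ : -(k₀ : ℝ) - 1 < (s - 1).re := by simp; linarith
  have hα₁ : -(k₁ : ℝ) - 1 < (-s - 1).re := by simp; linarith
  have hv' : ∀ j, PowerBounded k₁ k₀ fun x => v j x⁻¹ := fun j => (hv j).comp_inv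
  have hT' := apply_of_isExtensionAcrossInfinity hS hT
  rw [hE₀.eq (isPowerExtension_powerExt hv hS δ) hα₀,
    hE₁.eq (isPowerExtension_powerExt hv' hT' δ) hα₁, powerExt_apply hv δ hα₀,
    powerExt_apply hv' δ hα₁, ← Finset.sum_add_distrib, mellinSum]
  refine Finset.sum_congr rfl fun j _ => ?_
  set q := affComp (p j) 1 (s - 1) with hq
  -- The shifts by -2 from the Jacobian and by -s - 1 from the power combine to p(s - 1 - X), which
  -- is q(-X).
  have hq' : affComp (affComp (p j) (-1) (-2)) 1 (-s - 1) = affComp q (-1) 0 := by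
    rw [hq, affComp_affComp, affComp_affComp]
    congr 1 <;> ring
  rw [hq']
  have e1 : ∫ x, v j x⁻¹ * signedPower δ (-s - 1) x * eulerPoly (affComp q (-1) 0) ψ x =
      ∫ x, v j x * signedPower δ (s - 1) x * eulerPoly (affComp q (-1) 0) ψ x⁻¹ := by
    rw [← integral_comp_inv_mul]
    refine integral_congr_ae (ae_ne_zero.mono fun x hx => ?_)
    simp only
    rw [inv_inv, ← sq_inv_mul_signedPower δ s hx]
    ring
  have hI : Integrable fun x => v j x * signedPower δ (s - 1) x :=
    (hv j).integrable_mul_signedPower δ (by simp; linarith) (by simp; linarith)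
  have hb : ∀ (q : ℂ[X]) (f : TestFun) (g : ℝ → ℝ), Measurable g → Integrable fun x =>
      v j x * signedPower δ (s - 1) x * eulerPoly q f (g x) := fun q f g hg => by
    obtain ⟨M, hM⟩ := (hasCompactSupport_eulerPoly q f.hasCompactSupport).exists_bound_of_continuous
      (continuous_eulerPoly q f.contDiff)
    exact hI.mul_bdd (c := M) ((continuous_eulerPoly q f.contDiff).measurable.comp hg).aestronglyMeasurable
      (Eventually.of_forall fun x => hM _)
  have hb₁ : Integrable fun x => v j x * signedPower δ (s - 1) x * eulerPoly q φ x :=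
    hb q φ id measurable_id
  rw [e1, ← integral_add hb₁ (hb _ ψ _ measurable_inv)]
  have e2 : (p j).eval (s - 1) = q.eval 0 := by rw [hq, eval_affComp, mul_zero, zero_add]
  rw [e2, ← integral_const_mul]
  refine integral_congr_ae (ae_ne_zero.mono fun x hx => ?_)
  simp only
  rw [← eulerPoly_partition q hφψ hx]
  ring

end MellinSum

theorem hasSignedMellin_mellinSum {σ : 𝓢'(ℝ, ℂ)} {T : Distr} {k₀ k₁ : ℤ}
    (h₀ : VanishesToOrder (toDistr σ) k₀) (hT : IsExtensionAcrossInfinity (toDistr σ) T)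
    (h₁ : VanishesToOrder T k₁) (δ : ZMod 2) {s : ℂ} (hs₀ : -(k₀ : ℝ) < s.re) (hs₁ : s.re < k₁)
    {ι : Type} [Fintype ι] {v : ι → ℝ → ℂ} {p : ι → ℂ[X]} (hv : ∀ j, PowerBounded k₀ k₁ (v j))
    (hS : ∀ f ∈ OffZero, toDistr σ f = ∑ j, ∫ x, v j x * eulerPoly (p j) f x) :
    HasSignedMellin δ (toDistr σ) s (mellinSum v p δ s) := by
  obtain ⟨φ, ψ, hφψ, -⟩ := exists_partition one_pos
  have hE₀ := isPowerExtension_powerExt hv hS δ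
  have hE₁ := isPowerExtension_powerExt (fun j => (hv j).comp_inv)
    (apply_of_isExtensionAcrossInfinity hS hT) δ
  exact ⟨k₀, k₁, T, _, _, φ, ψ, hs₀, hs₁, h₀, hT, h₁, hE₀, hE₁, hφψ,
    (mellin_eq_mellinSum hv hS hT hs₀ hs₁ hE₀ hE₁ hφψ).symm⟩

/-- The sequence involves neither the orders, nor the extension across ∞, nor the partition of
unity. Uniqueness of limits thus makes the Mellin value independent of all these choices. -/
theorem HasSignedMellin.tendsto {σ : 𝓢'(ℝ, ℂ)} {δ : ZMod 2} {s z : ℂ}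
    (h : HasSignedMellin δ (toDistr σ) s z) {φ : TestFun} (hφ : ∀ x, |x| ≤ 1 → φ x = 1) :
    Tendsto (fun n => toDistr σ (mulOff _ (contDiffOn_signedPower δ (s - 1)) (annulus φ n)
      (zero_notMem_tsupport_annulus hφ n))) atTop (𝓝 z) := by
  obtain ⟨k₀, k₁, T, E₀, E₁, φ', ψ, hs₀, hs₁, h₀, hT, h₁, hE₀, hE₁, hφψ, rfl⟩ := h
  obtain ⟨ι, hι, v, p, hv, hS⟩ := isEulerSum_of_vanishesToOrder σ h₀ hT h₁
  rw [mellin_eq_mellinSum hv hS hT hs₀ hs₁ hE₀ hE₁ hφψ]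
  exact tendsto_mellinSum hv hS δ hs₀ hs₁ hφ

theorem HasSignedMellin.unique {σ : 𝓢'(ℝ, ℂ)} {δ : ZMod 2} {s z z' : ℂ}
    (h : HasSignedMellin δ (toDistr σ) s z) (h' : HasSignedMellin δ (toDistr σ) s z') : z = z' := by
  obtain ⟨φ, hφ, -⟩ := exists_cutoff one_pos
  exact tendsto_nhds_unique (h.tendsto hφ) (h'.tendsto hφ)

theorem HasSignedMellin.mellinDefinedAt {σ : 𝓢'(ℝ, ℂ)} {δ : ZMod 2} {s z : ℂ}
    (h : HasSignedMellin δ (toDistr σ) s z) : MellinDefinedAt δ (toDistr σ) s :=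
  ⟨z, h, fun _ h' => h'.unique h⟩

theorem HasSignedMellin.signedMellin_eq {σ : 𝓢'(ℝ, ℂ)} {δ : ZMod 2} {s z : ℂ}
    (h : HasSignedMellin δ (toDistr σ) s z) : signedMellin δ (toDistr σ) s = z :=
  (Classical.epsilon_spec (p := fun z => HasSignedMellin δ (toDistr σ) s z) ⟨z, h⟩).unique h

theorem mellinDefinedAt_of_vanishesToOrder {σ : 𝓢'(ℝ, ℂ)} {T : Distr} {k₀ k₁ : ℤ}
    (h₀ : VanishesToOrder (toDistr σ) k₀) (hT : IsExtensionAcrossInfinity (toDistr σ) T)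
    (h₁ : VanishesToOrder T k₁) (δ : ZMod 2) {s : ℂ} (hs₀ : -(k₀ : ℝ) < s.re) (hs₁ : s.re < k₁) :
    MellinDefinedAt δ (toDistr σ) s := by
  obtain ⟨ι, hι, v, p, hv, hS⟩ := isEulerSum_of_vanishesToOrder σ h₀ hT h₁
  exact (hasSignedMellin_mellinSum h₀ hT h₁ δ hs₀ hs₁ hv hS).mellinDefinedAt

theorem differentiableAt_mellinSum {ι : Type} [Fintype ι] {v : ι → ℝ → ℂ} {p : ι → ℂ[X]}
    {k₀ k₁ : ℤ} (hv : ∀ j, PowerBounded k₀ k₁ (v j)) (δ : ZMod 2) {s : ℂ}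
    (hs₀ : -(k₀ : ℝ) < s.re) (hs₁ : s.re < k₁) : DifferentiableAt ℂ (mellinSum v p δ) s := by
  change DifferentiableAt ℂ (fun s => ∑ j, (p j).eval (s - 1) *
    (fun α => ∫ x, v j x * signedPower δ α x) (s - 1)) s
  refine DifferentiableAt.fun_sum fun j _ => DifferentiableAt.mul ?_ ?_
  · exact (Polynomial.differentiable _).differentiableAt.comp s (f := fun s : ℂ => s - 1) (differentiableAt_id.sub_const 1)
  · exact (differentiableAt_integral_mul_signedPower δ (hv j).1.aestronglyMeasurable
      (a := -(k₀ : ℝ) - 1) (b := k₁ - 1) (fun c h1 h2 => (hv j).integrable_norm_mul_rpow h1 h2)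
      (α := s - 1) (by simp; linarith) (by simp; linarith)).comp s (f := fun s : ℂ => s - 1) (differentiableAt_id.sub_const 1)

/-! ### Integrals of Euler operators -/

theorem eulerPoly_apply_zero (p : ℂ[X]) (f : ℝ → ℂ) : eulerPoly p f 0 = p.eval 0 * f 0 := by
  have h : ∀ n : ℕ, n ≠ 0 → (eulerOp^[n] f) 0 = 0 := fun n hn => by
    obtain ⟨m, rfl⟩ := Nat.exists_eq_succ_of_ne_zero hn
    rw [Function.iterate_succ_apply', eulerOp, Complex.ofReal_zero, zero_mul]
  rw [eulerPoly_eq_sum_range p (Nat.lt_succ_self _), Finset.sum_eq_single 0]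
  · rw [Polynomial.coeff_zero_eq_eval_zero]
    rfl
  · intro i _ hi
    rw [h i hi, mul_zero]
  · simp

/-- The integral is the value of the Fourier transform at 0, where E acts as 0, while E corresponds
to -E - 1 on the other side. This encodes integration by parts. -/
theorem integral_eulerPoly (p : ℂ[X]) (f : 𝓢(ℝ, ℂ)) :
    ∫ x, eulerPoly p f x = p.eval (-1) * ∫ x, f x := by
  have hz : ∀ g : 𝓢(ℝ, ℂ), (𝓕 g : 𝓢(ℝ, ℂ)) 0 = ∫ x, g x := fun g => by
    rw [SchwartzMap.fourier_coe, Real.fourier_eq']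
    simp
  have h := congrFun (eulerPoly_fourier (affComp p (-1) (-1)) f) 0
  have e : affComp (affComp p (-1) (-1)) (-1) (-1) = p := by
    rw [affComp_affComp]
    convert affComp_one_zero p using 2 <;> ring
  rw [eulerPoly_apply_zero, hz, e, hz, coe_eulerPolySchwartz, eval_affComp] at h
  simpa using h.symm

/-- Absorb the power into the function: |x|^α p(E) f = p(E - α)(|x|^α f). Then integrate. -/
theorem integral_eulerPoly_mul_signedPower (p : ℂ[X]) (f : TestFun) (hf : (0 : ℝ) ∉ tsupport f)
    (δ : ZMod 2) (α : ℂ) : ∫ x, eulerPoly p f x * signedPower δ α x =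
      p.eval (-α - 1) * ∫ x, f x * signedPower δ α x := by
  set F := mulOff _ (contDiffOn_signedPower δ α) f hf
  have h := integral_eulerPoly (affComp p 1 (-α)) (testToSchwartz F)
  have e : affComp (affComp p 1 (-α)) 1 α = p := by
    rw [affComp_affComp]
    convert affComp_one_zero p using 2 <;> ring
  have h1 : ∫ x, eulerPoly (affComp p 1 (-α)) (testToSchwartz F) x =
      ∫ x, eulerPoly p f x * signedPower δ α x := by
    refine integral_congr_ae (ae_ne_zero.mono fun x hx => ?_)
    have := eulerPoly_mulOff (affComp p 1 (-α)) (contDiffOn_signedPower δ α)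
      (fun x hx => hasDerivAt_signedPower_right δ α hx) f hf hx
    rw [e] at this
    simp only
    rw [mul_comm, ← this]
    rfl
  rw [h1, eval_affComp] at h
  rw [h]
  congr 2
  ring

/-! ### The Fourier transform of a signed power -/

theorem integrableOn_rpow_mul_exp {c b : ℝ} (hc : -1 < c) (hb : 0 < b) :
    IntegrableOn (fun t : ℝ => t ^ c * Real.exp (-(b * t))) (Set.Ioi 0) := by
  have := integrableOn_rpow_mul_exp_neg_mul_rpow hc one_pos hb
  simpa only [Real.rpow_one, neg_mul] using this

theorem norm_cpow_mul_cexp {a r : ℂ} {t : ℝ} (ht : 0 < t) :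
    ‖(t : ℂ) ^ a * Complex.exp (-(r * t))‖ = t ^ a.re * Real.exp (-(r.re * t)) := by
  rw [norm_mul, Complex.norm_cpow_eq_rpow_re_of_pos ht, Complex.norm_exp]
  simp

theorem measurable_cpow_mul_cexp (a r : ℂ) :
    Measurable fun t : ℝ => (t : ℂ) ^ a * Complex.exp (-(r * t)) := by
  fun_prop

theorem integrableOn_cpow_mul_cexp {a r : ℂ} (ha : -1 < a.re) (hr : 0 < r.re) :
    IntegrableOn (fun t : ℝ => (t : ℂ) ^ a * Complex.exp (-(r * t))) (Set.Ioi 0) := by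
  refine (integrableOn_rpow_mul_exp ha hr).mono' (measurable_cpow_mul_cexp a r).aestronglyMeasurable
    ((ae_restrict_iff' measurableSet_Ioi).2 (Eventually.of_forall fun t ht => ?_))
  rw [norm_cpow_mul_cexp ht]

theorem differentiableAt_integral_cpow_mul_cexp {a r : ℂ} (ha : -1 < a.re) (hr : 0 < r.re) :
    DifferentiableAt ℂ
      (fun r : ℂ => ∫ t in Set.Ioi (0 : ℝ), (t : ℂ) ^ a * Complex.exp (-(r * t))) r := by
  have hs : {z : ℂ | r.re / 2 < z.re} ∈ 𝓝 r :=
    (isOpen_lt continuous_const Complex.continuous_re).mem_nhds (by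
      simp only [Set.mem_ofPred_eq]
      linarith)
  refine (hasDerivAt_integral_of_dominated_loc_of_deriv_le (μ := volume.restrict (Set.Ioi 0))
    (F := fun (r : ℂ) (t : ℝ) => (t : ℂ) ^ a * Complex.exp (-(r * t)))
    (F' := fun (r : ℂ) (t : ℝ) => -((t : ℂ) ^ (a + 1) * Complex.exp (-(r * t))))
    (bound := fun t : ℝ => t ^ (a.re + 1) * Real.exp (-(r.re / 2 * t))) hs
    (Eventually.of_forall fun r => (measurable_cpow_mul_cexp a r).aestronglyMeasurable)
    (integrableOn_cpow_mul_cexp ha hr)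
    (measurable_cpow_mul_cexp (a + 1) r).neg.aestronglyMeasurable ?_
    (integrableOn_rpow_mul_exp (by linarith) (by linarith)) ?_).2.differentiableAt
  · refine (ae_restrict_iff' measurableSet_Ioi).2 (Eventually.of_forall fun t ht z hz => ?_)
    have ht : 0 < t := ht
    have hz : r.re / 2 < z.re := hz
    rw [norm_neg, norm_cpow_mul_cexp ht, Complex.add_re, Complex.one_re]
    gcongr
  · refine (ae_restrict_iff' measurableSet_Ioi).2 (Eventually.of_forall fun t ht z hz => ?_)
    have ht' : (t : ℂ) ≠ 0 := Complex.ofReal_ne_zero.2 (ne_of_gt ht)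
    have h := (((hasDerivAt_id z).mul_const (t : ℂ)).neg.cexp.const_mul ((t : ℂ) ^ a))
    refine h.congr_deriv ?_
    rw [Complex.cpow_add _ _ ht', Complex.cpow_one]
    simp
    ring

/-- Both sides are analytic in r on the right half plane and agree at the real points 1 + 1/(n+1),
which accumulate at 1. -/
theorem integral_cpow_mul_cexp {a r : ℂ} (ha : 0 < a.re) (hr : 0 < r.re) :
    ∫ t in Set.Ioi (0 : ℝ), (t : ℂ) ^ (a - 1) * Complex.exp (-(r * t)) =
      (1 / r) ^ a * Complex.Gamma a := by
  have hopen : IsOpen {r : ℂ | 0 < r.re} := isOpen_lt continuous_const Complex.continuous_re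
  have h1 : DifferentiableOn ℂ (fun r : ℂ => ∫ t in Set.Ioi (0 : ℝ), (t : ℂ) ^ (a - 1) *
      Complex.exp (-(r * t))) {r : ℂ | 0 < r.re} := fun r hr =>
    (differentiableAt_integral_cpow_mul_cexp (by simpa using ha) hr).differentiableWithinAt
  have h2 : DifferentiableOn ℂ (fun r : ℂ => (1 / r) ^ a * Complex.Gamma a) {r : ℂ | 0 < r.re} := by
    intro r hr
    have hr : 0 < r.re := hr
    have hr0 : r ≠ 0 := fun h => by simp [h] at hr
    refine (DifferentiableAt.mul_const (DifferentiableAt.cpow_const ?_ ?_) _).differentiableWithinAt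
    · exact (differentiableAt_const _).div differentiableAt_id hr0
    · left
      rw [one_div, Complex.inv_re]
      exact div_pos hr (Complex.normSq_pos.2 hr0)
  have hlim : Tendsto (fun n : ℕ => ((1 + 1 / ((n : ℝ) + 1) : ℝ) : ℂ)) atTop (𝓝[≠] 1) := by
    refine tendsto_nhdsWithin_iff.2 ⟨?_, Eventually.of_forall fun n => ?_⟩
    · have := (tendsto_one_div_add_atTop_nhds_zero_nat (𝕜 := ℝ)).const_add 1
      rw [add_zero] at this
      exact (Complex.continuous_ofReal.tendsto 1).comp this
    · have : (0 : ℝ) < 1 / ((n : ℝ) + 1) := by positivity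
      rw [Set.mem_compl_iff, Set.mem_singleton_iff, ← Complex.ofReal_one, Complex.ofReal_inj]
      linarith
  refine (h1.analyticOnNhd hopen).eqOn_of_preconnected_of_frequently_eq (h2.analyticOnNhd hopen)
    (convex_halfSpace_re_gt 0).isPreconnected (z₀ := 1) (by simp) ?_ hr
  refine hlim.frequently (Frequently.of_forall fun n => ?_)
  exact Complex.integral_cpow_mul_exp_neg_mul_Ioi ha (by positivity)

theorem signedPower_of_pos (δ : ZMod 2) (α : ℂ) {x : ℝ} (hx : 0 < x) :
    signedPower δ α x = (x : ℂ) ^ α := by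
  rw [signedPower, Real.sign_of_pos hx, abs_of_pos hx]
  simp

theorem signedPower_neg (δ : ZMod 2) (α : ℂ) (x : ℝ) :
    signedPower δ α (-x) = (-1 : ℂ) ^ δ.val * signedPower δ α x := by
  rw [signedPower, signedPower, Real.sign_neg, abs_neg, Complex.ofReal_neg, neg_pow, mul_assoc]

/-- The exponential `exp (-ε |x|)` as a complex valued function. -/
def expDamp (ε x : ℝ) : ℂ := ((Real.exp (-(ε * |x|)) : ℝ) : ℂ)

theorem measurable_expDamp (ε : ℝ) : Measurable (expDamp ε) := by
  unfold expDamp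
  fun_prop

theorem norm_expDamp_le {ε : ℝ} (hε : 0 ≤ ε) (x : ℝ) : ‖expDamp ε x‖ ≤ 1 := by
  rw [expDamp, Complex.norm_real, Real.norm_of_nonneg (Real.exp_pos _).le, Real.exp_le_one_iff]
  have := mul_nonneg hε (abs_nonneg x)
  linarith

theorem integral_eq_integral_Ioi_add {F : ℝ → ℂ} (h₁ : IntegrableOn F (Set.Ioi 0))
    (h₂ : IntegrableOn (fun x => F (-x)) (Set.Ioi 0)) : Integrable F ∧
    ∫ x, F x = (∫ x in Set.Ioi 0, F x) + ∫ x in Set.Ioi 0, F (-x) := by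
  have h3 : IntegrableOn F (Set.Iic 0) := by
    have := (integrableOn_Ici_iff_integrableOn_Ioi (by simp)).2 h₂
    have h4 := this.comp_neg
    simpa using h4
  refine ⟨?_, ?_⟩
  · rw [← integrableOn_univ, ← Set.Iic_union_Ioi (a := (0 : ℝ))]
    exact h3.union h₁
  · rw [integral_comp_neg_Ioi, neg_zero, add_comm, intervalIntegral.integral_Iic_add_Ioi h3 h₁]

/-- Split the integral at 0. Each half is a gamma integral with parameter ε ± 2πiy, and the parity
of the signed power supplies (-1)^δ on the negative half. -/
theorem fourier_signedPower_mul_expDamp (δ : ZMod 2) {s : ℂ} (hs : 0 < s.re) {ε : ℝ} (hε : 0 < ε)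
    (y : ℝ) : Integrable (fun x => signedPower δ (s - 1) x * expDamp ε x) ∧
    𝓕 (fun x => signedPower δ (s - 1) x * expDamp ε x) y =
      Complex.Gamma s * ((1 / (ε + 2 * Real.pi * y * Complex.I)) ^ s +
        (-1) ^ δ.val * (1 / (ε - 2 * Real.pi * y * Complex.I)) ^ s) := by
  have hs' : -1 < (s - 1).re := by simpa using hs
  have re1 : ∀ c : ℝ, (ε + c * Complex.I : ℂ).re = ε := fun c => by simp
  have key : ∀ y : ℝ, Integrable (fun x : ℝ => Complex.exp (↑(-2 * Real.pi * (x * y)) * Complex.I) *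
      (signedPower δ (s - 1) x * expDamp ε x)) ∧ ∫ x : ℝ,
      Complex.exp (↑(-2 * Real.pi * (x * y)) * Complex.I) * (signedPower δ (s - 1) x * expDamp ε x) =
      Complex.Gamma s * ((1 / (ε + 2 * Real.pi * y * Complex.I)) ^ s +
        (-1) ^ δ.val * (1 / (ε - 2 * Real.pi * y * Complex.I)) ^ s) := by
    intro y
    have r1 : (ε + 2 * Real.pi * y * Complex.I : ℂ).re = ε := by
      simp
    have r2 : (ε - 2 * Real.pi * y * Complex.I : ℂ).re = ε := by
      simp
    have e1 : ∀ x ∈ Set.Ioi (0 : ℝ), (x : ℂ) ^ (s - 1) *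
        Complex.exp (-((ε + 2 * Real.pi * y * Complex.I) * x)) =
        Complex.exp (↑(-2 * Real.pi * (x * y)) * Complex.I) *
          (signedPower δ (s - 1) x * expDamp ε x) := fun x hx => by
      have hx : 0 < x := hx
      rw [signedPower_of_pos δ _ hx, expDamp, abs_of_pos hx, mul_left_comm, Complex.ofReal_exp,
        ← Complex.exp_add]
      congr 2
      push_cast
      ring
    have e2 : ∀ x ∈ Set.Ioi (0 : ℝ), (-1 : ℂ) ^ δ.val * ((x : ℂ) ^ (s - 1) *
        Complex.exp (-((ε - 2 * Real.pi * y * Complex.I) * x))) =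
        Complex.exp (↑(-2 * Real.pi * (-x * y)) * Complex.I) *
          (signedPower δ (s - 1) (-x) * expDamp ε (-x)) := fun x hx => by
      have hx : 0 < x := hx
      have e : Complex.exp (-((ε - 2 * Real.pi * y * Complex.I) * x)) =
          Complex.exp (↑(-2 * Real.pi * (-x * y)) * Complex.I) * ↑(Real.exp (-(ε * x))) := by
        rw [Complex.ofReal_exp, ← Complex.exp_add]
        congr 1
        push_cast
        ring
      rw [signedPower_neg, signedPower_of_pos δ _ hx, expDamp, abs_neg, abs_of_pos hx, e]
      ring
    have i1 := integrableOn_cpow_mul_cexp hs' (r1.symm ▸ hε)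
    have i2 := (integrableOn_cpow_mul_cexp hs' (r2.symm ▸ hε)).const_mul ((-1 : ℂ) ^ δ.val)
    have h := integral_eq_integral_Ioi_add (i1.congr_fun e1 measurableSet_Ioi)
      (IntegrableOn.congr_fun (f := fun x : ℝ => (-1 : ℂ) ^ δ.val * ((x : ℂ) ^ (s - 1) *
        Complex.exp (-((ε - 2 * Real.pi * y * Complex.I) * x)))) i2 e2 measurableSet_Ioi)
    refine ⟨h.1, h.2.trans ?_⟩
    rw [← setIntegral_congr_fun measurableSet_Ioi e1, ← setIntegral_congr_fun measurableSet_Ioi e2,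
      integral_const_mul, integral_cpow_mul_cexp hs (r1.symm ▸ hε),
      integral_cpow_mul_cexp hs (r2.symm ▸ hε)]
    ring
  refine ⟨by simpa using (key 0).1, ?_⟩
  rw [Real.fourier_eq', ← (key y).2]
  congr 1
  funext x
  simp only [smul_eq_mul, RCLike.inner_apply, conj_trivial]
  rw [mul_comm y x]

theorem one_div_cpow_limit (s : ℂ) {y : ℝ} (hy : 0 < y) (u : ℂ) (hu : u = Complex.I ∨ u = -Complex.I) :
    (1 / (2 * Real.pi * y * u)) ^ s =
      (2 * Real.pi : ℂ) ^ (-s) * (y : ℂ) ^ (-s) * (-u) ^ s := by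
  have hpi := Real.pi_pos
  have hu' : u⁻¹ = -u := by rcases hu with rfl | rfl <;> simp
  have e : (1 / (2 * Real.pi * y * u) : ℂ) = (((2 * Real.pi * y)⁻¹ : ℝ) : ℂ) * -u := by
    rw [one_div, mul_inv, hu']
    push_cast
    ring
  have h1 : (((2 * Real.pi * y)⁻¹ : ℝ) : ℂ) ^ s = (2 * Real.pi : ℂ) ^ (-s) * (y : ℂ) ^ (-s) := by
    rw [Complex.ofReal_inv, Complex.inv_cpow _ _ (by
      rw [Complex.arg_ofReal_of_nonneg (by positivity)]
      exact Real.pi_pos.ne), ← Complex.cpow_neg, Complex.ofReal_mul (2 * Real.pi) y,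
      Complex.mul_cpow_ofReal_nonneg (by positivity) hy.le]
    push_cast
    rfl
  have hu0 : -u ≠ 0 := by rcases hu with rfl | rfl <;> simp
  rw [e, ← h1]
  have hpos : (0 : ℝ) < (2 * Real.pi * y)⁻¹ := by positivity
  rw [Complex.cpow_def_of_ne_zero (mul_ne_zero (Complex.ofReal_ne_zero.2 hpos.ne') hu0),
    Complex.log_ofReal_mul hpos hu0, add_mul, Complex.exp_add,
    Complex.cpow_def_of_ne_zero (Complex.ofReal_ne_zero.2 hpos.ne'),
    Complex.cpow_def_of_ne_zero hu0, Complex.ofReal_log hpos.le]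

/-- With principal logarithms, (∓i)^s = e^(∓iπs/2). The even combination is a cosine, and the odd
one is a sine, that is, the cosine of the shifted argument. -/
theorem neg_I_cpow_add (δ : ZMod 2) (s : ℂ) :
    (-Complex.I) ^ s + (-1 : ℂ) ^ δ.val * Complex.I ^ s =
      (-1 : ℂ) ^ δ.val * (2 * Complex.I ^ δ.val * Complex.cos (Real.pi * (s - (δ.val : ℂ)) / 2)) := by
  rw [Complex.cpow_def_of_ne_zero (neg_ne_zero.2 Complex.I_ne_zero),
    Complex.cpow_def_of_ne_zero Complex.I_ne_zero, Complex.log_neg_I, Complex.log_I]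
  have h : δ = 0 ∨ δ = 1 := by
    fin_cases δ
    · exact Or.inl rfl
    · exact Or.inr rfl
  rcases h with rfl | rfl
  · simp only [ZMod.val_zero, pow_zero, one_mul, Nat.cast_zero, sub_zero, mul_one]
    rw [Complex.two_cos]
    have e1 : -(Real.pi / 2 : ℂ) * Complex.I * s = -(Real.pi * s / 2) * Complex.I := by ring
    have e2 : (Real.pi / 2 : ℂ) * Complex.I * s = (Real.pi * s / 2) * Complex.I := by ring
    rw [e1, e2, add_comm]
  · rw [ZMod.val_one, pow_one, pow_one, Nat.cast_one]
    have e : (Real.pi * (s - 1) / 2 : ℂ) = Real.pi * s / 2 - Real.pi / 2 := by ring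
    rw [e, Complex.cos_sub_pi_div_two]
    have e1 : -(Real.pi / 2 : ℂ) * Complex.I * s = -(Real.pi * s / 2) * Complex.I := by ring
    have e2 : (Real.pi / 2 : ℂ) * Complex.I * s = (Real.pi * s / 2) * Complex.I := by ring
    rw [e1, e2]
    have := Complex.two_sin (Real.pi * s / 2)
    linear_combination (Complex.I) * this + (Complex.exp (-(Real.pi * s / 2) * Complex.I) -
      Complex.exp ((Real.pi * s / 2) * Complex.I)) * Complex.I_sq

/-- For y > 0 the positive factor 2πy is pulled out of both powers. For y < 0, changing the sign of
y exchanges the two terms up to (-1)^δ. -/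
theorem limit_kernel_eq (δ : ZMod 2) (s : ℂ) {y : ℝ} (hy : y ≠ 0) :
    Complex.Gamma s * ((1 / (2 * Real.pi * y * Complex.I)) ^ s +
        (-1) ^ δ.val * (1 / (-(2 * Real.pi * y * Complex.I))) ^ s) =
      (-1 : ℂ) ^ δ.val * gammaFactor δ s * signedPower δ (-s) y := by
  have hpos : ∀ y : ℝ, 0 < y → Complex.Gamma s * ((1 / (2 * Real.pi * y * Complex.I)) ^ s +
        (-1) ^ δ.val * (1 / (-(2 * Real.pi * y * Complex.I))) ^ s) =
      (-1 : ℂ) ^ δ.val * gammaFactor δ s * signedPower δ (-s) y := fun y hy => by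
    have e1 := one_div_cpow_limit s hy _ (Or.inl rfl)
    have e2 := one_div_cpow_limit s hy _ (Or.inr rfl)
    rw [mul_neg, neg_neg] at e2
    have e3 := neg_I_cpow_add δ s
    rw [e1, e2, signedPower_of_pos δ _ hy, gammaFactor]
    linear_combination (Complex.Gamma s * (2 * Real.pi : ℂ) ^ (-s) * (y : ℂ) ^ (-s)) * e3
  rcases lt_or_gt_of_ne hy with h | h
  · have h1 := hpos (-y) (neg_pos.2 h)
    have h2 : ((-1 : ℂ) ^ δ.val) * (-1) ^ δ.val = 1 := by
      rw [← mul_pow]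
      simp
    rw [signedPower_neg, Complex.ofReal_neg, mul_neg, neg_mul, neg_neg] at h1
    linear_combination (-1 : ℂ) ^ δ.val * h1 + ((-1 : ℂ) ^ δ.val * gammaFactor δ s *
      signedPower δ (-s) y - Complex.Gamma s * (1 / (2 * Real.pi * y * Complex.I)) ^ s) * h2
  · exact hpos y h

/-! ### The local functional equation for test functions. -/

theorem powerBounded_schwartz (g : 𝓢(ℝ, ℂ)) (k : ℕ) : PowerBounded 0 k g := by
  refine ⟨g.continuous.measurable, max (SchwartzMap.seminorm ℂ 0 0 g)
    (SchwartzMap.seminorm ℂ k 0 g), fun x hx => ⟨fun _ => ?_, fun h => ?_⟩⟩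
  · rw [zpow_zero, mul_one]
    exact (g.norm_le_seminorm ℂ x).trans (le_max_left _ _)
  · have h1 := g.norm_pow_mul_le_seminorm ℂ k x
    have px : 0 < |x| ^ k := pow_pos (abs_pos.2 hx) _
    rw [Real.norm_eq_abs] at h1
    rw [zpow_neg, zpow_natCast, ← div_eq_mul_inv, le_div_iff₀ px, mul_comm]
    exact h1.trans (le_max_right _ _)

theorem powerBounded_of_notMem (f : TestFun) (hf : (0 : ℝ) ∉ tsupport f) (l₀ l₁ : ℤ) :
    PowerBounded l₀ l₁ f := by
  have h : PowerBounded 0 0 fun _ => 1 := ⟨measurable_const, 1, fun x _ => by simp⟩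
  have := h.mul_of_notMem f.continuous f.hasCompactSupport hf l₀ l₁
  simpa using this

theorem integrable_schwartz_mul_signedPower (g : 𝓢(ℝ, ℂ)) (δ : ZMod 2) {α : ℂ} (hα : -1 < α.re) :
    Integrable fun x => g x * signedPower δ α x := by
  obtain ⟨n, hn⟩ := exists_nat_gt (α.re + 1)
  refine (powerBounded_schwartz g n).integrable_mul_signedPower δ (by simpa using hα) ?_
  push_cast
  linarith

theorem integrable_test_mul_signedPower (f : TestFun) (hf : (0 : ℝ) ∉ tsupport f) (δ : ZMod 2)
    (α : ℂ) : Integrable fun x => f x * signedPower δ α x := by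
  obtain ⟨n, hn⟩ := exists_int_gt (α.re + 1)
  obtain ⟨m, hm⟩ := exists_int_gt (-α.re - 1)
  exact (powerBounded_of_notMem f hf m n).integrable_mul_signedPower δ (by linarith) (by linarith)

/-- The bound depends on z only through the lower bound y. It is therefore uniform in the damping
parameter; the exponential factor accounts for the argument of 1/z. -/
theorem norm_one_div_cpow_le {s z : ℂ} (hs : 0 ≤ s.re) {y : ℝ} (hy : 0 < y) (h : y ≤ ‖z‖) :
    ‖(1 / z) ^ s‖ ≤ y ^ (-s.re) * Real.exp (Real.pi * |s.im|) := by
  refine (Complex.norm_cpow_le _ _).trans ?_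
  rw [div_eq_mul_inv, ← Real.exp_neg]
  have h1 : ‖1 / z‖ ≤ y⁻¹ := by
    rw [norm_div, norm_one, one_div]
    exact inv_anti₀ hy h
  have h2 : -((1 / z).arg * s.im) ≤ Real.pi * |s.im| := by
    refine (neg_le_abs _).trans ?_
    rw [abs_mul]
    exact mul_le_mul_of_nonneg_right (Complex.abs_arg_le_pi _) (abs_nonneg _)
  calc ‖1 / z‖ ^ s.re * Real.exp (-((1 / z).arg * s.im)) ≤
      y⁻¹ ^ s.re * Real.exp (Real.pi * |s.im|) := by gcongr
    _ = _ := by rw [Real.inv_rpow hy.le, Real.rpow_neg hy.le]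

theorem tendsto_one_div_cpow (s : ℂ) {c : ℂ} (hc : c.im ≠ 0) :
    Tendsto (fun ε : ℝ => (1 / ((ε : ℂ) + c)) ^ s) (𝓝[>] 0) (𝓝 ((1 / c) ^ s)) := by
  have hc0 : c ≠ 0 := fun h => hc (by simp [h])
  have h1 : ContinuousAt (fun z : ℂ => (1 / z) ^ s) c := by
    refine ContinuousAt.cpow (continuousAt_const.div continuousAt_id hc0) continuousAt_const ?_
    rw [Complex.mem_slitPlane_iff]
    right
    simp only [one_div, Complex.inv_im]
    exact div_ne_zero (neg_ne_zero.2 hc) (Complex.normSq_pos.2 hc0).ne'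
  have h2 : Tendsto (fun ε : ℝ => (ε : ℂ) + c) (𝓝[>] 0) (𝓝 c) := by
    have : Tendsto (fun ε : ℝ => (ε : ℂ) + c) (𝓝 0) (𝓝 (((0 : ℝ) : ℂ) + c)) :=
      (Complex.continuous_ofReal.tendsto 0).add_const c
    rw [Complex.ofReal_zero, zero_add] at this
    exact this.mono_left nhdsWithin_le_nhds
  exact h1.tendsto.comp h2

/-- The local functional equation, for test functions vanishing near the origin. -/
theorem integral_fourier_mul_signedPower (f : TestFun) (hf : (0 : ℝ) ∉ tsupport f) (δ : ZMod 2)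
    {s : ℂ} (hs : 0 < s.re) :
    ∫ x, (𝓕 (testToSchwartz f) : 𝓢(ℝ, ℂ)) x * signedPower δ (s - 1) x =
      (-1 : ℂ) ^ δ.val * gammaFactor δ s * ∫ y, f y * signedPower δ (-s) y := by
  have hI := integrable_schwartz_mul_signedPower (𝓕 (testToSchwartz f)) δ (α := s - 1)
    (by simpa using hs)
  have hpi := Real.pi_pos
  -- The kernel |x|^(s-1) is not integrable at infinity, so it is damped by exp(-ε|x|). The identity
  -- for ε > 0 is the self-adjointness of the Fourier transform for integrable functions, and the
  -- damping is removed on both sides by dominated convergence.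
  have A : Tendsto (fun ε : ℝ => ∫ x, (𝓕 (testToSchwartz f) : 𝓢(ℝ, ℂ)) x *
      (signedPower δ (s - 1) x * expDamp ε x)) (𝓝[>] 0)
      (𝓝 (∫ x, (𝓕 (testToSchwartz f) : 𝓢(ℝ, ℂ)) x * signedPower δ (s - 1) x)) := by
    refine tendsto_integral_filter_of_dominated_convergence _ (Eventually.of_forall fun ε => ?_) ?_
      hI.norm ?_
    · exact ((𝓕 (testToSchwartz f) : 𝓢(ℝ, ℂ)).continuous.measurable.mul
        ((measurable_signedPower δ _).mul (measurable_expDamp ε))).aestronglyMeasurable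
    · filter_upwards [self_mem_nhdsWithin] with ε hε
      refine Eventually.of_forall fun x => ?_
      rw [← mul_assoc, norm_mul]
      exact mul_le_of_le_one_right (norm_nonneg _) (norm_expDamp_le (le_of_lt hε) x)
    · refine Eventually.of_forall fun x => ?_
      have h1 : Tendsto (fun ε : ℝ => expDamp ε x) (𝓝[>] 0) (𝓝 1) := by
        have hc : Continuous fun ε : ℝ => expDamp ε x := by unfold expDamp; fun_prop
        have := hc.tendsto 0
        simp only [expDamp, zero_mul, neg_zero, Real.exp_zero, Complex.ofReal_one] at this
        exact this.mono_left nhdsWithin_le_nhds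
      simpa using (h1.const_mul (signedPower δ (s - 1) x)).const_mul
        ((𝓕 (testToSchwartz f) : 𝓢(ℝ, ℂ)) x)
  have B : Tendsto (fun ε : ℝ => ∫ y, f y * (Complex.Gamma s *
      ((1 / (ε + 2 * Real.pi * y * Complex.I)) ^ s +
        (-1) ^ δ.val * (1 / (ε + -(2 * Real.pi * y * Complex.I))) ^ s))) (𝓝[>] 0)
      (𝓝 (∫ y, f y * ((-1 : ℂ) ^ δ.val * gammaFactor δ s * signedPower δ (-s) y))) := by
    -- The function f vanishes near 0, so |y|^(-s) does no harm there and no upper bound on Re s is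
    -- required.
    have hb : Integrable fun y => (‖f y‖ * |y| ^ (-s.re)) * (‖Complex.Gamma s‖ *
        (2 * ((2 * Real.pi) ^ (-s.re) * Real.exp (Real.pi * |s.im|)))) := by
      obtain ⟨n, hn⟩ := exists_int_gt (-s.re + 1)
      obtain ⟨m, hm⟩ := exists_int_gt (-(-s.re) - 1)
      exact ((powerBounded_of_notMem f hf m n).integrable_norm_mul_rpow (by linarith)
        (by linarith)).mul_const _
    refine tendsto_integral_filter_of_dominated_convergence _ (Eventually.of_forall fun ε => ?_) ?_
      hb ?_
    · refine (f.continuous.measurable.mul ?_).aestronglyMeasurable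
      fun_prop
    · filter_upwards [self_mem_nhdsWithin] with ε hε
      filter_upwards [ae_ne_zero] with y hy
      have py : 0 < |y| := abs_pos.2 hy
      have n1 : ∀ c : ℝ, |c| ≤ ‖(ε : ℂ) + c * Complex.I‖ := fun c => by
        have := Complex.abs_im_le_norm ((ε : ℂ) + c * Complex.I)
        simpa using this
      have n2 := norm_one_div_cpow_le (s := s) hs.le (y := 2 * Real.pi * |y|) (by positivity)
        (by have := n1 (2 * Real.pi * y)
            rwa [abs_mul, abs_of_pos (by positivity : 0 < 2 * Real.pi)] at this)
      have n3 := norm_one_div_cpow_le (s := s) hs.le (y := 2 * Real.pi * |y|) (by positivity)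
        (by have := n1 (-(2 * Real.pi * y))
            rwa [abs_neg, abs_mul, abs_of_pos (by positivity : 0 < 2 * Real.pi)] at this)
      push_cast at n2 n3
      rw [neg_mul] at n3
      rw [Real.mul_rpow (by positivity) py.le] at n2 n3
      rw [norm_mul, norm_mul, mul_assoc ‖f y‖]
      refine mul_le_mul_of_nonneg_left ?_ (norm_nonneg _)
      rw [mul_left_comm]
      refine mul_le_mul_of_nonneg_left ((norm_add_le _ _).trans ?_) (norm_nonneg _)
      have n4 : ‖(-1 : ℂ) ^ δ.val‖ = 1 := by simp
      rw [norm_mul, n4, one_mul]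
      refine (add_le_add n2 n3).trans (le_of_eq ?_)
      ring
    · filter_upwards [ae_ne_zero] with y hy
      have him : (2 * Real.pi * y * Complex.I : ℂ).im ≠ 0 := by simp [hy, hpi.ne']
      rw [← limit_kernel_eq δ s hy]
      exact (((tendsto_one_div_cpow s him).add ((tendsto_one_div_cpow s (c := -(2 * Real.pi * y * Complex.I))
        (by rw [Complex.neg_im]; exact neg_ne_zero.2 him)).const_mul _)).const_mul _).const_mul _
  have C : ∀ ε : ℝ, 0 < ε → ∫ x, (𝓕 (testToSchwartz f) : 𝓢(ℝ, ℂ)) x *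
      (signedPower δ (s - 1) x * expDamp ε x) = ∫ y, f y * (Complex.Gamma s *
      ((1 / (ε + 2 * Real.pi * y * Complex.I)) ^ s +
        (-1) ^ δ.val * (1 / (ε + -(2 * Real.pi * y * Complex.I))) ^ s)) := by
    intro ε hε
    have hfi : Integrable (testToSchwartz f) volume := (testToSchwartz f).integrable
    have h := VectorFourier.integral_fourierIntegral_smul_eq_flip (L := innerₗ ℝ)
      (μ := volume) (ν := volume) Real.continuous_fourierChar continuous_inner hfi
      (fourier_signedPower_mul_expDamp δ hs hε 0).1
    rw [flip_innerₗ] at h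
    refine h.trans ?_
    congr 1
    funext y
    have h2 := (fourier_signedPower_mul_expDamp δ hs hε y).2
    rw [sub_eq_add_neg (ε : ℂ)] at h2
    rw [← h2]
    rfl
  have D := tendsto_nhds_unique_of_eventuallyEq A B (by
    filter_upwards [self_mem_nhdsWithin] with ε hε using C ε hε)
  rw [D, ← integral_const_mul]
  congr 1
  funext y
  ring

/-! ### The dilation argument -/

theorem integral_comp_mul_signedPower (g : ℝ → ℂ) (δ : ZMod 2) (α : ℂ) {x : ℝ} (hx : x ≠ 0) :
    ∫ t, g (t * x) * signedPower δ α t =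
      signedPower δ (-α - 1) x * ∫ t, g t * signedPower δ α t := by
  have hx' : ((|x| : ℝ) : ℂ) ≠ 0 := by exact_mod_cast (abs_pos.2 hx).ne'
  have h : ∀ t, g (t * x) * signedPower δ α t =
      (fun t => g t * signedPower δ α t) (t * x) * signedPower δ (-α) x := fun t => by
    simp only
    have : signedPower δ α t = signedPower δ α (t * x) * signedPower δ (-α) x := by
      rw [← signedPower_inv, ← signedPower_mul_left, mul_inv_cancel_right₀ hx]
    rw [this]
    ring
  rw [funext h, integral_mul_const,
    Measure.integral_comp_mul_right (fun t => g t * signedPower δ α t), sub_eq_add_neg,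
    signedPower_add δ _ _ hx, Complex.cpow_neg_one, abs_inv, Complex.real_smul]
  push_cast
  ring

/-- For fixed x ≠ 0, substituting t/x for t factors out the signed power of x. The same substitution
applied to norms gives the absolute convergence needed for Fubini. -/
theorem dilation_fubini {u g : ℝ → ℂ} (δ : ZMod 2) {α : ℂ} (hu : Measurable u) (hg : Measurable g)
    (h₁ : Integrable fun x => u x * signedPower δ (-α - 1) x)
    (h₂ : Integrable fun x => g x * signedPower δ α x) :
    Integrable (fun t => (∫ x, u x * g (t * x)) * signedPower δ α t) ∧
    ∫ t, (∫ x, u x * g (t * x)) * signedPower δ α t =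
      (∫ x, u x * signedPower δ (-α - 1) x) * ∫ x, g x * signedPower δ α x := by
  let F : ℝ → ℝ → ℂ := fun t x => u x * (g (t * x) * signedPower δ α t)
  have hFm : AEStronglyMeasurable (Function.uncurry F) (volume.prod volume) := by
    refine Measurable.aestronglyMeasurable ?_
    exact (hu.comp measurable_snd).mul ((hg.comp (measurable_fst.mul measurable_snd)).mul
      ((measurable_signedPower δ α).comp measurable_fst))
  have hi : ∀ x : ℝ, x ≠ 0 → Integrable fun t => g (t * x) * signedPower δ α t := fun x hx => by
    have h3 := ((integrable_comp_mul_right_iff (fun t => g t * signedPower δ α t) hx).2 h₂).mul_const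
      (signedPower δ α x⁻¹)
    refine h3.congr (Eventually.of_forall fun t => ?_)
    simp only
    rw [mul_assoc, ← signedPower_mul_left, mul_inv_cancel_right₀ hx]
  have hn : ∀ x : ℝ, x ≠ 0 → ∫ t, ‖F t x‖ =
      ‖u x * signedPower δ (-α - 1) x‖ * ∫ t, ‖g t * signedPower δ α t‖ := fun x hx => by
    have h3 : ∀ t, ‖F t x‖ = ‖u x‖ * ‖signedPower δ α x⁻¹‖ *
        (fun t => ‖g t * signedPower δ α t‖) (t * x) := fun t => by
      simp only [F]
      have : signedPower δ α t = signedPower δ α (t * x) * signedPower δ α x⁻¹ := by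
        rw [← signedPower_mul_left, mul_inv_cancel_right₀ hx]
      rw [this, norm_mul, norm_mul, norm_mul, norm_mul]
      ring
    rw [funext h3, integral_const_mul,
      Measure.integral_comp_mul_right (fun t => ‖g t * signedPower δ α t‖), norm_mul, signedPower_inv,
      norm_signedPower δ _ hx, norm_signedPower δ _ hx, smul_eq_mul, abs_inv, Complex.sub_re,
      Complex.one_re, Real.rpow_sub_one (abs_pos.2 hx).ne']
    ring
  have hF : Integrable (Function.uncurry F) (volume.prod volume) := by
    rw [integrable_prod_iff' hFm]
    refine ⟨?_, ?_⟩
    · filter_upwards [ae_ne_zero] with x hx using (hi x hx).const_mul (u x)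
    · refine (h₁.norm.mul_const (∫ t, ‖g t * signedPower δ α t‖)).congr ?_
      filter_upwards [ae_ne_zero] with x hx using (hn x hx).symm
  have e : ∀ t, (∫ x, u x * g (t * x)) * signedPower δ α t = ∫ x, F t x := fun t => by
    rw [← integral_mul_const]
    simp only [F, mul_assoc]
  simp only [e]
  refine ⟨hF.integral_prod_left, ?_⟩
  rw [integral_integral_swap hF, ← integral_mul_const]
  refine integral_congr_ae (ae_ne_zero.mono fun x hx => ?_)
  simp only [F]
  rw [integral_const_mul, integral_comp_mul_signedPower g δ α hx]
  ring

/-- A bump around 1 multiplied by the inverse of the signed power. It allows the auxiliary Mellin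
integral to be cancelled at the end of the dilation argument. -/
theorem exists_test_integral_ne_zero (δ : ZMod 2) (α : ℂ) :
    ∃ f : TestFun, (0 : ℝ) ∉ tsupport f ∧ ∫ x, f x * signedPower δ α x ≠ 0 := by
  let b : ContDiffBump (1 : ℝ) := ⟨1 / 4, 1 / 2, by norm_num, by norm_num⟩
  have hsupp : ∀ x, |x| < 1 / 2 → b x = 0 := fun x hx => by
    refine b.zero_of_le_dist ?_
    change 1 / 2 ≤ dist x 1
    rw [Real.dist_eq, abs_sub_comm]
    have := abs_lt.1 hx
    rw [abs_of_pos (by linarith)]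
    linarith
  have hsub : tsupport (fun x => ((b x : ℝ) : ℂ)) ⊆ Metric.closedBall 1 (1 / 2) := by
    refine closure_minimal (fun x hx => ?_) Metric.isClosed_closedBall
    by_contra h
    refine hx ?_
    simp only [b.zero_of_le_dist (not_le.1 h).le, Complex.ofReal_zero]
  let B : TestFun := ⟨fun x => ((b x : ℝ) : ℂ), Complex.ofRealCLM.contDiff.comp b.contDiff,
    (isCompact_closedBall (1 : ℝ) (1 / 2)).of_isClosed_subset (isClosed_tsupport _) hsub,
    fun _ _ => trivial⟩
  have hB : (0 : ℝ) ∉ tsupport B := notMem_tsupport_of_eqOn_zero (r := 1 / 2) (by norm_num) fun x hx => by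
    change ((b x : ℝ) : ℂ) = 0
    rw [hsupp x hx, Complex.ofReal_zero]
  refine ⟨mulOff _ (contDiffOn_signedPower δ (-α)) B hB, fun h => hB
    (tsupport_mulOff_subset _ _ _ _ h), ?_⟩
  have e : ∫ x, mulOff _ (contDiffOn_signedPower δ (-α)) B hB x * signedPower δ α x =
      ((∫ x, b x : ℝ) : ℂ) := by
    rw [← integral_complex_ofReal]
    refine integral_congr_ae (ae_ne_zero.mono fun x hx => ?_)
    simp only
    rw [mulOff_apply, mul_assoc, ← signedPower_inv, ← signedPower_mul_left, inv_mul_cancel₀ hx,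
      signedPower_of_pos δ _ one_pos, Complex.ofReal_one, Complex.one_cpow, mul_one]
    rfl
  rw [e, Complex.ofReal_ne_zero]
  exact b.integral_pos.ne'

theorem fourier_dilateTest (t : ℝ) (ht : t ≠ 0) (f : TestFun) (y : ℝ) :
    (𝓕 (testToSchwartz (dilateTest t ht f)) : 𝓢(ℝ, ℂ)) y =
      ((|t|⁻¹ : ℝ) : ℂ) * (𝓕 (testToSchwartz f) : 𝓢(ℝ, ℂ)) (t⁻¹ * y) := by
  rw [SchwartzMap.fourier_coe, SchwartzMap.fourier_coe, Real.fourier_eq', Real.fourier_eq']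
  have h := Measure.integral_comp_mul_left (fun x : ℝ =>
    Complex.exp (↑(-2 * Real.pi * inner ℝ x (t⁻¹ * y)) * Complex.I) • testToSchwartz f x) t
  rw [abs_inv, Complex.real_smul] at h
  rw [← h]
  congr 1
  funext x
  simp only [testToSchwartz_apply, dilateTest_apply, RCLike.inner_apply, conj_trivial]
  congr 4
  field_simp

theorem eulerPoly_fourier_dilateTest (p : ℂ[X]) (t : ℝ) (ht : t ≠ 0) (f : TestFun) (y : ℝ) :
    eulerPoly p (𝓕 (testToSchwartz (dilateTest t ht f)) : 𝓢(ℝ, ℂ)) y =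
      ((|t|⁻¹ : ℝ) : ℂ) * eulerPoly p (𝓕 (testToSchwartz f) : 𝓢(ℝ, ℂ)) (t⁻¹ * y) := by
  have hs := (𝓕 (testToSchwartz f) : 𝓢(ℝ, ℂ)).smooth ⊤
  rw [funext (fourier_dilateTest t ht f),
    eulerPoly_fun_const_mul p _ (f := fun y => (𝓕 (testToSchwartz f) : 𝓢(ℝ, ℂ)) (t⁻¹ * y)) (hs.comp (contDiff_const.mul contDiff_id)),
    eulerPoly_comp_mul_left p hs]

/-- The functional equation for the Mellin transforms of a tempered distribution and of its
Fourier transform. -/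
theorem mellinSum_fourier {σ : 𝓢'(ℝ, ℂ)} {ι κ : Type} [Fintype ι] [Fintype κ] {v : ι → ℝ → ℂ}
    {p : ι → ℂ[X]} {u : κ → ℝ → ℂ} {q : κ → ℂ[X]} {k₀ k₁ l₀ l₁ : ℤ}
    (hv : ∀ j, PowerBounded k₀ k₁ (v j)) (hu : ∀ j, PowerBounded l₀ l₁ (u j))
    (hσ : ∀ f : 𝓢(ℝ, ℂ), σ f = ∑ j, ∫ x, v j x * eulerPoly (p j) f x)
    (hσ' : ∀ f ∈ OffZero, toDistr (𝓕 σ) f = ∑ j, ∫ x, u j x * eulerPoly (q j) f x)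
    (δ : ZMod 2) {s : ℂ} (hs : 0 < s.re) (hk₀ : -(k₀ : ℝ) < 1 - s.re) (hk₁ : 1 - s.re < k₁)
    (hl₀ : -(l₀ : ℝ) < s.re) (hl₁ : s.re < l₁) :
    mellinSum u q δ s = (-1 : ℂ) ^ δ.val * gammaFactor δ s * mellinSum v p δ (1 - s) := by
  obtain ⟨f, hf, hc⟩ := exists_test_integral_ne_zero δ (-s)
  have es : -(-s) - 1 = s - 1 := by ring
  have es' : -(s - 1) - 1 = -s := by ring
  have hA := fun j => dilation_fubini (u := u j) (g := eulerPoly (q j) f) δ (α := -s) (hu j).1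
    (continuous_eulerPoly _ f.contDiff).measurable
    (by rw [es]; exact (hu j).integrable_mul_signedPower δ (by simp; linarith) (by simp; linarith))
    (integrable_test_mul_signedPower (eulerPolyTest (q j) f)
      (fun h => hf (tsupport_eulerPoly_subset _ _ h)) δ _)
  have hB := fun j => dilation_fubini (u := v j)
    (g := eulerPoly (p j) (𝓕 (testToSchwartz f) : 𝓢(ℝ, ℂ))) δ (α := s - 1) (hv j).1
    (continuous_eulerPoly _ ((𝓕 (testToSchwartz f) : 𝓢(ℝ, ℂ)).smooth ⊤)).measurable
    (by rw [es']; exact (hv j).integrable_mul_signedPower δ (by simp; linarith) (by simp; linarith))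
    (by
      have := integrable_schwartz_mul_signedPower
        (eulerPolySchwartz (p j) (𝓕 (testToSchwartz f))) δ (α := s - 1) (by simpa using hs)
      rwa [coe_eulerPolySchwartz] at this)
  -- Both sides are the value of 𝓕 σ on the dilate f(tx). The formula for 𝓕 σ is used on a function
  -- supported off 0, the one for σ on the Schwartz function 𝓕 f dilated by 1/t.
  have key : ∀ t : ℝ, t ≠ 0 → ∑ j, ∫ x, u j x * eulerPoly (q j) f (t * x) =
      ((|t|⁻¹ : ℝ) : ℂ) * ∑ j, ∫ y, v j y *
        eulerPoly (p j) (𝓕 (testToSchwartz f) : 𝓢(ℝ, ℂ)) (t⁻¹ * y) := by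
    intro t ht
    have h0 : dilateTest t ht f ∈ OffZero := by
      obtain ⟨r, hr, h⟩ := exists_inner_radius hf
      refine notMem_tsupport_of_eqOn_zero (r := r / |t|) (div_pos hr (abs_pos.2 ht)) fun x hx => ?_
      rw [dilateTest_apply, h]
      rw [abs_mul]
      rwa [lt_div_iff₀ (abs_pos.2 ht), mul_comm] at hx
    have h1 := hσ' _ h0
    rw [toDistr_apply, TemperedDistribution.fourier_apply, hσ] at h1
    have e1 : ∀ j, ∫ x, u j x * eulerPoly (q j) (dilateTest t ht f) x =
        ∫ x, u j x * eulerPoly (q j) f (t * x) := fun j => by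
      congr 1
      funext x
      rw [← eulerPoly_comp_mul_left (q j) f.contDiff]
      rfl
    simp only [e1] at h1
    rw [← h1, Finset.mul_sum]
    refine Finset.sum_congr rfl fun j _ => ?_
    rw [← integral_const_mul]
    congr 1
    funext y
    rw [eulerPoly_fourier_dilateTest]
    ring
  have A : ∫ t, (∑ j, ∫ x, u j x * eulerPoly (q j) f (t * x)) * signedPower δ (-s) t =
      mellinSum u q δ s * ∫ x, f x * signedPower δ (-s) x := by
    simp only [Finset.sum_mul]
    rw [integral_finsetSum _ fun j _ => (hA j).1, mellinSum, Finset.sum_mul]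
    refine Finset.sum_congr rfl fun j _ => ?_
    rw [(hA j).2, integral_eulerPoly_mul_signedPower _ _ hf, es]
    ring
  have B : ∫ t, (∑ j, ∫ x, u j x * eulerPoly (q j) f (t * x)) * signedPower δ (-s) t =
      (-1 : ℂ) ^ δ.val * gammaFactor δ s * mellinSum v p δ (1 - s) *
        ∫ x, f x * signedPower δ (-s) x := by
    -- Substitute 1/t for t. The Jacobian t⁻², the factor |t| from dilating the Fourier transform,
    -- and |t|^s combine to |t|^(s-1).
    have e1 : ∫ t, (∑ j, ∫ x, u j x * eulerPoly (q j) f (t * x)) * signedPower δ (-s) t =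
        ∫ t, (∑ j, ∫ y, v j y * eulerPoly (p j) (𝓕 (testToSchwartz f) : 𝓢(ℝ, ℂ)) (t * y)) *
          signedPower δ (s - 1) t := by
      rw [← integral_comp_inv_mul]
      refine integral_congr_ae (ae_ne_zero.mono fun t ht => ?_)
      simp only
      have ht' : ((|t| : ℝ) : ℂ) ≠ 0 := by exact_mod_cast (abs_pos.2 ht).ne'
      have hsq : ((|t| : ℝ) : ℂ) ^ 2 = (t : ℂ) ^ 2 := by
        rw [← Complex.ofReal_pow, sq_abs, Complex.ofReal_pow]
      rw [key _ (inv_ne_zero ht), inv_inv, signedPower_inv, neg_neg, abs_inv, inv_inv,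
        sub_eq_add_neg, signedPower_add δ _ _ ht, Complex.cpow_neg_one, ← hsq]
      field_simp
    rw [e1]
    simp only [Finset.sum_mul]
    rw [integral_finsetSum _ fun j _ => (hB j).1, mellinSum, Finset.mul_sum, Finset.sum_mul]
    refine Finset.sum_congr rfl fun j _ => ?_
    rw [(hB j).2, es', eulerPoly_fourier]
    have h0 : (0 : ℝ) ∉ tsupport (eulerPolyTest (affComp (p j) (-1) (-1)) f) :=
      fun h => hf (tsupport_eulerPoly_subset _ _ h)
    have h1 := integral_fourier_mul_signedPower _ h0 δ hs
    have e2 : testToSchwartz (eulerPolyTest (affComp (p j) (-1) (-1)) f) =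
        eulerPolySchwartz (affComp (p j) (-1) (-1)) (testToSchwartz f) := by
      ext x
      rw [coe_eulerPolySchwartz]
      rfl
    rw [e2, coe_eulerPolyTest, integral_eulerPoly_mul_signedPower _ _ hf, eval_affComp] at h1
    rw [h1]
    have e3 : -1 * (-(-s) - 1) + -1 = 1 - s - 1 := by ring
    have e4 : (1 - s - 1 : ℂ) = -s := by ring
    rw [e3, e4]
    ring
  rw [A] at B
  exact mul_right_cancel₀ hc B

/-! ### Integral formulas valid on all Schwartz functions. -/

theorem VanishesToNatOrder.mono {T : Distr} {k l : ℕ} (h : VanishesToNatOrder T k) (hl : l ≤ k) :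
    VanishesToNatOrder T l := by
  obtain ⟨U, hU, h0, N, f, D, w, hf, hrest⟩ := h
  refine ⟨U, hU, h0, N, f, D, w, fun j => ?_, hrest⟩
  obtain ⟨v, hv, e⟩ := hf j
  refine ⟨fun x => (x : ℂ) ^ (k - l) * v x, (contDiff_ofReal_pow _).contDiffOn.mul hv,
    fun x hx => ?_⟩
  rw [e x hx, ← mul_assoc, ← pow_add, Nat.add_sub_cancel' hl]

theorem PowerBounded.mul_zpow {k₀ k₁ : ℤ} {v : ℝ → ℂ} (hv : PowerBounded k₀ k₁ v) (n : ℤ) :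
    PowerBounded (k₀ + n) (k₁ - n) fun x => v x * (x : ℂ) ^ n := by
  obtain ⟨hm, C, hC⟩ := hv
  refine ⟨hm.mul (by fun_prop), C, fun x hx => ?_⟩
  have px : |x| ≠ 0 := (abs_pos.2 hx).ne'
  have e : ∀ m : ℤ, C * |x| ^ (m + n) = C * |x| ^ m * |x| ^ n := fun m => by
    rw [zpow_add₀ px, mul_assoc]
  rw [neg_sub, sub_eq_neg_add, e, e, norm_mul, norm_zpow, Complex.norm_real, Real.norm_eq_abs]
  exact ⟨fun h => mul_le_mul_of_nonneg_right ((hC x hx).1 h) (by positivity),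
    fun h => mul_le_mul_of_nonneg_right ((hC x hx).2 h) (by positivity)⟩

theorem exists_clm_integral {w : ℝ → ℂ} (hw : Integrable w) :
    ∃ L : 𝓢(ℝ, ℂ) →L[ℂ] ℂ, ∀ g, L g = ∫ x, w x * g x := by
  have hi : ∀ g : BoundedContinuousFunction ℝ ℂ, Integrable fun x => w x * g x := fun g =>
    hw.mul_bdd (c := ‖g‖) g.continuous.aestronglyMeasurable
      (Eventually.of_forall fun x => g.norm_coe_le_norm x)
  let l : BoundedContinuousFunction ℝ ℂ →ₗ[ℂ] ℂ :=
    { toFun := fun g => ∫ x, w x * g x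
      map_add' := fun g h => by
        simp only [BoundedContinuousFunction.coe_add, Pi.add_apply, mul_add]
        exact integral_add (hi g) (hi h)
      map_smul' := fun c g => by
        simp only [BoundedContinuousFunction.coe_smul, smul_eq_mul, RingHom.id_apply]
        rw [← integral_const_mul]
        congr 1
        funext x
        ring }
  refine ⟨(l.mkContinuous (∫ x, ‖w x‖) fun g => ?_).comp
    (SchwartzMap.toBoundedContinuousFunctionCLM ℂ ℝ ℂ), fun g => rfl⟩
  refine (norm_integral_le_integral_norm _).trans ?_
  rw [← integral_mul_const]
  refine integral_mono (hi g).norm (hw.norm.mul_const _) fun x => ?_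
  simp only [norm_mul]
  exact mul_le_mul_of_nonneg_left (g.norm_coe_le_norm x) (norm_nonneg _)

/-- Nonnegative order at 0 gives local integrability. Dividing v by a high power of 1 + x² makes it
integrable, and that power is given back to the Schwartz function. -/
theorem PowerBounded.exists_clm {k₀ k₁ : ℤ} {v : ℝ → ℂ} (hv : PowerBounded k₀ k₁ v)
    (h : 0 ≤ k₀) : ∃ L : 𝓢(ℝ, ℂ) →L[ℂ] ℂ, ∀ g, L g = ∫ x, v x * g x := by
  obtain ⟨m, hm⟩ : ∃ m : ℕ, 1 < k₁ + 2 * m := ⟨(2 - k₁).toNat, by omega⟩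
  obtain ⟨hvm, C, hC⟩ := hv
  have hw : PowerBounded k₀ (k₁ + 2 * m) fun x => v x * ((1 + (x : ℂ) ^ 2) ^ m)⁻¹ := by
    refine ⟨by fun_prop, C, fun x hx => ?_⟩
    have px : 0 < |x| := abs_pos.2 hx
    have h1 : (1 : ℝ) ≤ (1 + x ^ 2) ^ m := one_le_pow₀ (by nlinarith [sq_nonneg x])
    rw [norm_mul, norm_inv, norm_weight]
    refine ⟨fun hx1 => ?_, fun hx1 => ?_⟩
    · exact (mul_le_of_le_one_right (norm_nonneg _) (inv_le_one_of_one_le₀ h1)).trans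
        ((hC x hx).1 hx1)
    · have h2 : |x| ^ (2 * m) ≤ (1 + x ^ 2) ^ m := by
        rw [pow_mul, sq_abs]
        gcongr
        linarith
      have h3 : |x| ^ (-(k₁ + 2 * m : ℤ)) = |x| ^ (-k₁) * (|x| ^ (2 * m))⁻¹ := by
        rw [neg_add, zpow_add₀ px.ne', zpow_neg _ (2 * (m : ℤ))]
        norm_cast
      rw [h3, ← mul_assoc]
      refine mul_le_mul ((hC x hx).2 hx1) (inv_anti₀ (by positivity) h2) (by positivity) ?_
      exact (norm_nonneg _).trans ((hC x hx).2 hx1)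
  obtain ⟨L, hL⟩ := exists_clm_integral (hw.integrable_of_lt (by linarith) hm)
  refine ⟨L.comp (weightCLM m), fun g => ?_⟩
  rw [ContinuousLinearMap.comp_apply, hL]
  congr 1
  funext x
  have h0 : (1 + (x : ℂ) ^ 2) ^ m ≠ 0 := norm_pos_iff.1 (by rw [norm_weight]; positivity)
  rw [weightCLM_apply, mul_assoc, inv_mul_cancel_left₀ h0]

theorem exists_clm_sum {ι : Type} [Fintype ι] {v : ι → ℝ → ℂ} {k₀ k₁ : ℤ} (h : 0 ≤ k₀)
    (hv : ∀ j, PowerBounded k₀ k₁ (v j)) (p : ι → ℂ[X]) : ∃ L : 𝓢(ℝ, ℂ) →L[ℂ] ℂ, ∀ g,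
      L g = ∑ j, ∫ x, v j x * eulerPoly (p j) g x := by
  choose L hL using fun j => (hv j).exists_clm h
  refine ⟨∑ j, (L j).comp (eulerPolySchwartz (p j)), fun g => ?_⟩
  rw [sum_apply]
  refine Finset.sum_congr rfl fun j _ => ?_
  rw [ContinuousLinearMap.comp_apply, hL, coe_eulerPolySchwartz]

theorem PowerBounded.exists_bound_near_zero {k₁ : ℤ} {k : ℕ} {v : ℝ → ℂ}
    (hv : PowerBounded k k₁ v) :
    ∃ C : ℝ, ∀ x : ℝ, x ≠ 0 → |x| ≤ 1 → ‖v x‖ ≤ C * |x| ^ k := by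
  obtain ⟨-, C, hC⟩ := hv
  exact ⟨C, fun x hx h => by simpa using (hC x hx).1 h⟩

section Representation

variable {ι : Type} [Fintype ι] {v : ι → ℝ → ℂ} {p : ι → ℂ[X]}

/-- A formula for a tempered distribution which holds off the origin holds for all Schwartz
functions if both sides vanish to order `0` at the origin. -/
theorem apply_schwartz_of_offZero {σ : 𝓢'(ℝ, ℂ)} {k₀ k₁ : ℤ} (h0 : 0 ≤ k₀)
    (hσ : VanishesToNatOrder (toDistr σ) 0) (hv : ∀ j, PowerBounded k₀ k₁ (v j))
    (hS : ∀ f ∈ OffZero, toDistr σ f = ∑ j, ∫ x, v j x * eulerPoly (p j) f x) (f : 𝓢(ℝ, ℂ)) :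
    σ f = ∑ j, ∫ x, v j x * eulerPoly (p j) f x := by
  obtain ⟨L, hL⟩ := exists_clm_sum h0 hv p
  let T : Distr := L.comp testToSchwartz
  have hT : ∀ f, T f = ∑ j, ∫ x, v j x * eulerPoly (p j) f x := fun f => hL _
  have hT0 : VanishesToNatOrder T 0 := by
    refine vanishesToNatOrder_of_eq (fun j => (hv j).1) (fun j => ?_) fun f _ => hT f
    exact PowerBounded.exists_bound_near_zero (k := 0) ((hv j).mono (by simpa using h0) le_rfl)
  -- The difference is supported at 0 and vanishes to order 0 there, so it is zero on test
  -- functions; density then covers Schwartz functions.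
  have e : temperedCLM σ = L := clm_ext_testFun fun f => by
    have := eq_zero_of_vanishesToNatOrder (hσ.sub hT0)
      (fun f hf => by rw [sub_apply, hS f hf, hT, sub_self]) f
    rw [sub_apply, sub_eq_zero] at this
    exact this
  rw [← temperedCLM_apply, e, hL]

/-- Order k ≥ 0 at ∞ makes the inverted coefficients bounded near 0, so the inverted formula defines
the extension directly. -/
theorem exists_extension_of_powerBounded {S : Distr} {k₀ : ℤ} {k : ℕ}
    (hv : ∀ j, PowerBounded k₀ k (v j))
    (hS : ∀ f ∈ OffZero, S f = ∑ j, ∫ x, v j x * eulerPoly (p j) f x) :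
    ∃ T, IsExtensionAcrossInfinity S T ∧ VanishesToNatOrder T k := by
  have hT : ∀ f : TestFun, (∑ j, eulerDistr (fun x => v j x⁻¹) (affComp (p j) (-1) (-2))) f =
      ∑ j, ∫ x, v j x⁻¹ * eulerPoly (affComp (p j) (-1) (-2)) f x := fun f => by
    rw [sum_apply]
    exact Finset.sum_congr rfl fun j _ =>
      eulerDistr_apply ((hv j).comp_inv.locallyIntegrable (Int.natCast_nonneg k)) _ f
  refine ⟨_, isExtensionAcrossInfinity_of fun f hf => ?_, vanishesToNatOrder_of_eq
    (fun j => (hv j).comp_inv.1) (fun j => (hv j).comp_inv.exists_bound_near_zero)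
    fun f _ => hT f⟩
  rw [hT, hS _ (zero_notMem_tsupport_invTest f hf)]
  simp only [integral_mul_eulerPoly_invTest]

end Representation

/-! ### Fourier transforms of distributions vanishing at the origin -/

theorem iterate_derivCLM_fourier (k : ℕ) (g : 𝓢(ℝ, ℂ)) (x : ℝ) :
    (𝓕 ((SchwartzMap.derivCLM ℂ ℂ)^[k] g) : 𝓢(ℝ, ℂ)) x =
      (2 * Real.pi * Complex.I * x) ^ k * (𝓕 g : 𝓢(ℝ, ℂ)) x := by
  rw [SchwartzMap.fourier_coe, coe_iterate_derivCLM, SchwartzMap.fourier_coe]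
  have := Real.fourier_iteratedDeriv (f := g) (N := ⊤) (n := k) (g.smooth ⊤)
    (fun n _ => by
      rw [← coe_iterate_derivCLM]
      exact SchwartzMap.integrable _) le_top
  rw [this]
  rfl

theorem integral_fourier_mul {u : ℝ → ℂ} (hu : Integrable u) (g : 𝓢(ℝ, ℂ)) :
    ∫ x, u x * (𝓕 g : 𝓢(ℝ, ℂ)) x = ∫ y, 𝓕 u y * g y := by
  have hg : Integrable g volume := g.integrable
  have h := VectorFourier.integral_fourierIntegral_smul_eq_flip (L := innerₗ ℝ)
    (μ := volume) (ν := volume) Real.continuous_fourierChar continuous_inner hu hg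
  rw [flip_innerₗ] at h
  exact h.symm

theorem continuous_fourier {u : ℝ → ℂ} (hu : Integrable u) : Continuous (𝓕 u) :=
  VectorFourier.fourierIntegral_continuous Real.continuous_fourierChar continuous_inner hu

theorem norm_fourier_le (u : ℝ → ℂ) (y : ℝ) : ‖𝓕 u y‖ ≤ ∫ x, ‖u x‖ :=
  VectorFourier.norm_fourierIntegral_le_integral_norm _ _ _ _ _

theorem powerBounded_of_bounded {u : ℝ → ℂ} (hu : Measurable u) {C : ℝ} (hC : ∀ x, ‖u x‖ ≤ C) :
    PowerBounded 0 0 u :=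
  ⟨hu, C, fun x _ => ⟨fun _ => by simpa using hC x, fun _ => by simpa using hC x⟩⟩

theorem testToSchwartz_mulTest_pow (k : ℕ) (f : TestFun) (x : ℝ) :
    testToSchwartz (mulTest (fun x : ℝ => (x : ℂ) ^ k) (contDiff_ofReal_pow k) f) x =
      (x : ℂ) ^ k * f x := mul_comm _ _

/-- Write v = x^k u. Here u has order 0 at 0 and order k + k₁ ≥ 2 at ∞, hence is integrable with
bounded Fourier transform, while x^k becomes the k-th derivative up to a constant. -/
theorem fourier_apply_eq {σ : 𝓢'(ℝ, ℂ)} {ι : Type} [Fintype ι] {v : ι → ℝ → ℂ} {p : ι → ℂ[X]}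
    {k : ℕ} {k₁ : ℤ} (hv : ∀ j, PowerBounded k k₁ (v j)) (hk : 2 ≤ k + k₁)
    (hσ : ∀ f : 𝓢(ℝ, ℂ), σ f = ∑ j, ∫ x, v j x * eulerPoly (p j) f x) :
    ∃ w : ι → ℝ → ℂ, (∀ j, PowerBounded 0 0 (w j)) ∧ ∀ f : 𝓢(ℝ, ℂ), (𝓕 σ) f =
      ∑ j, ∫ x, w j x * iteratedDeriv k (eulerPoly (affComp (p j) (-1) (-1)) f) x := by
  let u : ι → ℝ → ℂ := fun j x => v j x * (x : ℂ) ^ (-k : ℤ)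
  have hu : ∀ j, Integrable (u j) := fun j =>
    ((hv j).mul_zpow (-k)).integrable_of_lt (by omega) (by omega)
  have hc : (2 * Real.pi * Complex.I : ℂ) ^ k ≠ 0 := pow_ne_zero _ Complex.two_pi_I_ne_zero
  refine ⟨fun j y => 𝓕 (u j) y * ((2 * Real.pi * Complex.I : ℂ) ^ k)⁻¹, fun j =>
    (powerBounded_of_bounded (continuous_fourier (hu j)).measurable
      (norm_fourier_le (u j))).mul_bounded measurable_const fun _ => le_rfl, fun f => ?_⟩
  rw [TemperedDistribution.fourier_apply, hσ]
  refine Finset.sum_congr rfl fun j _ => ?_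
  let g := eulerPolySchwartz (affComp (p j) (-1) (-1)) f
  have e1 : ∫ x, v j x * eulerPoly (p j) (𝓕 f : 𝓢(ℝ, ℂ)) x =
      ∫ x, ((2 * Real.pi * Complex.I : ℂ) ^ k)⁻¹ *
        (u j x * (𝓕 ((SchwartzMap.derivCLM ℂ ℂ)^[k] g) : 𝓢(ℝ, ℂ)) x) := by
    refine integral_congr_ae (ae_ne_zero.mono fun x hx => ?_)
    have hx' : (x : ℂ) ^ k ≠ 0 := pow_ne_zero _ (by exact_mod_cast hx)
    simp only [u, zpow_neg, zpow_natCast]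
    rw [eulerPoly_fourier, iterate_derivCLM_fourier,
      mul_pow (2 * Real.pi * Complex.I : ℂ)]
    field_simp
    rfl
  rw [e1, integral_const_mul, integral_fourier_mul (hu j), ← integral_const_mul]
  congr 1
  funext x
  rw [coe_iterate_derivCLM, coe_eulerPolySchwartz]
  ring

/-- If `σ` vanishes to order `k` at the origin and decays sufficiently at `∞`, then its Fourier
transform vanishes to order `-k` at the origin and to order `k` at `∞`. -/
theorem vanishesToOrder_fourier {σ : 𝓢'(ℝ, ℂ)} {ι : Type} [Fintype ι] {v : ι → ℝ → ℂ}
    {p : ι → ℂ[X]} {k : ℕ} {k₁ : ℤ} (hv : ∀ j, PowerBounded k k₁ (v j)) (hk : 2 ≤ k + k₁)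
    (hσ : ∀ f : 𝓢(ℝ, ℂ), σ f = ∑ j, ∫ x, v j x * eulerPoly (p j) f x) :
    VanishesToNatOrder (mulPow k (toDistr (𝓕 σ))) 0 ∧
      ∃ T, IsExtensionAcrossInfinity (toDistr (𝓕 σ)) T ∧ VanishesToNatOrder T k := by
  obtain ⟨w, hw, hF⟩ := fourier_apply_eq hv hk hσ
  let q := fun j => affComp (p j) (-1) (-1)
  constructor
  · refine vanishesToNatOrder_of_eq (u := w) (p := fun j => risingPoly k * affComp (q j) 1 k)
      (fun j => (hw j).1)
      (fun j => PowerBounded.exists_bound_near_zero (k := 0) (hw j)) fun f _ => ?_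
    change (𝓕 σ) (testToSchwartz (mulTest _ _ f)) = _
    rw [hF]
    refine Finset.sum_congr rfl fun j _ => ?_
    congr 1
    funext x
    have e : ⇑(testToSchwartz (mulTest (fun x : ℝ => (x : ℂ) ^ k) (contDiff_ofReal_pow k) f)) =
        fun x : ℝ => (x : ℂ) ^ k * f x := funext (testToSchwartz_mulTest_pow k f)
    rw [e, funext (eulerPoly_pow_mul k _ f.contDiff),
      iteratedDeriv_pow_mul k (contDiff_eulerPoly _ f.contDiff),
      eulerPoly_mul _ _ f.contDiff]
  -- At ∞: ∂^k = x^(-k) E(E-1)⋯(E-k+1), and x^(-k) provides the decay.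
  · refine exists_extension_of_powerBounded (k₀ := 0 + -k) (v := fun j x => w j x * (x : ℂ) ^ (-k : ℤ))
      (p := fun j => fallingPoly k * q j) (fun j => ?_) fun f _ => ?_
    · simpa using (hw j).mul_zpow (-k)
    rw [toDistr_apply, hF]
    refine Finset.sum_congr rfl fun j _ => integral_congr_ae (ae_ne_zero.mono fun x hx => ?_)
    have hx' : (x : ℂ) ^ k ≠ 0 := pow_ne_zero _ (by exact_mod_cast hx)
    simp only
    rw [eulerPoly_mul _ _ f.contDiff, ← pow_mul_iteratedDeriv k (contDiff_eulerPoly _ f.contDiff),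
      mul_assoc, zpow_neg, zpow_natCast, inv_mul_cancel_left₀ hx']
    rfl

theorem vanishesToOrder_neg_iff (T : Distr) (k : ℕ) :
    VanishesToOrder T (-((k + 1 : ℕ) : ℤ)) ↔ VanishesToNatOrder (mulPow (k + 1) T) 0 := Iff.rfl

/-- Every tempered distribution extends across `∞`. -/
theorem exists_extension (σ : 𝓢'(ℝ, ℂ)) : ∃ (k : ℕ) (T : Distr),
    IsExtensionAcrossInfinity (toDistr σ) T ∧ VanishesToOrder T (-((k + 1 : ℕ) : ℤ)) := by
  obtain ⟨K, ι, hι, v, p, hv, hS⟩ := exists_isEulerSum_off_zero (temperedCLM σ)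
  -- In the coordinate 1/x the coefficients are O(|x|^(-K)) near 0. Multiplying by x^(K+1) makes
  -- them locally bounded and keeps the exponent positive, as a negative order of vanishing
  -- requires.
  let k := K + 1
  let w : ι → ℝ → ℂ := fun j x => v j x⁻¹ * (x : ℂ) ^ (k : ℤ)
  let q := fun j => affComp (p j) (-1) (-2)
  have hw : ∀ j, PowerBounded 0 (-(K : ℤ) - k) (w j) := fun j =>
    ((hv j).comp_inv.mul_zpow k).mono (by simp [k]) le_rfl
  obtain ⟨L, hL⟩ := exists_clm_sum le_rfl hw fun j => affComp (q j) 1 k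
  -- L is the distribution that x^k T should be, so T is obtained by division by x^k. The ambiguity
  -- of the division at the origin is immaterial.
  obtain ⟨M, hM⟩ := exists_div_mulX_pow L k
  have hMf : ∀ f g : TestFun, (∀ x : ℝ, f x = (x : ℂ) ^ k * g x) →
      M (testToSchwartz f) = L (testToSchwartz g) := fun f g h => by
    rw [← hM]
    congr 1
    ext x
    rw [iterate_mulXCLM_apply]
    exact h x
  refine ⟨K, M.comp testToSchwartz, isExtensionAcrossInfinity_of fun f hf => ?_, ?_⟩
  · let h := mulOff _ (contDiffOn_inv_pow k) f hf
    have hfh : ∀ x : ℝ, f x = (x : ℂ) ^ k * h x := fun x => by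
      rw [mulOff_apply]
      by_cases hx : x = 0
      · rw [hx, apply_zero_of_notMem hf, zero_mul, mul_zero]
      · have hx' : (x : ℂ) ^ k ≠ 0 := pow_ne_zero _ (by exact_mod_cast hx)
        field_simp
    rw [ContinuousLinearMap.comp_apply, hMf f h hfh, hL]
    refine Eq.trans ?_ (hS _ (zero_notMem_tsupport_invTest f hf)).symm
    simp only [integral_mul_eulerPoly_invTest]
    refine Finset.sum_congr rfl fun j _ => ?_
    congr 1
    funext x
    have := eulerPoly_pow_mul k (q j) h.contDiff x
    rw [← funext hfh] at this
    rw [this]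
    simp only [w, zpow_natCast, mul_assoc]
    rfl
  · rw [vanishesToOrder_neg_iff]
    refine vanishesToNatOrder_of_eq (p := fun j => affComp (q j) 1 k) (fun j => (hw j).1)
      (fun j => PowerBounded.exists_bound_near_zero (k := 0) (hw j)) fun f _ => ?_
    change M (testToSchwartz _) = _
    rw [hMf _ f fun x => mul_comm _ _, hL]
    rfl

/-- The order of σ at ∞ is a fixed -(K+1), while its order at 0 may be taken as large as desired. A
fixed choice bounds the order of 𝓕 σ at 0, and a choice depending on s provides enough order at ∞.
-/
theorem mellin_fourier_of_vanishesToInfiniteOrder (δ : ZMod 2) (σ : 𝓢'(ℝ, ℂ))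
    (hσ : VanishesToInfiniteOrder (toDistr σ)) : ∃ A : ℝ, ∀ s : ℂ, A < s.re →
      MellinDefinedAt δ (toDistr σ) (1 - s) ∧ MellinDefinedAt δ (toDistr (𝓕 σ)) s ∧
      signedMellin δ (toDistr (𝓕 σ)) s =
        (-1 : ℂ) ^ δ.val * gammaFactor δ s * signedMellin δ (toDistr σ) (1 - s) := by
  obtain ⟨K, T, hT, hTK⟩ := exists_extension σ
  have rep : ∀ k : ℕ, ∃ (ι : Type) (_ : Fintype ι) (v : ι → ℝ → ℂ) (p : ι → ℂ[X]),
      (∀ j, PowerBounded k (-((K + 1 : ℕ) : ℤ)) (v j)) ∧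
      (∀ f ∈ OffZero, toDistr σ f = ∑ j, ∫ x, v j x * eulerPoly (p j) f x) ∧
      ∀ f : 𝓢(ℝ, ℂ), σ f = ∑ j, ∫ x, v j x * eulerPoly (p j) f x := fun k => by
    obtain ⟨ι, hι, v, p, hv, hS⟩ := isEulerSum_of_vanishesToOrder σ (k₀ := k) (hσ k) hT hTK
    exact ⟨ι, hι, v, p, hv, hS,
      apply_schwartz_of_offZero (Int.natCast_nonneg k) (hσ 0) hv hS⟩
  -- K + 3 is the least k with k - (K + 1) ≥ 2, the condition of `vanishesToOrder_fourier`. It is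
  -- also the abscissa A below.
  have h0 : VanishesToOrder (toDistr (𝓕 σ)) (-((K + 2 + 1 : ℕ) : ℤ)) := by
    obtain ⟨ι, hι, v, p, hv, -, hS⟩ := rep (K + 2 + 1)
    exact (vanishesToOrder_fourier hv (by push_cast; omega) hS).1
  refine ⟨K + 3, fun s hs => ?_⟩
  obtain ⟨k, hk⟩ := exists_nat_gt (s.re + (K + 3))
  have hK : (0 : ℝ) ≤ K := Nat.cast_nonneg K
  obtain ⟨ι, hι, v, p, hv, hS, hS'⟩ := rep k
  obtain ⟨-, T', hT', hTk⟩ := vanishesToOrder_fourier hv (by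
    have : (K : ℝ) + 3 < k := by linarith
    have : K + 3 < k := by exact_mod_cast this
    push_cast
    omega) hS'
  obtain ⟨κ, hκ, u, q, hu, hF⟩ := isEulerSum_of_vanishesToOrder (𝓕 σ) (k₁ := k) h0 hT' hTk
  have b1 : -((k : ℤ) : ℝ) < (1 - s).re := by simp; linarith
  have b2 : (1 - s).re < ((-((K + 1 : ℕ) : ℤ) : ℤ) : ℝ) := by simp; linarith
  have b3 : -((-((K + 2 + 1 : ℕ) : ℤ) : ℤ) : ℝ) < s.re := by
    push_cast
    linarith
  have b4 : s.re < ((k : ℤ) : ℝ) := by simp; linarith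
  have m1 := hasSignedMellin_mellinSum (k₀ := k) (hσ k) hT hTK δ b1 b2 hv hS
  have m2 := hasSignedMellin_mellinSum (k₁ := k) h0 hT' hTk δ b3 b4 hu hF
  refine ⟨m1.mellinDefinedAt, m2.mellinDefinedAt, ?_⟩
  rw [m1.signedMellin_eq, m2.signedMellin_eq]
  refine mellinSum_fourier hv hu hS' hF δ (by linarith) ?_ ?_ b3 b4
  · simpa using b1
  · simpa using b2

/-! ### Moments -/

/-- For |t| ≤ 1 this is the Taylor estimate. For |t| ≥ 1 the exponential and each of the m terms are
separately at most |t|^m. -/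
theorem exists_norm_exp_sub_taylor_le (m : ℕ) : ∃ C : ℝ, ∀ t : ℝ,
    ‖Complex.exp (t * Complex.I) - ∑ i ∈ Finset.range m, (t * Complex.I) ^ i / i.factorial‖ ≤
      C * |t| ^ m := by
  refine ⟨max (Real.exp 1) (1 + m), fun t => ?_⟩
  have hn : ‖(t : ℂ) * Complex.I‖ = |t| := by simp
  rcases le_total |t| 1 with h | h
  · refine (Complex.norm_exp_sub_sum_le_norm_mul_exp _ m).trans ?_
    rw [hn, mul_comm]
    gcongr
    exact (Real.exp_le_exp.2 h).trans (le_max_left _ _)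
  · have h1 : ‖∑ i ∈ Finset.range m, ((t : ℂ) * Complex.I) ^ i / i.factorial‖ ≤ m * |t| ^ m := by
      refine (norm_sum_le _ _).trans ?_
      rw [← nsmul_eq_mul]
      conv_rhs => rw [← Finset.card_range m]
      refine Finset.sum_le_card_nsmul _ _ _ fun i hi => ?_
      rw [norm_div, norm_pow, hn, Complex.norm_natCast]
      refine (div_le_self (by positivity) (by exact_mod_cast i.factorial_pos)).trans ?_
      exact pow_le_pow_right₀ h (by simpa using (Finset.mem_range.1 hi).le)
    have h2 : (1 : ℝ) ≤ |t| ^ m := one_le_pow₀ h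
    calc _ ≤ 1 + m * |t| ^ m :=
          (norm_sub_le _ _).trans (add_le_add (Complex.norm_exp_ofReal_mul_I t).le h1)
      _ ≤ (1 + m) * |t| ^ m := by linarith
      _ ≤ _ := by gcongr; exact le_max_right _ _

theorem integral_pow_mul_eulerPoly (i : ℕ) (q : ℂ[X]) (f : TestFun) :
    ∫ y : ℝ, (y : ℂ) ^ i * eulerPoly q f y =
      q.eval (-1 - (i : ℂ)) * ∫ y : ℝ, (y : ℂ) ^ i * f y := by
  let g := mulTest (fun x : ℝ => (x : ℂ) ^ i) (contDiff_ofReal_pow i) f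
  have e : ⇑(testToSchwartz g) = fun x : ℝ => (x : ℂ) ^ i * f x :=
    funext (testToSchwartz_mulTest_pow i f)
  have h := integral_eulerPoly (affComp q 1 (-i)) (testToSchwartz g)
  rw [e, funext (eulerPoly_pow_mul i _ f.contDiff), affComp_affComp, eval_affComp] at h
  simpa [affComp_one_zero, sub_eq_add_neg] using h

/-- Order m + 2 at ∞ makes v_j x^m integrable, so 𝓕 v_j has a Taylor expansion at 0 with remainder
O(|y|^m). After the Euler operators are applied and summed over j, the coefficient of y^i is a
constant times the i-th moment of σ, which is zero by hypothesis. -/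
theorem vanishesToNatOrder_fourier_of_moments {σ : 𝓢'(ℝ, ℂ)} {ι : Type} [Fintype ι]
    {v : ι → ℝ → ℂ} {p : ι → ℂ[X]} {k m : ℕ} (hv : ∀ j, PowerBounded k (m + 2 : ℕ) (v j))
    (hσ : ∀ f : 𝓢(ℝ, ℂ), σ f = ∑ j, ∫ x, v j x * eulerPoly (p j) f x)
    (h : ∀ i < m, ∑ j, (p j).eval (i : ℂ) * ∫ x, v j x * (x : ℂ) ^ i = 0) :
    VanishesToNatOrder (toDistr (𝓕 σ)) m := by
  obtain ⟨C, hC⟩ := exists_norm_exp_sub_taylor_le m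
  have hvi : ∀ j, ∀ i ≤ m, Integrable fun x => v j x * (x : ℂ) ^ i := fun j i hi => by
    have := ((hv j).mul_zpow i).integrable_of_lt (by omega) (by push_cast; omega)
    simpa using this
  have hv0 : ∀ j, Integrable (v j) := fun j => by simpa using hvi j 0 (Nat.zero_le m)
  let b : ℕ → ℂ := fun i => (-2 * Real.pi * Complex.I) ^ i / i.factorial
  -- The Taylor remainders serve as the new coefficients. An individual v_j may have nonzero
  -- moments; only the sum over j lets the Taylor polynomials drop out.
  let R : ι → ℝ → ℂ := fun j y => 𝓕 (v j) y -
    ∑ i ∈ Finset.range m, b i * (∫ x, v j x * (x : ℂ) ^ i) * (y : ℂ) ^ i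
  have hRc : ∀ j, Continuous (R j) := fun j => (continuous_fourier (hv0 j)).sub (by fun_prop)
  have hR : ∀ j y, R j y = ∫ x, v j x * (Complex.exp ((-2 * Real.pi * x * y : ℝ) * Complex.I) -
      ∑ i ∈ Finset.range m, ((-2 * Real.pi * x * y : ℝ) * Complex.I) ^ i / i.factorial) := by
    intro j y
    have h1 : ∀ x, v j x * (Complex.exp ((-2 * Real.pi * x * y : ℝ) * Complex.I) -
        ∑ i ∈ Finset.range m, ((-2 * Real.pi * x * y : ℝ) * Complex.I) ^ i / i.factorial) =
        v j x * Complex.exp ((-2 * Real.pi * x * y : ℝ) * Complex.I) -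
        ∑ i ∈ Finset.range m, b i * (v j x * (x : ℂ) ^ i) * (y : ℂ) ^ i := fun x => by
      rw [mul_sub, Finset.mul_sum]
      congr 1
      refine Finset.sum_congr rfl fun i _ => ?_
      simp only [b]
      push_cast
      ring
    have h2 : Integrable fun x => v j x * Complex.exp ((-2 * Real.pi * x * y : ℝ) * Complex.I) :=
      (hv0 j).mul_bdd (c := 1) (by fun_prop)
        (Eventually.of_forall fun x => (Complex.norm_exp_ofReal_mul_I _).le)
    have h3 : ∀ i ∈ Finset.range m, Integrable fun x => b i * (v j x * (x : ℂ) ^ i) * (y : ℂ) ^ i :=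
      fun i hi => ((hvi j i (Finset.mem_range.1 hi).le).const_mul _).mul_const _
    change 𝓕 (v j) y - _ = _
    rw [funext h1, integral_sub h2 (integrable_finsetSum _ h3), integral_finsetSum _ h3]
    congr 1
    · rw [Real.fourier_eq']
      congr 1
      funext x
      rw [smul_eq_mul, mul_comm]
      simp only [RCLike.inner_apply, conj_trivial]
      ring_nf
    · refine Finset.sum_congr rfl fun i _ => ?_
      rw [integral_mul_const, integral_const_mul]
  let q := fun j => affComp (p j) (-1) (-1)
  refine vanishesToNatOrder_of_eq (u := R) (p := q) (fun j => (hRc j).measurable) (fun j => ?_)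
    fun f _ => ?_
  · refine ⟨∫ x, ‖v j x * (x : ℂ) ^ m‖ * (C * (2 * Real.pi) ^ m), fun y _ _ => ?_⟩
    rw [hR, ← integral_mul_const]
    refine (norm_integral_le_integral_norm _).trans (integral_mono_of_nonneg
      (Eventually.of_forall fun _ => norm_nonneg _)
      (((hvi j m le_rfl).norm.mul_const _).mul_const _) (Eventually.of_forall fun x => ?_))
    simp only
    rw [norm_mul]
    refine (mul_le_mul_of_nonneg_left (hC _) (norm_nonneg _)).trans (le_of_eq ?_)
    rw [norm_mul, norm_pow, Complex.norm_real, Real.norm_eq_abs, abs_mul, abs_mul, abs_mul,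
      abs_neg, abs_two, abs_of_pos Real.pi_pos]
    ring
  · have hi1 : ∀ {u : ℝ → ℂ}, Continuous u → ∀ j, Integrable fun y => u y * eulerPoly (q j) f y :=
      fun hu j => (hu.mul (continuous_eulerPoly _ f.contDiff)).integrable_of_hasCompactSupport
        (hasCompactSupport_eulerPoly _ f.hasCompactSupport).mul_left
    have e1 : ∀ j, ∫ y, R j y * eulerPoly (q j) f y =
        (∫ x, v j x * eulerPoly (p j) (𝓕 (testToSchwartz f) : 𝓢(ℝ, ℂ)) x) -
        ∑ i ∈ Finset.range m, b i * ((p j).eval (i : ℂ) * ∫ x, v j x * (x : ℂ) ^ i) *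
          ∫ y : ℝ, (y : ℂ) ^ i * f y := by
      intro j
      simp only [R, sub_mul, Finset.sum_mul]
      have h3 : ∀ i ∈ Finset.range m, Integrable fun y : ℝ =>
          b i * (∫ x, v j x * (x : ℂ) ^ i) * (y : ℂ) ^ i * eulerPoly (q j) f y := fun i _ =>
        hi1 (by fun_prop) j
      rw [integral_sub (hi1 (continuous_fourier (hv0 j)) j) (integrable_finsetSum _ h3),
        integral_finsetSum _ h3]
      congr 1
      · rw [eulerPoly_fourier, integral_fourier_mul (hv0 j), coe_eulerPolySchwartz]
        rfl
      · refine Finset.sum_congr rfl fun i _ => ?_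
        simp only [mul_assoc]
        rw [integral_const_mul, integral_const_mul, integral_pow_mul_eulerPoly, eval_affComp]
        have : -1 * (-1 - (i : ℂ)) + -1 = i := by ring
        rw [this]
        ring
    simp only [e1]
    rw [Finset.sum_sub_distrib, toDistr_apply, TemperedDistribution.fourier_apply, hσ,
      Finset.sum_comm, eq_comm, sub_eq_self]
    refine Finset.sum_eq_zero fun i hi => ?_
    rw [← Finset.sum_mul, ← Finset.mul_sum, h i (Finset.mem_range.1 hi), mul_zero, zero_mul]

theorem signedPower_natCast (n : ℕ) {x : ℝ} (hx : x ≠ 0) : signedPower (n : ZMod 2) n x = (x : ℂ) ^ n := by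
  rw [signedPower, Complex.cpow_natCast, ZMod.val_natCast]
  have h2 : (Real.sign x : ℂ) ^ (n % 2) = (Real.sign x : ℂ) ^ n := by
    have hs : (Real.sign x : ℂ) ^ 2 = 1 := by
      rcases hx.lt_or_gt with h | h
      · rw [Real.sign_of_neg h]; norm_num
      · rw [Real.sign_of_pos h]; norm_num
    conv_rhs => rw [← Nat.mod_add_div n 2, pow_add, pow_mul, hs, one_pow, mul_one]
  rw [h2, ← mul_pow, ← Complex.ofReal_mul]
  congr 2
  rcases hx.lt_or_gt with h | h
  · rw [Real.sign_of_neg h, abs_of_neg h]; ring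
  · rw [Real.sign_of_pos h, abs_of_pos h]; ring

/-- When δ is the residue of n mod 2, (sgn x)^δ |x|^n = x^n, so these Mellin values are the moments
of σ. -/
theorem mellinSum_one_add_natCast {ι : Type} [Fintype ι] (v : ι → ℝ → ℂ) (p : ι → ℂ[X]) (n : ℕ) :
    mellinSum v p (n : ZMod 2) (1 + n) = ∑ j, (p j).eval (n : ℂ) * ∫ x, v j x * (x : ℂ) ^ n := by
  refine Finset.sum_congr rfl fun j _ => ?_
  rw [add_sub_cancel_left]
  congr 1
  refine integral_congr_ae (ae_ne_zero.mono fun x hx => ?_)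
  simp only
  rw [signedPower_natCast n hx]

theorem neg_one_pow_val_ne {δ δ' : ZMod 2} (h : δ ≠ δ') :
    (-1 : ℂ) ^ δ.val ≠ (-1 : ℂ) ^ δ'.val := by
  have key : ∀ δ δ' : ZMod 2, δ ≠ δ' → (δ.val = 0 ∧ δ'.val = 1) ∨ (δ.val = 1 ∧ δ'.val = 0) := by
    decide
  rcases key δ δ' h with ⟨h1, h2⟩ | ⟨h1, h2⟩ <;> rw [h1, h2] <;> norm_num

/-- With an even cutoff, the functions in the limit for δ' have parity δ', and σ of parity δ ≠ δ'
annihilates them. -/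
theorem mellinSum_eq_zero_of_hasParity {σ : 𝓢'(ℝ, ℂ)} {ι : Type} [Fintype ι] {v : ι → ℝ → ℂ}
    {p : ι → ℂ[X]} {k₀ k₁ : ℤ} {δ δ' : ZMod 2} (hδ : δ ≠ δ') (hp : HasParity δ σ)
    (hv : ∀ j, PowerBounded k₀ k₁ (v j))
    (hS : ∀ f ∈ OffZero, toDistr σ f = ∑ j, ∫ x, v j x * eulerPoly (p j) f x)
    {s : ℂ} (h₀ : -(k₀ : ℝ) < s.re) (h₁ : s.re < k₁) : mellinSum v p δ' s = 0 := by
  obtain ⟨φ, hφ, -, -, he⟩ := exists_cutoff one_pos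
  refine tendsto_nhds_unique (tendsto_mellinSum hv hS δ' h₀ h₁ hφ)
    (tendsto_const_nhds.congr fun n => ?_)
  let f := mulOff _ (contDiffOn_signedPower δ' (s - 1)) (annulus φ n)
    (zero_notMem_tsupport_annulus hφ n)
  have hf : ∀ x, ((-1 : ℂ) ^ δ'.val • testToSchwartz f) x = testToSchwartz f (-x) := fun x => by
    rw [smul_apply, smul_eq_mul]
    change _ * (annulus φ n x * signedPower δ' (s - 1) x) =
      annulus φ n (-x) * signedPower δ' (s - 1) (-x)
    rw [signedPower_neg, annulus_apply, annulus_apply, mul_neg, mul_neg, he, he]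
    ring
  have h := hp (testToSchwartz f) _ hf
  have h2 : σ ((-1 : ℂ) ^ δ'.val • testToSchwartz f) = (-1 : ℂ) ^ δ'.val * σ (testToSchwartz f) := by
    rw [map_smul, smul_eq_mul]
  rw [h2] at h
  by_contra hne
  exact neg_one_pow_val_ne hδ (mul_right_cancel₀ (Ne.symm hne) h).symm

/-! ### Poles of the gamma factor, and holomorphy of the Mellin transform. -/

/-- The entire factor in `G_δ = Γ · B_δ`. -/
def entireFactor (δ : ZMod 2) (s : ℂ) : ℂ :=
  2 * Complex.I ^ δ.val * (2 * Real.pi : ℂ) ^ (-s) *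
    Complex.cos (Real.pi * (s - (δ.val : ℂ)) / 2)

theorem gammaFactor_eq (δ : ZMod 2) (s : ℂ) :
    gammaFactor δ s = Complex.Gamma s * entireFactor δ s := by
  rw [gammaFactor, entireFactor]
  ring

theorem two_pi_ne_zero' : (2 * Real.pi : ℂ) ≠ 0 := by
  exact_mod_cast Real.two_pi_pos.ne'

theorem differentiable_entireFactor (δ : ZMod 2) : Differentiable ℂ (entireFactor δ) := by
  intro s
  have h : DifferentiableAt ℂ (fun s : ℂ => (2 * Real.pi : ℂ) ^ (-s)) s :=
    differentiableAt_id.neg.const_cpow (Or.inl two_pi_ne_zero')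
  unfold entireFactor
  fun_prop

/-- When δ ≡ n mod 2, the argument of the cosine at s = -n is an integer multiple of π. Hence G_δ
has a genuine pole there. -/
theorem entireFactor_neg_natCast_ne_zero (n : ℕ) : entireFactor (n : ZMod 2) (-n) ≠ 0 := by
  have hpi : (2 * Real.pi : ℂ) ^ (-(-(n : ℂ))) ≠ 0 := by
    rw [Complex.cpow_ne_zero_iff]
    exact Or.inl two_pi_ne_zero'
  have hcos : Complex.cos (Real.pi * (-(n : ℂ) - ((n : ZMod 2).val : ℂ)) / 2) ≠ 0 := by
    obtain ⟨m, hm⟩ : ∃ m : ℕ, n + n % 2 = 2 * m := ⟨(n + n % 2) / 2, by omega⟩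
    have h2 : (n : ℂ) + (n % 2 : ℕ) = 2 * m := by exact_mod_cast hm
    have e : (Real.pi * (-(n : ℂ) - ((n : ZMod 2).val : ℂ)) / 2 : ℂ) =
        ((-(m * Real.pi) : ℝ) : ℂ) := by
      rw [ZMod.val_natCast]
      push_cast
      linear_combination (-(Real.pi : ℂ) / 2) * h2
    rw [e, ← Complex.ofReal_cos, Real.cos_neg, Real.cos_nat_mul_pi]
    norm_num
  exact mul_ne_zero (mul_ne_zero (mul_ne_zero two_ne_zero (pow_ne_zero _ Complex.I_ne_zero)) hpi)
    hcos

/-- `Complex.Gamma` takes the default value 0 at its poles, so this removes exactly the points where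
`gammaFactor` carries that value. They are isolated because 1/Γ is entire and not identically zero.
-/
theorem eventually_gamma_ne_zero (s : ℂ) : ∀ᶠ z in 𝓝[≠] s, Complex.Gamma z ≠ 0 := by
  by_contra h
  have hf : ∃ᶠ z in 𝓝[≠] s, (Complex.Gamma z)⁻¹ = 0 := by
    refine (not_eventually.1 h).mono fun z hz => ?_
    rw [not_not.1 hz, inv_zero]
  have han : AnalyticOnNhd ℂ (fun z => (Complex.Gamma z)⁻¹) Set.univ :=
    Complex.differentiable_one_div_Gamma.differentiableOn.analyticOnNhd isOpen_univ
  have := han.eqOn_zero_of_preconnected_of_frequently_eq_zero isPreconnected_univ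
    (Set.mem_univ s) hf (Set.mem_univ 1)
  simp at this

/-- A single formula for σ serves the whole strip, so near s the transform coincides with one
holomorphic `mellinSum`. -/
theorem differentiableAt_signedMellin {σ : 𝓢'(ℝ, ℂ)} {T : Distr} {k₀ k₁ : ℤ}
    (h₀ : VanishesToOrder (toDistr σ) k₀) (hT : IsExtensionAcrossInfinity (toDistr σ) T)
    (h₁ : VanishesToOrder T k₁) (δ : ZMod 2) {s : ℂ} (hs₀ : -(k₀ : ℝ) < s.re) (hs₁ : s.re < k₁) :
    DifferentiableAt ℂ (signedMellin δ (toDistr σ)) s := by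
  obtain ⟨ι, hι, v, p, hv, hS⟩ := isEulerSum_of_vanishesToOrder σ h₀ hT h₁
  refine (differentiableAt_mellinSum (p := p) hv δ hs₀ hs₁).congr_of_eventuallyEq ?_
  filter_upwards [(isOpen_lt continuous_const Complex.continuous_re).mem_nhds hs₀,
    (isOpen_lt Complex.continuous_re continuous_const).mem_nhds hs₁] with z h1 h2
  exact (hasSignedMellin_mellinSum h₀ hT h₁ δ h1 h2 hv hS).signedMellin_eq

theorem isOpen_re_lt_one : IsOpen {z : ℂ | z.re < 1} :=
  isOpen_lt Complex.continuous_re continuous_const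

/-! ### Distributions that extend canonically across ∞. -/

section Canonical

variable {σ : 𝓢'(ℝ, ℂ)} {k₀ : ℕ}

theorem exists_isEulerSum_of_extendsCanonically (hc : ExtendsCanonically (toDistr σ))
    (hσ : VanishesToNatOrder (toDistr σ) k₀) (n : ℕ) :
    ∃ (ι : Type) (_ : Fintype ι) (v : ι → ℝ → ℂ) (p : ι → ℂ[X]),
      (∀ j, PowerBounded k₀ n (v j)) ∧
      (∀ f ∈ OffZero, toDistr σ f = ∑ j, ∫ x, v j x * eulerPoly (p j) f x) ∧
      (∀ f : 𝓢(ℝ, ℂ), σ f = ∑ j, ∫ x, v j x * eulerPoly (p j) f x) ∧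
      ∀ (δ : ZMod 2) (s : ℂ), -(k₀ : ℝ) < s.re → s.re < n →
        HasSignedMellin δ (toDistr σ) s (mellinSum v p δ s) := by
  obtain ⟨T, hT, hTi⟩ := hc
  obtain ⟨ι, hι, v, p, hv, hS⟩ := isEulerSum_of_vanishesToOrder σ (k₀ := k₀) (k₁ := n) hσ hT
    (hTi n)
  exact ⟨ι, hι, v, p, hv, hS, apply_schwartz_of_offZero (Int.natCast_nonneg _)
    (hσ.mono (Nat.zero_le _)) hv hS, fun δ s h₀ h₁ =>
    hasSignedMellin_mellinSum (k₀ := k₀) (k₁ := n) hσ hT (hTi n) δ h₀ h₁ hv hS⟩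

theorem mellinDefinedAt_of_extendsCanonically (hc : ExtendsCanonically (toDistr σ))
    (hσ : VanishesToNatOrder (toDistr σ) k₀) (δ : ZMod 2) {s : ℂ} (hs : -(k₀ : ℝ) < s.re) :
    MellinDefinedAt δ (toDistr σ) s := by
  obtain ⟨n, hn⟩ := exists_nat_gt s.re
  obtain ⟨ι, hι, v, p, -, -, -, h⟩ := exists_isEulerSum_of_extendsCanonically hc hσ n
  exact (h δ s hs hn).mellinDefinedAt

theorem differentiableAt_signedMellin_of_extendsCanonically
    (hc : ExtendsCanonically (toDistr σ)) (hσ : VanishesToNatOrder (toDistr σ) k₀) (δ : ZMod 2)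
    {s : ℂ} (hs : -(k₀ : ℝ) < s.re) : DifferentiableAt ℂ (signedMellin δ (toDistr σ)) s := by
  obtain ⟨n, hn⟩ := exists_nat_gt s.re
  obtain ⟨T, hT, hTi⟩ := hc
  exact differentiableAt_signedMellin (k₀ := k₀) (k₁ := n) hσ hT (hTi n) δ hs hn

theorem differentiableAt_signedMellin_one_sub (hc : ExtendsCanonically (toDistr σ))
    (hσ : VanishesToNatOrder (toDistr σ) k₀) (δ : ZMod 2) {s : ℂ} (hs : s.re < 1) :
    DifferentiableAt ℂ (fun z => signedMellin δ (toDistr σ) (1 - z)) s := by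
  refine (differentiableAt_signedMellin_of_extendsCanonically hc hσ δ (s := 1 - s) ?_).comp s
    (f := fun z : ℂ => 1 - z) (by fun_prop)
  have : (0 : ℝ) ≤ k₀ := Nat.cast_nonneg _
  simp
  linarith

theorem exists_extension_fourier (hc : ExtendsCanonically (toDistr σ)) (hk : 1 ≤ k₀)
    (hσ : VanishesToNatOrder (toDistr σ) k₀) : ∃ T,
      IsExtensionAcrossInfinity (toDistr (𝓕 σ)) T ∧ VanishesToNatOrder T k₀ := by
  obtain ⟨ι, hι, v, p, hv, -, hS, -⟩ := exists_isEulerSum_of_extendsCanonically hc hσ 1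
  exact (vanishesToOrder_fourier hv (by omega) hS).2

/-- The dilation argument gives the identity on the strip 0 < Re z < 1, within the range of both
transforms since 𝓕 σ has order k₀ ≥ 1 at ∞. It is then continued to the left. -/
theorem mellin_fourier_of_extendsCanonically (δ : ZMod 2) (hc : ExtendsCanonically (toDistr σ))
    (hk : 1 ≤ k₀) (hσ : VanishesToNatOrder (toDistr σ) k₀)
    (hF : VanishesToInfiniteOrder (toDistr (𝓕 σ))) :
    (∀ s : ℂ, s.re < 1 → MellinDefinedAt δ (toDistr (𝓕 σ)) s) ∧
    DifferentiableOn ℂ (signedMellin δ (toDistr (𝓕 σ))) {z | z.re < 1} ∧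
    ∀ s : ℂ, s.re < 1 → Complex.Gamma s ≠ 0 → signedMellin δ (toDistr (𝓕 σ)) s =
      (-1 : ℂ) ^ δ.val * gammaFactor δ s * signedMellin δ (toDistr σ) (1 - s) := by
  obtain ⟨T, hT, hTk⟩ := exists_extension_fourier hc hk hσ
  have hk' : (1 : ℝ) ≤ k₀ := by exact_mod_cast hk
  have hlt : ∀ {s : ℂ}, s.re < 1 → s.re < ((k₀ : ℤ) : ℝ) := fun h => by
    push_cast
    linarith
  have hn : ∀ s : ℂ, ∃ n : ℕ, -((n : ℤ) : ℝ) < s.re := fun s => by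
    obtain ⟨n, hn⟩ := exists_nat_gt (-s.re)
    exact ⟨n, by push_cast; linarith⟩
  have hdiff : DifferentiableOn ℂ (signedMellin δ (toDistr (𝓕 σ))) {z | z.re < 1} := fun s hs => by
    obtain ⟨n, hn⟩ := hn s
    exact (differentiableAt_signedMellin (k₀ := n) (k₁ := k₀) (hF n) hT hTk δ hn
      (hlt hs)).differentiableWithinAt
  refine ⟨fun s hs => ?_, hdiff, fun s hs hΓ => ?_⟩
  · obtain ⟨n, hn⟩ := hn s
    exact mellinDefinedAt_of_vanishesToOrder (k₀ := n) (k₁ := k₀) (hF n) hT hTk δ hn (hlt hs)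
  have hloc : ∀ z : ℂ, 0 < z.re → z.re < 1 → signedMellin δ (toDistr (𝓕 σ)) z =
      (-1 : ℂ) ^ δ.val * gammaFactor δ z * signedMellin δ (toDistr σ) (1 - z) := by
    intro z h0 h1
    obtain ⟨ι, hι, v, p, hv, -, hS, hM⟩ := exists_isEulerSum_of_extendsCanonically hc hσ 1
    obtain ⟨κ, hκ, u, q, hu, hq⟩ :=
      isEulerSum_of_vanishesToOrder (𝓕 σ) (k₀ := (0 : ℕ)) (k₁ := k₀) (hF 0) hT hTk
    rw [(hM δ (1 - z) (by simp; linarith) (by simp; linarith)).signedMellin_eq,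
      (hasSignedMellin_mellinSum (k₀ := (0 : ℕ)) (k₁ := k₀) (hF 0) hT hTk δ (by simpa using h0)
        (hlt h1) hu hq).signedMellin_eq]
    exact mellinSum_fourier hv hu hS hq δ h0 (by push_cast; linarith) (by push_cast; linarith)
      (by simpa using h0) (hlt h1)
  have han1 : AnalyticOnNhd ℂ (fun z => signedMellin δ (toDistr (𝓕 σ)) z * (Complex.Gamma z)⁻¹)
      {z | z.re < 1} := (hdiff.mul
    Complex.differentiable_one_div_Gamma.differentiableOn).analyticOnNhd isOpen_re_lt_one
  have han2 : AnalyticOnNhd ℂ (fun z => (-1 : ℂ) ^ δ.val * entireFactor δ z *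
      signedMellin δ (toDistr σ) (1 - z)) {z | z.re < 1} := by
    refine DifferentiableOn.analyticOnNhd (fun z hz => ?_) isOpen_re_lt_one
    exact (((differentiable_entireFactor δ z).const_mul _).mul
      (differentiableAt_signedMellin_one_sub hc hσ δ hz)).differentiableWithinAt
  have hmem : (1 / 2 : ℂ) ∈ {z : ℂ | z.re < 1} := by norm_num
  -- Multiplied by 1/Γ, both sides are holomorphic on the whole half plane, so the identity theorem
  -- applies from the point 1/2.
  have heq := han1.eqOn_of_preconnected_of_eventuallyEq han2
    (convex_halfSpace_re_lt 1).isPreconnected hmem (by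
      have h1 : {z : ℂ | 0 < z.re} ∈ 𝓝 (1 / 2 : ℂ) :=
        (isOpen_lt continuous_const Complex.continuous_re).mem_nhds (by norm_num)
      filter_upwards [h1, isOpen_re_lt_one.mem_nhds hmem] with z hz0 hz1
      rw [hloc z hz0 hz1, gammaFactor_eq]
      have := Complex.Gamma_ne_zero_of_re_pos hz0
      field_simp) hs
  simp only at heq
  rw [gammaFactor_eq, mul_left_comm, mul_assoc, ← heq]
  field_simp

theorem isRegularOn_of_vanishesToInfiniteOrder (δ : ZMod 2) (hc : ExtendsCanonically (toDistr σ))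
    (hk : 1 ≤ k₀) (hσ : VanishesToNatOrder (toDistr σ) k₀)
    (hF : VanishesToInfiniteOrder (toDistr (𝓕 σ))) :
    IsRegularOn (fun z => gammaFactor δ z * signedMellin δ (toDistr σ) (1 - z))
      {z : ℂ | z.re < 1} := by
  intro s hs
  obtain ⟨-, hd, h⟩ := mellin_fourier_of_extendsCanonically δ hc hk hσ hF
  have han : AnalyticAt ℂ (fun z => (-1 : ℂ) ^ δ.val * signedMellin δ (toDistr (𝓕 σ)) z) s :=
    (hd.const_mul _).analyticAt (isOpen_re_lt_one.mem_nhds hs)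
  have e : (fun z => (-1 : ℂ) ^ δ.val * signedMellin δ (toDistr (𝓕 σ)) z) =ᶠ[𝓝[≠] s]
      fun z => gammaFactor δ z * signedMellin δ (toDistr σ) (1 - z) := by
    filter_upwards [eventually_gamma_ne_zero s,
      nhdsWithin_le_nhds (isOpen_re_lt_one.mem_nhds hs)] with z hz hz1
    rw [h z hz1 hz, mul_assoc, ← mul_assoc, ← mul_pow]
    norm_num
  exact ⟨han.meromorphicAt.congr e, meromorphicOrderAt_congr e ▸ han.meromorphicOrderAt_nonneg⟩

/-- Regularity at -i gives G_δ(z) M_δσ(1-z) a finite limit. Multiplied by 1/Γ(z) → 0 it tends to 0,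
but this product is the entire factor times M_δσ(1-z). The entire factor is nonzero at -i when i ≡
δ, so the i-th moment vanishes; for the other i parity is used. -/
theorem vanishesToInfiniteOrder_of_isRegularOn {δ : ZMod 2} (hp : HasParity δ σ)
    (hc : ExtendsCanonically (toDistr σ)) (hσ : VanishesToNatOrder (toDistr σ) k₀)
    (h : IsRegularOn (fun z => gammaFactor δ z * signedMellin δ (toDistr σ) (1 - z))
      {z : ℂ | z.re < 1}) : VanishesToInfiniteOrder (toDistr (𝓕 σ)) := by
  intro m
  obtain ⟨ι, hι, v, p, hv, hO, hS, hM⟩ := exists_isEulerSum_of_extendsCanonically hc hσ (m + 2)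
  refine vanishesToNatOrder_fourier_of_moments hv hS fun i hi => ?_
  have hk0 : (0 : ℝ) ≤ k₀ := Nat.cast_nonneg _
  have hi0 : (0 : ℝ) ≤ i := Nat.cast_nonneg _
  have him : (i : ℝ) < m := by exact_mod_cast hi
  have b0 : -(k₀ : ℝ) < (1 + (i : ℂ)).re := by simp; linarith
  have b1 : (1 + (i : ℂ)).re < (m + 2 : ℕ) := by simp; linarith
  rw [← mellinSum_one_add_natCast]
  by_cases hδ : δ = (i : ZMod 2)
  · have hmem : (-(i : ℂ)) ∈ {z : ℂ | z.re < 1} := by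
      simp
      linarith
    obtain ⟨hmer, hord⟩ := h _ hmem
    obtain ⟨c, hc'⟩ := tendsto_nhds_of_meromorphicOrderAt_nonneg hmer hord
    have hΓ : Tendsto (fun z => (Complex.Gamma z)⁻¹) (𝓝[≠] (-(i : ℂ))) (𝓝 0) := by
      have := (Complex.differentiable_one_div_Gamma.continuous.tendsto (-(i : ℂ))).mono_left
        (nhdsWithin_le_nhds (s := {-(i : ℂ)}ᶜ))
      rwa [Complex.Gamma_neg_nat_eq_zero, inv_zero] at this
    have h1 := hc'.mul hΓ
    have h2 : Tendsto (fun z => entireFactor δ z * signedMellin δ (toDistr σ) (1 - z))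
        (𝓝[≠] (-(i : ℂ)))
        (𝓝 (entireFactor δ (-(i : ℂ)) * signedMellin δ (toDistr σ) (1 - (-(i : ℂ))))) :=
      ((differentiable_entireFactor δ).continuous.continuousAt.mul
        (differentiableAt_signedMellin_one_sub hc hσ δ hmem).continuousAt).tendsto.mono_left
        nhdsWithin_le_nhds
    have h3 := tendsto_nhds_unique_of_eventuallyEq h1 h2 (by
      filter_upwards [eventually_gamma_ne_zero (-(i : ℂ))] with z hz
      rw [gammaFactor_eq]
      field_simp)
    rw [mul_zero, sub_neg_eq_add, (hM δ _ b0 b1).signedMellin_eq] at h3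
    subst hδ
    exact (mul_eq_zero.1 h3.symm).resolve_left (entireFactor_neg_natCast_ne_zero i)
  · exact mellinSum_eq_zero_of_hasParity hδ hp hv hO (by simpa using b0) (by simpa using b1)

end Canonical

end SignedMellin

end

theorem mainTheorem3 :
    (∀ (δ : ZMod 2) (σ : 𝓢'(ℝ, ℂ)), VanishesToInfiniteOrder (toDistr σ) →
      ∃ A : ℝ, ∀ s : ℂ, A < s.re →
        MellinDefinedAt δ (toDistr σ) (1 - s) ∧
        MellinDefinedAt δ (toDistr (𝓕 σ)) s ∧
        signedMellin δ (toDistr (𝓕 σ)) s =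
          (-1 : ℂ) ^ δ.val * gammaFactor δ s * signedMellin δ (toDistr σ) (1 - s)) ∧
    (∀ (δ : ZMod 2) (σ : 𝓢'(ℝ, ℂ)) (k₀ : ℕ), HasParity δ σ →
      ExtendsCanonically (toDistr σ) → 1 ≤ k₀ → VanishesToNatOrder (toDistr σ) k₀ →
      (∀ s : ℂ, s.re < 1 → MellinDefinedAt δ (toDistr σ) (1 - s)) ∧
      (VanishesToInfiniteOrder (toDistr (𝓕 σ)) ↔
        IsRegularOn (fun z => gammaFactor δ z * signedMellin δ (toDistr σ) (1 - z))
          {z : ℂ | z.re < 1}) ∧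
      (VanishesToInfiniteOrder (toDistr (𝓕 σ)) → ∀ s : ℂ, s.re < 1 →
        MellinDefinedAt δ (toDistr (𝓕 σ)) s ∧
        Tendsto (fun z => (-1 : ℂ) ^ δ.val * gammaFactor δ z *
            signedMellin δ (toDistr σ) (1 - z)) (𝓝[≠] s)
          (𝓝 (signedMellin δ (toDistr (𝓕 σ)) s)) ∧
        ((∀ n : ℕ, s ≠ -(n : ℂ)) →
          signedMellin δ (toDistr (𝓕 σ)) s =
            (-1 : ℂ) ^ δ.val * gammaFactor δ s * signedMellin δ (toDistr σ) (1 - s)))) := by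
  refine ⟨mellin_fourier_of_vanishesToInfiniteOrder, fun δ σ k₀ hp hc hk hσ =>
    ⟨fun s hs => mellinDefinedAt_of_extendsCanonically hc hσ δ ?_,
      ⟨isRegularOn_of_vanishesToInfiniteOrder δ hc hk hσ,
        vanishesToInfiniteOrder_of_isRegularOn hp hc hσ⟩, fun hF s hs => ?_⟩⟩
  · have : (0 : ℝ) ≤ k₀ := Nat.cast_nonneg _
    rw [Complex.sub_re, Complex.one_re]
    linarith
  · obtain ⟨hM, hd, h⟩ := mellin_fourier_of_extendsCanonically δ hc hk hσ hF
    -- The left hand side is continuous at s and equals the right hand side on a punctured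
    -- neighborhood, which gives the limit also at the non-positive integers.
    refine ⟨hM s hs, ?_, fun hn => h s hs (Complex.Gamma_ne_zero hn)⟩
    have hs' := isOpen_re_lt_one.mem_nhds hs
    refine ((hd.differentiableAt hs').continuousAt.tendsto.mono_left nhdsWithin_le_nhds).congr' ?_
    filter_upwards [eventually_gamma_ne_zero s, nhdsWithin_le_nhds hs'] with z hz hz1
    exact h z hz1 hz
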